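/- **Theorem 3.2.** Let $\mathcal H$ be an infinite-dimensional separable complex Hilbert space, let $n\ge 1$, and let $\Omega\subset\mathbb C$ be a bounded, open, simply connected set (in particular nonempty and connected). Then there exists $T\in\mathcal{NCFB}_n(\Omega)$ such that 1. $T$ is strongly irreducible, i.e. every bounded idempotent operator commuting with $T$ is $0$ or $I$; 2. $\sigma(T)=\overline{\Omega}$ and $\rho_F(T)\cap\sigma(T)=\Omega$, where $\rho_F(T)=\{w\in\mathbb C: w-T \text{ is Fredholm}\}$; 3. $\operatorname{ind}(w-T)=\dim\ker(w-T)-\dim\bigl(\mathcal H/\operatorname{Ran}(w-T)\bigr)=n$ for all $w\in\Omega$. In particular, $\mathcal{NCFB}_n(\Omega)\neq\emptyset$. Here the notions are as follows. For a Hilbert space $\mathcal E$, $\mathcal B_n(\Omega)$ is the set of bounded operators $S$ on $\mathcal E$ such that, for every $w\in\Omega$, $S-w$ is surjective and $\dim\ker(S-w)=n$, and such that $\bigcup_{w\in\Omega}\ker(S-w)$ spans a dense subspace of $\mathcal E$. Given bounded idempotents $P_1,\dots,P_n$ on $\mathcal H$ with $\sum_jP_j=I$ and $P_kP_j=0$ for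 $k\ne j$, put $\mathcal H_j=\operatorname{Ran}P_j$ and let $T_{k,j}=P_kT|_{\mathcal H_j}:\mathcal H_j\to\mathcal H_k$ be the entries of the operator matrix of $T$. The operator $T$ is in $\mathcal{CFB}_n(\Omega)$ with respect to $\mathcal H=\mathcal H_1\dotplus\cdots\dotplus\mathcal H_n$ if * $T\in\mathcal B_n(\Omega)$, $T_{k,j}=0$ for $k>j$, and $T_{j,j}\in\mathcal B_1(\Omega)$ for all $j$; * the diagonal $\operatorname{Diag}T=\sum_jP_jTP_j$ commutes with $T$; * for $1\le k\le j\le n$ there is a bounded operator $C_{k,j}$ on $\mathcal H_k$ commuting with $T_{k,k}$ such that $T_{k,j}=C_{k,j}T_{k,k+1}T_{k+1,k+2}\cdots T_{j-1,j}$ (the empty product being the identity); * for $1\le j\le n-1$ the pair $(T_{j,j},T_{j+1,j+1})$ has Property (H): if a bounded $X:\mathcal H_{j+1}\to\mathcal H_j$ satisfies $T_{j,j}X=XT_{j+1,j+1}$ and $X=T_{j,j}Z-ZT_{j+1,j+1}$ for some bounded $Z:\mathcal H_{j+1}\to\mathcal H_j$, then $X=0$. Finally, $\mathcal{NCFB}_n(\Omega)$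 is the set of bounded operators $T$ on $\mathcal H$ that are essentially normal ($T^*T-TT^*$ is compact) and are in $\mathcal{CFB}_n(\Omega)$ with respect to a decomposition given by idempotents $P_1,\dots,P_n$ as above for which every $P_j^*-P_j$ is compact. -/

import Mathlib

noncomputable section

namespace EssCowenDouglas

/-- The Cowen-Douglas class `B_n(Ω)` on a space `E`: for every `w ∈ Ω` the operator `T - w` is onto
and has an `n`-dimensional kernel, and these kernels together span a dense subspace. -/
structure IsCowenDouglas {E : Type*} [NormedAddCommGroup E] [NormedSpace ℂ E]
    (n : ℕ) (Ω : Set ℂ) (T : E →L[ℂ] E) : Prop where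
  surj : ∀ w ∈ Ω, Function.Surjective (T - w • (1 : E →L[ℂ] E))
  dim_ker : ∀ w ∈ Ω, Module.rank ℂ (T - w • (1 : E →L[ℂ] E)).ker = (n : Cardinal)
  span_ker : (⨆ w ∈ Ω, (T - w • (1 : E →L[ℂ] E)).ker).topologicalClosure = ⊤

/-- Property (H) of the ordered pair `(T₁, T₂)`: an operator `X` with `T₁ X = X T₂` which is of the
form `T₁ Z - Z T₂` must vanish. -/
def PropertyH {E₁ E₂ : Type*} [NormedAddCommGroup E₁] [NormedSpace ℂ E₁]
    [NormedAddCommGroup E₂] [NormedSpace ℂ E₂]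
    (T₁ : E₁ →L[ℂ] E₁) (T₂ : E₂ →L[ℂ] E₂) : Prop :=
  ∀ X : E₂ →L[ℂ] E₁, T₁ ∘L X = X ∘L T₂ →
    (∃ Z : E₂ →L[ℂ] E₁, X = T₁ ∘L Z - Z ∘L T₂) → X = 0

variable {H : Type*} [NormedAddCommGroup H] [InnerProductSpace ℂ H]

/-- Idempotents `P_1, …, P_n` with `P_k P_j = 0` for `k ≠ j` and `∑ P_j = I`. Such families are the
same thing as topological direct decompositions `H = Ran P_1 ∔ ⋯ ∔ Ran P_n`. -/
structure IsDecomposition {n : ℕ} (P : Fin n → H →L[ℂ] H) : Prop where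
  idem : ∀ j, P j * P j = P j
  mul_eq_zero : ∀ k j, k ≠ j → P k * P j = 0
  sum_eq_one : ∑ j, P j = 1

/-- The `(k, j)` entry `Ran P_j → Ran P_k` of the operator matrix of `T` with respect to the
decomposition `H = Ran P_1 ∔ ⋯ ∔ Ran P_n`, that is, `x ↦ P_k T x`. -/
def block {n : ℕ} (P : Fin n → H →L[ℂ] H) (T : H →L[ℂ] H) (k j : Fin n) :
    (P j).range →L[ℂ] (P k).range :=
  (P k).rangeRestrict ∘L T ∘L (P j).range.subtypeL

/-- The product `T_{k,k+1} T_{k+1,k+2} ⋯ T_{j-1,j}` of `d` superdiagonal entries, where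
`j = k + d`. For `d = 0` it is the identity of `Ran P_k`, written as the `(k, k)` entry of `I`. -/
def superdiagProd {n : ℕ} (P : Fin n → H →L[ℂ] H) (T : H →L[ℂ] H) :
    (d : ℕ) → (k j : Fin n) → (k : ℕ) + d = (j : ℕ) → ((P j).range →L[ℂ] (P k).range)
  | 0, k, j, _ => block P 1 k j
  | d + 1, k, j, h =>
      block P T k ⟨(k : ℕ) + 1, by omega⟩ ∘L
        superdiagProd P T d ⟨(k : ℕ) + 1, by omega⟩ j (by simp only; omega)

/-- The diagonal `Diag T` of the operator matrix of `T`, as an operator on `H`. -/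
def diagPart {n : ℕ} (P : Fin n → H →L[ℂ] H) (T : H →L[ℂ] H) : H →L[ℂ] H :=
  ∑ j, P j * T * P j

/-- `T ∈ CFB_n(Ω)` with respect to the topological direct decomposition
`H = Ran P_1 ∔ ⋯ ∔ Ran P_n`. The diagonal entries are in `B_1(Ω)`, as always for matrix forms of
Cowen-Douglas operators in this theory. -/
structure IsCFBWith {n : ℕ} (Ω : Set ℂ) (P : Fin n → H →L[ℂ] H) (T : H →L[ℂ] H) : Prop where
  cowenDouglas : IsCowenDouglas n Ω T
  decomposition : IsDecomposition P
  diag_cowenDouglas : ∀ j, IsCowenDouglas 1 Ω (block P T j j)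
  upperTriangular : ∀ k j, j < k → block P T k j = 0
  diag_commute : Commute (diagPart P T) T
  factor : ∀ (k j : Fin n) (hkj : k ≤ j), ∃ C : (P k).range →L[ℂ] (P k).range,
    Commute C (block P T k k) ∧
      block P T k j =
        C ∘L superdiagProd P T ((j : ℕ) - k) k j (Nat.add_sub_of_le (Fin.le_def.mp hkj))
  propertyH : ∀ k j : Fin n, (k : ℕ) + 1 = j → PropertyH (block P T k k) (block P T j j)

/-- Two operators with the same image in the Calkin algebra. -/
def EqModCompact (A B : H →L[ℂ] H) : Prop := IsCompactOperator (A - B)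

/-- `T` is essentially normal: its image in the Calkin algebra is normal. -/
def IsEssNormal [CompleteSpace H] (T : H →L[ℂ] H) : Prop := EqModCompact (star T * T) (T * star T)

/-- The class `NCFB_n(Ω)`: essentially normal operators which are in `CFB_n(Ω)` with respect to a
decomposition given by idempotents whose images in the Calkin algebra are self-adjoint. -/
def NCFB (H : Type*) [NormedAddCommGroup H] [InnerProductSpace ℂ H] [CompleteSpace H]
    (n : ℕ) (Ω : Set ℂ) : Set (H →L[ℂ] H) :=
  {T | IsEssNormal T ∧
    ∃ P : Fin n → H →L[ℂ] H, (∀ j, EqModCompact (star (P j)) (P j)) ∧ IsCFBWith Ω P T}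

/-- `T` is strongly irreducible: its commutant has no nontrivial idempotent. -/
def IsStronglyIrreducible (T : H →L[ℂ] H) : Prop :=
  ∀ E : H →L[ℂ] H, E * E = E → Commute E T → E = 0 ∨ E = 1

/-- The Fredholm domain `ρ_F(T)`. -/
def fredholmDomain (T : H →L[ℂ] H) : Set ℂ :=
  {w | (w • (1 : H →L[ℂ] H) - T).IsFredholm}

/-- The Fredholm index `dim Ker A - dim (H / Ran A)`, meaningful for Fredholm operators `A`. -/
def fredholmIndex (A : H →L[ℂ] H) : ℤ :=
  (Module.finrank ℂ A.ker : ℤ) - (Module.finrank ℂ (H ⧸ A.range) : ℤ)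

end EssCowenDouglas

end

/-! Write Ω = φ(𝔻) with φ a Riemann map. Since Ω is bounded, the area formula gives φ a finite
Dirichlet integral, that is, ∑ k|a_k|² < ∞ for its Taylor coefficients. All compactness and rigidity
below comes from this one fact.

For 0 ≤ p ≤ 1/4 let A_p be the coanalytic Toeplitz operator with symbol φ, conjugated by the weights
(i+1)^p (`wToeplitz`). The vectors k_p(z) = (z^i/(i+1)^p)_i satisfy A_p k_p(z) = φ(z) k_p(z) and
span a dense subspace, so operator identities can be checked on symbols. The quotient (φ(u) -
φ(z))/(u - z) is bounded, bounded below and of finite Dirichlet integral; hence A_p - φ(z) is an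
invertible operator times (weighted backward shift - z), and A_p lies in B_1(Ω). The Dirichlet
integral also makes A_p a compact perturbation of the unweighted Toeplitz operator A
(`exists_weightedToeplitz`), and A essentially normal (`isCompactOperator_toeplitz_selfCommutator`).

The operator T has A_{p_0}, …, A_{p_{n-1}} on the diagonal, where p_j = p_{j+1} + s with s > 0, and
D = diag((i+1)^{-s}) on the superdiagonal. As D k_q(z) = k_{q+s}(z), the injective compact operator
D satisfies A_{p_j} D = D A_{p_{j+1}}. The exponents have to differ: an operator commuting with A_p
multiplies k_p(z) by a bounded holomorphic function, and compactness would force that function to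
vanish at the circle. Modulo compacts T is n copies of A, so it is essentially normal. Back
substitution along the bidiagonal matrix gives the spectrum, the kernels and the index; at boundary
points of Ω the normalized kernel vectors are approximate eigenvectors without a convergent
subsequence, which excludes Fredholmness.

The hard point is Property (H), `eq_zero_of_intertwines`. If A_p X = X A_q, then X k_q(z) = c(z)
k_p(z) with c holomorphic. If also X = A_p Z - Z A_q, pairing with an approximate eigenvector of
A_p* bounds |c|² by a defect whose mean over the circle of radius r is O(√(1 - r²) ∑ k|a_k|²).
Letting r → 1 gives c = 0.

Property (H), available for every pair of exponents, shows by induction that each entry of an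
operator E commuting with T intertwines the diagonal entries. Then D E_{i+1,j+1} = E_{i,j} D, and
the first column of E vanishes below the diagonal. For an idempotent E the symbol of E_{0,0} takes
values in {0, 1} and is constant on the disc; the value 0 forces E = 0, and passing to 1 - E settles
the value 1. -/

section

open Filter Metric Set
open scoped Topology

/-! ### The Riemann mapping theorem for bounded simply connected domains -/

namespace RiemannMapping

/-- Hurwitz: near an isolated zero of a locally uniform limit, the approximants have zeros. -/
theorem eventually_exists_zero {ι : Type*} {l : Filter ι} {F : ι → ℂ → ℂ} {f : ℂ → ℂ} {U : Set ℂ}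
    (hU : IsOpen U) (hF : ∀ n, DifferentiableOn ℂ (F n) U) (hlim : TendstoLocallyUniformlyOn F f l U)
    (hf : DifferentiableOn ℂ f U) {b : ℂ} (hb : b ∈ U) (hfb : f b = 0)
    (hne : ¬ ∀ᶠ z in 𝓝 b, f z = 0) {V : Set ℂ} (hV : V ∈ 𝓝 b) :
    ∀ᶠ n in l, ∃ z ∈ V ∩ U, F n z = 0 := by
  have han : AnalyticAt ℂ f b := hf.analyticAt (hU.mem_nhds hb)
  have hiso := (han.eventually_eq_zero_or_eventually_ne_zero).resolve_left hne
  rw [eventually_nhdsWithin_iff] at hiso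
  obtain ⟨r, hr, hball⟩ := Metric.nhds_basis_closedBall.mem_iff.1
    (inter_mem (inter_mem hV (hU.mem_nhds hb)) hiso)
  have hsub : closedBall b r ⊆ U := fun z hz => (hball hz).1.2
  have hcont : ContinuousOn f (sphere b r) := hf.continuousOn.mono (sphere_subset_closedBall.trans hsub)
  obtain ⟨z₀, hz₀, hmin⟩ := (isCompact_sphere b r).exists_isMinOn
    (NormedSpace.sphere_nonempty.2 hr.le) hcont.norm
  have hz₀ne : f z₀ ≠ 0 := (hball (sphere_subset_closedBall hz₀)).2 (by
    rintro rfl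
    simp [hr.ne] at hz₀)
  set ε := ‖f z₀‖ with hε
  have hεpos : 0 < ε := norm_pos_iff.2 hz₀ne
  have huni := (tendstoLocallyUniformlyOn_iff_forall_isCompact hU).1 hlim _ hsub
    (isCompact_closedBall b r)
  -- With error ε/3 a zero-free approximant has modulus at least 2ε/3 on the circle but less than
  -- ε/3 at the centre, against the maximum principle for its reciprocal.
  filter_upwards [Metric.tendstoUniformlyOn_iff.1 huni (ε / 3) (by positivity)] with n hn
  by_contra! hcon
  have hne0 : ∀ z ∈ closedBall b r, F n z ≠ 0 := fun z hz => hcon z ⟨(hball hz).1.1, hsub hz⟩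
  have hd : DifferentiableOn ℂ (fun z => (F n z)⁻¹) (closedBall b r) :=
    ((hF n).mono hsub).inv hne0
  have hle : ‖(F n b)⁻¹‖ ≤ (2 * ε / 3)⁻¹ := by
    refine Complex.norm_le_of_forall_mem_frontier_norm_le (U := ball b r)
      (f := fun z => (F n z)⁻¹) (z := b) isBounded_ball
      (DifferentiableOn.diffContOnCl (by rwa [closure_ball _ hr.ne'])) ?_
      (subset_closure (mem_ball_self hr))
    intro z hz
    rw [frontier_ball _ hr.ne'] at hz
    have h1 : ε ≤ ‖f z‖ := hmin hz
    have h2 := hn z (sphere_subset_closedBall hz)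
    rw [dist_eq_norm] at h2
    have h3 := norm_sub_norm_le (f z) (F n z)
    rw [norm_inv]
    exact inv_anti₀ (by positivity) (by linarith)
  have h2 := hn b (mem_closedBall_self hr.le)
  rw [hfb, dist_zero_left] at h2
  rw [norm_inv] at hle
  have h4 := (inv_le_inv₀ (norm_pos_iff.2 (hne0 b (mem_closedBall_self hr.le)))
    (by positivity)).1 hle
  linarith

/-- The competitors in the extremal problem: injective holomorphic maps into the unit disc. -/
structure Competitor (U : Set ℂ) (f : ℂ → ℂ) : Prop where
  diff : DifferentiableOn ℂ f U
  mapsTo : MapsTo f U (ball 0 1)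
  inj : InjOn f U
  deriv_ne : ∀ z ∈ U, deriv f z ≠ 0

/-- Continuous functions on `U` bounded by one with the modulus of continuity of holomorphic maps
into the disc. -/
def equicontSet (U : Set ℂ) : Set C(U, ℂ) :=
  {f | (∀ x, f x ∈ closedBall (0 : ℂ) 1) ∧ ∀ (x y : U) (R : ℝ), ball (x : ℂ) R ⊆ U →
    (y : ℂ) ∈ ball (x : ℂ) R → dist (f y) (f x) ≤ 2 / R * dist (y : ℂ) x}

/-- Arzelà–Ascoli in the role of Montel's theorem. The conditions defining the set are pointwise and
closed, so its image in the product of closed discs is compact, and the common Lipschitz bound 2/R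
near a point gives equicontinuity. -/
theorem isCompact_equicontSet {U : Set ℂ} (hU : IsOpen U) : IsCompact (equicontSet U) := by
  have hcontr : ∀ f : U → ℂ, (∀ (x y : U) (R : ℝ), ball (x : ℂ) R ⊆ U →
      (y : ℂ) ∈ ball (x : ℂ) R → dist (f y) (f x) ≤ 2 / R * dist (y : ℂ) x) → Continuous f := by
    intro f hf
    rw [continuous_iff_continuousAt]
    intro x
    obtain ⟨R, hR, hsub⟩ := Metric.isOpen_iff.1 hU x x.2
    rw [ContinuousAt, tendsto_iff_dist_tendsto_zero]
    have hlim : Tendsto (fun y : U => 2 / R * dist (y : ℂ) x) (𝓝 x) (𝓝 0) := by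
      have : Continuous fun y : U => 2 / R * dist (y : ℂ) x := by fun_prop
      simpa using this.tendsto x
    refine squeeze_zero' (Eventually.of_forall fun _ => dist_nonneg) ?_ hlim
    filter_upwards [ball_mem_nhds x hR] with y hy
    exact hf x y R hsub hy
  refine ArzelaAscoli.isCompact_of_equicontinuous _ ?_ ?_
  · have himg : ContinuousMap.toFun '' equicontSet U = {f : U → ℂ |
        (∀ x, f x ∈ closedBall (0 : ℂ) 1) ∧ ∀ (x y : U) (R : ℝ), ball (x : ℂ) R ⊆ U →
        (y : ℂ) ∈ ball (x : ℂ) R → dist (f y) (f x) ≤ 2 / R * dist (y : ℂ) x} := by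
      ext f
      constructor
      · rintro ⟨g, hg, rfl⟩
        exact hg
      · intro hf
        exact ⟨⟨f, hcontr f hf.2⟩, hf, rfl⟩
    rw [himg]
    refine IsCompact.of_isClosed_subset
      (isCompact_univ_pi fun _ : U => isCompact_closedBall (0 : ℂ) 1) ?_
      (fun f hf x _ => hf.1 x)
    simp only [ ofPred_and, ofPred_forall]
    refine IsClosed.inter (isClosed_iInter fun x => ?_) (isClosed_iInter fun x =>
      isClosed_iInter fun y => isClosed_iInter fun R => isClosed_iInter fun _ =>
        isClosed_iInter fun _ => ?_)
    · exact isClosed_closedBall.preimage (continuous_apply x)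
    · exact isClosed_le (by fun_prop) continuous_const
  · intro x
    rw [Metric.equicontinuousAt_iff]
    intro ε hε
    obtain ⟨R, hR, hsub⟩ := Metric.isOpen_iff.1 hU x x.2
    refine ⟨min R (ε * R / 2), by positivity, fun y hy f => ?_⟩
    have hyR : (y : ℂ) ∈ ball (x : ℂ) R := lt_of_lt_of_le hy (min_le_left _ _)
    have h1 := f.2.2 x y R hsub hyR
    have h2 : dist (y : ℂ) x < ε * R / 2 := lt_of_lt_of_le hy (min_le_right _ _)
    rw [dist_comm]
    calc dist (f.1 y) (f.1 x) ≤ 2 / R * dist (y : ℂ) x := h1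
      _ < 2 / R * (ε * R / 2) := by gcongr
      _ = ε := by field_simp

theorem Competitor.restrict_mem {U : Set ℂ} {f : ℂ → ℂ} (hf : Competitor U f) :
    (⟨U.domRestrict f, hf.diff.continuousOn.domRestrict⟩ : C(U, ℂ)) ∈ equicontSet U := by
  refine ⟨fun x => ball_subset_closedBall (hf.mapsTo x.2), fun x y R hsub hy => ?_⟩
  refine Complex.dist_le_div_mul_dist_of_mapsTo_ball (hf.diff.mono hsub) ?_ hy
  intro z hz
  have h1 := hf.mapsTo (hsub hz)
  have h2 := hf.mapsTo x.2
  rw [mem_ball_zero_iff] at h1 h2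
  rw [mem_closedBall, dist_eq_norm]
  exact (norm_sub_le _ _).trans (by linarith)

theorem norm_deriv_le {U : Set ℂ} {R : ℝ} (hR : 0 < R) {z₀ : ℂ} (hsub : ball z₀ R ⊆ U)
    {f : ℂ → ℂ} (hf : Competitor U f) : ‖deriv f z₀‖ ≤ 2 / R := by
  refine Complex.norm_deriv_le_div_of_mapsTo_ball (hf.diff.mono hsub) ?_ hR
  intro z hz
  have h1 := hf.mapsTo (hsub hz)
  have h2 := hf.mapsTo (hsub (mem_ball_self hR))
  rw [mem_ball_zero_iff] at h1 h2
  rw [mem_closedBall, dist_eq_norm]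
  exact (norm_sub_le _ _).trans (by linarith)

/-- A maximizing sequence converges locally uniformly along an ultrafilter, which avoids extracting
subsequences, and derivatives converge with it. The limit is not constant because its derivative at
z₀ dominates that of `f₀`. Hence the maximum principle keeps its values in the open disc, and
Hurwitz passes on injectivity and the nonvanishing of the derivative. -/
theorem exists_extremal {U : Set ℂ} (hU : IsOpen U) (hc : IsPreconnected U) {z₀ : ℂ} (hz₀ : z₀ ∈ U)
    {f₀ : ℂ → ℂ} (hf₀ : Competitor U f₀) :
    ∃ f, Competitor U f ∧ ∀ g, Competitor U g → ‖deriv g z₀‖ ≤ ‖deriv f z₀‖ := by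
  obtain ⟨R, hR, hRU⟩ := Metric.isOpen_iff.1 hU z₀ hz₀
  set S : Set ℝ := {t | ∃ f, Competitor U f ∧ t = ‖deriv f z₀‖} with hS
  have hbdd : BddAbove S := ⟨2 / R, by rintro t ⟨f, hf, rfl⟩; exact norm_deriv_le hR hRU hf⟩
  have hSne : S.Nonempty := ⟨_, f₀, hf₀, rfl⟩
  obtain ⟨u, -, hu, huS⟩ := exists_seq_tendsto_sSup hSne hbdd
  choose F hF hFu using huS
  let l : Filter ℕ := hyperfilter ℕ
  have hl : l ≤ atTop := Nat.hyperfilter_le_atTop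
  obtain ⟨G, hG, hlimG⟩ := (isCompact_equicontSet hU).ultrafilter_le_nhds
    ((hyperfilter ℕ).map fun n =>
      (⟨U.domRestrict (F n), (hF n).diff.continuousOn.domRestrict⟩ : C(U, ℂ)))
    (by
      rw [le_principal_iff, Ultrafilter.coe_map, Filter.mem_map]
      exact Filter.Eventually.of_forall fun n : ℕ => (hF n).restrict_mem)
  have hlimG' : Tendsto (fun n =>
      (⟨U.domRestrict (F n), (hF n).diff.continuousOn.domRestrict⟩ : C(U, ℂ))) l (𝓝 G) := hlimG
  obtain ⟨f, hfG⟩ : ∃ f : ℂ → ℂ, ∀ x : U, f x = G x := by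
    classical
    exact ⟨fun z => if h : z ∈ U then G ⟨z, h⟩ else 0, fun x => by simp⟩
  have hlim : TendstoLocallyUniformlyOn F f l U := by
    rw [tendstoLocallyUniformlyOn_iff_tendstoLocallyUniformly_comp_coe]
    have := hU.locallyCompactSpace
    have := ContinuousMap.tendsto_iff_tendstoLocallyUniformly.1 hlimG'
    have hfG' : f ∘ ((↑) : U → ℂ) = G := funext hfG
    rw [hfG']
    exact this
  have hfd : DifferentiableOn ℂ f U := hlim.differentiableOn
    (Eventually.of_forall fun n => (hF n).diff) hU
  have hlimd := hlim.deriv (Eventually.of_forall fun n => (hF n).diff) hU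
  have hfM : ‖deriv f z₀‖ = sSup S := by
    refine tendsto_nhds_unique (hlimd.tendsto_at hz₀).norm ?_
    have : (fun n => ‖(deriv ∘ F) n z₀‖) = u := by
      ext n
      rw [hFu n]
      rfl
    rw [this]
    exact hu.mono_left hl
  have hmax : ∀ g, Competitor U g → ‖deriv g z₀‖ ≤ ‖deriv f z₀‖ := fun g hg => by
    rw [hfM]
    exact le_csSup hbdd ⟨g, hg, rfl⟩
  have hder : deriv f z₀ ≠ 0 := by
    rw [← norm_pos_iff]
    exact (norm_pos_iff.2 (hf₀.deriv_ne z₀ hz₀)).trans_le (hmax f₀ hf₀)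
  have hnc : ∀ b ∈ U, ∀ c : ℂ, ¬ ∀ᶠ z in 𝓝 b, f z = c := by
    intro b hb c hbc
    have heq : EqOn f (fun _ => c) U := (hfd.analyticOnNhd hU).eqOn_of_preconnected_of_eventuallyEq
      (analyticOnNhd_const) hc hb hbc
    apply hder
    have : f =ᶠ[𝓝 z₀] fun _ => c := heq.eventuallyEq_of_mem (hU.mem_nhds hz₀)
    rw [this.deriv_eq, deriv_const]
  refine ⟨f, ⟨hfd, ?_, ?_, ?_⟩, hmax⟩
  · have hle : ∀ z ∈ U, ‖f z‖ ≤ 1 := fun z hz => by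
      have := hG.1 ⟨z, hz⟩
      rw [← hfG] at this
      simpa using this
    intro z hz
    rw [mem_ball_zero_iff]
    refine lt_of_le_of_ne (hle z hz) fun h1 => ?_
    have hloc : IsLocalMax (norm ∘ f) z := by
      filter_upwards [hU.mem_nhds hz] with w hw
      simp only [Function.comp, h1]
      exact hle w hw
    refine hnc z hz (f z) (Complex.eventually_eq_of_isLocalMax_norm ?_ hloc)
    filter_upwards [hU.mem_nhds hz] with w hw
    exact (hfd w hw).differentiableAt (hU.mem_nhds hw)
  · intro a ha b hb hab
    by_contra hne
    obtain ⟨V, hV, W, hW, hVW⟩ : ∃ V ∈ 𝓝 b, ∃ W ∈ 𝓝 a, Disjoint V W :=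
      ⟨_, (t2_separation_nhds (Ne.symm hne)).choose_spec.choose_spec.1, _,
        (t2_separation_nhds (Ne.symm hne)).choose_spec.choose_spec.2.1,
        (t2_separation_nhds (Ne.symm hne)).choose_spec.choose_spec.2.2⟩
    have hlim' : TendstoLocallyUniformlyOn (fun n z => F n z - F n a) (fun z => f z - f a) l U := by
      have hpt := Metric.tendsto_nhds.1 (hlim.tendsto_at ha)
      rw [Metric.tendstoLocallyUniformlyOn_iff] at hlim ⊢
      intro ε hε x hx
      obtain ⟨t, ht, h⟩ := hlim (ε / 2) (by positivity) x hx
      refine ⟨t, ht, ?_⟩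
      filter_upwards [h, hpt (ε / 2) (by positivity)] with n hn hna y hy
      have h1 := hn y hy
      rw [dist_eq_norm] at h1 hna ⊢
      calc ‖f y - f a - (F n y - F n a)‖ = ‖(f y - F n y) + (F n a - f a)‖ := by ring_nf
        _ ≤ ‖f y - F n y‖ + ‖F n a - f a‖ := norm_add_le _ _
        _ < ε := by linarith
    have := eventually_exists_zero hU (fun n => (hF n).diff.sub_const _) hlim' (hfd.sub_const _) hb
      (by simp [hab]) (fun h => hnc b hb (f a) (h.mono fun z hz => sub_eq_zero.1 hz)) hV
    obtain ⟨n, z, hz, hz0⟩ := this.exists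
    have : z = a := (hF n).inj hz.2 ha (sub_eq_zero.1 hz0)
    exact hVW.notMem_of_mem_left hz.1 (this ▸ mem_of_mem_nhds hW)
  · intro z hz h0
    by_cases hev : ∀ᶠ w in 𝓝 z, deriv f w = 0
    · have heq := (hfd.analyticOnNhd hU).deriv.eqOn_zero_of_preconnected_of_eventuallyEq_zero
        hc hz hev
      exact hder (heq hz₀)
    · have := eventually_exists_zero hU (F := deriv ∘ F) (fun n => (hF n).diff.deriv hU) hlimd
        (hfd.deriv hU) hz h0 hev univ_mem
      obtain ⟨n, w, hw, hw0⟩ := this.exists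
      exact (hF n).deriv_ne w hw.2 hw0


/-- The disc automorphism sending `c` to `0`, composed with `f`. -/
noncomputable def moebius (c : ℂ) (f : ℂ → ℂ) (z : ℂ) : ℂ := (f z - c) / (1 - starRingEnd ℂ c * f z)

theorem one_sub_conj_mul_ne {c w : ℂ} (hc : ‖c‖ < 1) (hw : ‖w‖ < 1) :
    1 - starRingEnd ℂ c * w ≠ 0 := by
  intro h
  have h1 : starRingEnd ℂ c * w = 1 := (sub_eq_zero.1 h).symm
  have h2 : ‖starRingEnd ℂ c * w‖ = 1 := by rw [h1, norm_one]
  rw [norm_mul, RCLike.norm_conj] at h2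
  nlinarith [norm_nonneg c, norm_nonneg w]

theorem one_sub_conj_mul_self (c : ℂ) : 1 - starRingEnd ℂ c * c = ((1 - ‖c‖ ^ 2 : ℝ) : ℂ) := by
  rw [mul_comm, Complex.mul_conj, Complex.normSq_eq_norm_sq]
  push_cast
  ring

theorem hasDerivAt_moebius {c : ℂ} {f : ℂ → ℂ} {f' z : ℂ} (hc : ‖c‖ < 1) (hfz : ‖f z‖ < 1)
    (hf : HasDerivAt f f' z) :
    HasDerivAt (moebius c f)
      ((1 - starRingEnd ℂ c * c) * f' / (1 - starRingEnd ℂ c * f z) ^ 2) z := by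
  have h := (hf.sub_const c).div ((hf.const_mul (starRingEnd ℂ c)).const_sub 1)
    (one_sub_conj_mul_ne hc hfz)
  refine h.congr_deriv ?_
  ring

theorem Competitor.hasDerivAt {U : Set ℂ} (hU : IsOpen U) {f : ℂ → ℂ} (hf : Competitor U f)
    {z : ℂ} (hz : z ∈ U) : HasDerivAt f (deriv f z) z :=
  ((hf.diff z hz).differentiableAt (hU.mem_nhds hz)).hasDerivAt

theorem Competitor.norm_lt {U : Set ℂ} {f : ℂ → ℂ} (hf : Competitor U f)
    {z : ℂ} (hz : z ∈ U) : ‖f z‖ < 1 := mem_ball_zero_iff.1 (hf.mapsTo hz)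

theorem Competitor.deriv_moebius {U : Set ℂ} (hU : IsOpen U) {f : ℂ → ℂ} (hf : Competitor U f)
    {c : ℂ} (hc : ‖c‖ < 1) {z : ℂ} (hz : z ∈ U) : deriv (moebius c f) z =
      (1 - starRingEnd ℂ c * c) * deriv f z / (1 - starRingEnd ℂ c * f z) ^ 2 :=
  (hasDerivAt_moebius hc (hf.norm_lt hz) (hf.hasDerivAt hU hz)).deriv

theorem Competitor.moebius {U : Set ℂ} (hU : IsOpen U) {f : ℂ → ℂ} (hf : Competitor U f)
    {c : ℂ} (hc : ‖c‖ < 1) : Competitor U (moebius c f) := by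
  have hcc : 1 - starRingEnd ℂ c * c ≠ 0 := one_sub_conj_mul_ne hc hc
  refine ⟨fun z hz => ((hasDerivAt_moebius hc (hf.norm_lt hz)
    (hf.hasDerivAt hU hz)).differentiableAt).differentiableWithinAt, ?_, ?_, ?_⟩
  · intro z hz
    have hw := hf.norm_lt hz
    have hne := one_sub_conj_mul_ne hc hw
    rw [mem_ball_zero_iff, RiemannMapping.moebius, norm_div, div_lt_one (norm_pos_iff.2 hne),
      ← sq_lt_sq₀ (norm_nonneg _) (norm_nonneg _), ← Complex.normSq_eq_norm_sq,
      ← Complex.normSq_eq_norm_sq]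
    have h1 : Complex.normSq c < 1 := by rw [Complex.normSq_eq_norm_sq]; nlinarith [norm_nonneg c]
    have h2 : Complex.normSq (f z) < 1 := by
      rw [Complex.normSq_eq_norm_sq]; nlinarith [norm_nonneg (f z)]
    rw [Complex.normSq_apply] at *
    simp only [Complex.sub_re, Complex.sub_im, Complex.one_re, Complex.one_im, Complex.mul_re,
      Complex.mul_im, Complex.conj_re, Complex.conj_im, Complex.normSq_apply] at *
    nlinarith [mul_pos (sub_pos.2 h1) (sub_pos.2 h2)]
  · intro a ha b hb hab
    have h1 := one_sub_conj_mul_ne hc (hf.norm_lt ha)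
    have h2 := one_sub_conj_mul_ne hc (hf.norm_lt hb)
    rw [RiemannMapping.moebius, RiemannMapping.moebius, div_eq_div_iff h1 h2] at hab
    have : (1 - starRingEnd ℂ c * c) * (f a - f b) = 0 := by linear_combination hab
    exact hf.inj ha hb (sub_eq_zero.1 ((mul_eq_zero.1 this).resolve_left hcc))
  · intro z hz
    rw [hf.deriv_moebius hU hc hz]
    exact div_ne_zero (mul_ne_zero hcc (hf.deriv_ne z hz))
      (pow_ne_zero 2 (one_sub_conj_mul_ne hc (hf.norm_lt hz)))

/-- The slope of `h` is the slope of g = h² divided by h(y) + h(z), so a merely continuous square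
root is differentiable wherever it is nonzero. -/
theorem hasDerivAt_of_sq_eq {h g : ℂ → ℂ} {g' z : ℂ} (hsq : ∀ x, h x ^ 2 = g x)
    (hcont : ContinuousAt h z) (hz : h z ≠ 0) (hg : HasDerivAt g g' z) :
    HasDerivAt h (g' / (2 * h z)) z := by
  rw [hasDerivAt_iff_tendsto_slope] at hg ⊢
  have hsum : Tendsto (fun y => h y + h z) (𝓝[≠] z) (𝓝 (2 * h z)) := by
    rw [two_mul]
    exact (hcont.tendsto.mono_left nhdsWithin_le_nhds).add_const _
  have hne : ∀ᶠ y in 𝓝[≠] z, h y + h z ≠ 0 := hsum.eventually_ne (by simpa using hz)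
  refine (hg.div hsum (by simpa using hz)).congr' ?_
  filter_upwards [hne] with y hy
  simp only [slope_def_field, Pi.div_apply]
  rw [← hsq y, ← hsq z]
  field_simp
  ring

/-- Koebe's square root trick. Recentring a competitor g by a disc automorphism improves the
extremal inequality to |g'(z₀)| ≤ (1 - |g(z₀)|²)|f'(z₀)|, and in particular f(z₀) = 0. If f omits w,
let h be a square root of the automorphism of w composed with f, and t = |h(z₀)|, so that t² = |w|.
The inequality for h reads (1 - t⁴)/(2t) ≤ 1 - t², that is (1 - t)² ≤ 0, while t < 1. -/
theorem image_extremal_eq {U : Set ℂ} (hU : IsOpen U) (hs : IsSimplyConnected U) {z₀ : ℂ}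
    (hz₀ : z₀ ∈ U) {f : ℂ → ℂ} (hf : Competitor U f)
    (hmax : ∀ g, Competitor U g → ‖deriv g z₀‖ ≤ ‖deriv f z₀‖) : f '' U = ball 0 1 := by
  have hf0 := hf.norm_lt hz₀
  have hd : 0 < ‖deriv f z₀‖ := norm_pos_iff.2 (hf.deriv_ne z₀ hz₀)
  have hgain : ∀ g, Competitor U g → ‖deriv g z₀‖ ≤ (1 - ‖g z₀‖ ^ 2) * ‖deriv f z₀‖ := by
    intro g hg
    have hg0 := hg.norm_lt hz₀
    have h1 := hmax _ (hg.moebius hU hg0)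
    have hpos : 0 < 1 - ‖g z₀‖ ^ 2 := by nlinarith [norm_nonneg (g z₀)]
    rw [hg.deriv_moebius hU hg0 hz₀, one_sub_conj_mul_self, norm_div, norm_mul, norm_pow,
      Complex.norm_real, Real.norm_of_nonneg hpos.le, div_le_iff₀ (by positivity)] at h1
    nlinarith
  have hfz : f z₀ = 0 := by
    have h1 := hgain f hf
    have : ‖f z₀‖ ^ 2 ≤ 0 := by nlinarith
    exact norm_eq_zero.1 (pow_eq_zero_iff two_ne_zero |>.1 (le_antisymm this (sq_nonneg _)))
  refine Subset.antisymm (image_subset_iff.2 hf.mapsTo) fun w hw => ?_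
  by_contra hwU
  have hw1 : ‖w‖ < 1 := mem_ball_zero_iff.1 hw
  have hg := hf.moebius hU hw1
  have hg0 : (0 : ℂ) ∉ moebius w f '' U := by
    rintro ⟨z, hz, h0⟩
    rcases div_eq_zero_iff.1 h0 with h | h
    · exact hwU ⟨z, hz, sub_eq_zero.1 h⟩
    · exact one_sub_conj_mul_ne hw1 (hf.norm_lt hz) h
  obtain ⟨h, hcont, hsq⟩ := Complex.exists_continuousOn_pow_eq hs hU hg.diff.continuousOn hg0
    two_ne_zero
  have hne : ∀ z ∈ U, h z ≠ 0 := fun z hz h0 => hg0 ⟨z, hz, by rw [← hsq, h0]; simp⟩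
  have hder : ∀ z ∈ U, HasDerivAt h (deriv (moebius w f) z / (2 * h z)) z := fun z hz =>
    hasDerivAt_of_sq_eq hsq (hcont.continuousAt (hU.mem_nhds hz)) (hne z hz) (hg.hasDerivAt hU hz)
  have hh : Competitor U h := by
    refine ⟨fun z hz => (hder z hz).differentiableAt.differentiableWithinAt, ?_, ?_, ?_⟩
    · intro z hz
      have := hg.norm_lt hz
      rw [← hsq, norm_pow] at this
      rw [mem_ball_zero_iff]
      by_contra! h1
      nlinarith
    · intro a ha b hb hab
      exact hg.inj ha hb (by rw [← hsq, ← hsq, hab])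
    · intro z hz
      rw [(hder z hz).deriv]
      exact div_ne_zero (hg.deriv_ne z hz) (mul_ne_zero two_ne_zero (hne z hz))
  have h1 := hgain h hh
  rw [(hder z₀ hz₀).deriv, hf.deriv_moebius hU hw1 hz₀, hfz, mul_zero, sub_zero, one_pow, div_one,
    one_sub_conj_mul_self, norm_div, norm_mul, norm_mul, Complex.norm_real, Complex.norm_ofNat,
    Real.norm_of_nonneg (by nlinarith [norm_nonneg w])] at h1
  have ht : ‖h z₀‖ ^ 2 = ‖w‖ := by
    rw [← norm_pow, hsq, RiemannMapping.moebius, hfz]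
    simp
  have htpos : 0 < ‖h z₀‖ := norm_pos_iff.2 (hne z₀ hz₀)
  have hlt : ‖h z₀‖ < 1 := hh.norm_lt hz₀
  set t := ‖h z₀‖
  rw [← ht, div_le_iff₀ (by positivity)] at h1
  have h3 : 0 < 1 - t ^ 2 := by nlinarith
  have h2 : (1 - t ^ 2) * ‖deriv f z₀‖ * (1 - t) ^ 2 ≤ 0 := by nlinarith
  have h4 : 0 < (1 - t) ^ 2 := by
    have : 0 < 1 - t := by linarith
    positivity
  exact absurd h2 (not_le.2 (by positivity))

/-- **Riemann mapping theorem** for bounded domains, as a map from the unit disc. -/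
theorem exists_riemannMap {U : Set ℂ} (hU : IsOpen U) (hb : Bornology.IsBounded U)
    (hs : IsSimplyConnected U) :
    ∃ φ : ℂ → ℂ, DifferentiableOn ℂ φ (ball 0 1) ∧ InjOn φ (ball 0 1) ∧
      (∀ z ∈ ball (0 : ℂ) 1, deriv φ z ≠ 0) ∧ φ '' ball 0 1 = U := by
  obtain ⟨z₀, hz₀⟩ := hs.nonempty
  obtain ⟨R, hR, hUR⟩ := hb.subset_ball_lt 0 0
  have hRc : (R : ℂ) ≠ 0 := by exact_mod_cast hR.ne'
  have hf₀ : Competitor U fun z => z / R := by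
    refine ⟨by fun_prop, fun z hz => ?_, fun a _ b _ hab => ?_, fun z _ => ?_⟩
    · have := hUR hz
      rw [mem_ball_zero_iff] at this ⊢
      rw [norm_div, Complex.norm_real, Real.norm_of_nonneg hR.le]
      exact (div_lt_one hR).2 this
    · field_simp at hab
      exact hab
    · simp [hRc]
  obtain ⟨f, hf, hmax⟩ := exists_extremal hU hs.isPathConnected.isConnected.isPreconnected hz₀ hf₀
  have himg := image_extremal_eq hU hs hz₀ hf hmax
  have hbij : BijOn f U (ball 0 1) := ⟨hf.mapsTo, hf.inj, himg.ge⟩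
  have hinv : InvOn (Function.invFunOn f U) f U (ball 0 1) := hbij.invOn_invFunOn
  -- Near f(z) the global inverse coincides with the local inverse of the inverse function theorem,
  -- because the latter takes values in U, where f is injective.
  have hder : ∀ y ∈ ball (0 : ℂ) 1, ∃ d ≠ 0, HasDerivAt (Function.invFunOn f U) d y := by
    rw [← himg]
    rintro _ ⟨z, hz, rfl⟩
    have hst : HasStrictDerivAt f (deriv f z) z :=
      (hf.diff.analyticAt (hU.mem_nhds hz)).hasStrictDerivAt
    have hne := hf.deriv_ne z hz
    set g := hst.localInverse f (deriv f z) z hne with hgdef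
    have hgd : HasStrictDerivAt g (deriv f z)⁻¹ (f z) := hst.to_localInverse hne
    have hgz : g (f z) = z :=
      (hst.hasStrictFDerivAt_equiv hne).eventually_left_inverse.self_of_nhds
    have hright : ∀ᶠ y in 𝓝 (f z), f (g y) = y :=
      (hst.hasStrictFDerivAt_equiv hne).eventually_right_inverse
    have hgU : ∀ᶠ y in 𝓝 (f z), g y ∈ U :=
      hgd.hasDerivAt.continuousAt.eventually_mem (by rw [hgz]; exact hU.mem_nhds hz)
    have : Function.invFunOn f U =ᶠ[𝓝 (f z)] g := by
      filter_upwards [hright, hgU] with y hy hyU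
      conv_lhs => rw [← hy]
      exact hinv.1 hyU
    exact ⟨_, inv_ne_zero hne, hgd.hasDerivAt.congr_of_eventuallyEq this⟩
  refine ⟨Function.invFunOn f U, fun y hy => ?_, hinv.2.injOn, fun y hy => ?_, ?_⟩
  · obtain ⟨d, -, hd⟩ := hder y hy
    exact hd.differentiableAt.differentiableWithinAt
  · obtain ⟨d, hd0, hd⟩ := hder y hy
    rwa [hd.deriv]
  · rw [← himg]
    exact hinv.1.image_image

end RiemannMapping

end

/-! ### Functions with finite Dirichlet integral on the disc -/

section

open Filter Metric Set MeasureTheory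
open scoped Topology ENNReal

namespace DiscDirichlet

/-- Parseval's identity for absolutely convergent power series on a circle. -/
theorem lintegral_norm_sq_tsum {b : ℕ → ℂ} (hb : Summable fun n => ‖b n‖) :
    ∫⁻ θ in Ioo (-Real.pi) Real.pi, ‖∑' n, b n * Complex.exp (n * θ * Complex.I)‖ₑ ^ 2 =
      ENNReal.ofReal (2 * Real.pi) * ∑' n, ‖b n‖ₑ ^ 2 := by
  have : Fact (0 < 2 * Real.pi) := ⟨Real.two_pi_pos⟩
  let T := 2 * Real.pi
  have hsum : Summable fun n : ℕ => b n • (fourier (n : ℤ) : C(AddCircle T, ℂ)) := by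
    refine Summable.of_norm ?_
    simpa [norm_smul, fourier_norm] using hb
  set F : C(AddCircle T, ℂ) := ∑' n : ℕ, b n • (fourier (n : ℤ) : C(AddCircle T, ℂ)) with hF
  have hFs : HasSum (fun n : ℕ => b n • (fourier (n : ℤ) : C(AddCircle T, ℂ))) F := hsum.hasSum
  have hFx : ∀ θ : ℝ, F (θ : AddCircle T) = ∑' n, b n * Complex.exp (n * θ * Complex.I) := by
    intro θ
    have h := (ContinuousMap.hasSum_apply hFs (θ : AddCircle T)).tsum_eq
    rw [← h]
    refine tsum_congr fun n => ?_
    rw [ContinuousMap.smul_apply, fourier_coe_apply, smul_eq_mul]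
    congr 2
    have : (Real.pi : ℂ) ≠ 0 := by exact_mod_cast Real.pi_ne_zero
    simp only [T]
    push_cast
    field_simp
  let L := ContinuousMap.toLp (E := ℂ) 2 AddCircle.haarAddCircle ℂ (α := AddCircle T)
  have hx : HasSum (fun n : ℕ => b n • fourierLp (T := T) 2 (n : ℤ)) (L F) := by
    have := hFs.mapL L
    simpa using this
  have horth := orthonormal_fourier (T := T)
  have hcoef : ∀ m : ℕ, inner ℂ (fourierLp (T := T) 2 (m : ℤ)) (L F) = b m := by
    intro m
    have h := hx.mapL (innerSL ℂ (fourierLp (T := T) 2 (m : ℤ)))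
    have h2 := hasSum_single (f := fun n : ℕ =>
      (innerSL ℂ (fourierLp (T := T) 2 (m : ℤ))) (b n • fourierLp (T := T) 2 (n : ℤ))) m (by
        intro n hn
        have := horth.2 (i := (m : ℤ)) (j := (n : ℤ)) (by exact_mod_cast hn.symm)
        simp [this])
    have h3 := h.unique h2
    rw [innerSL_apply_apply] at h3
    rw [h3]
    simp [horth.1]
  have hnorm : HasSum (fun n => ‖b n‖ ^ 2) (‖L F‖ ^ 2) := by
    have h := hx.mapL (innerSL ℂ (L F))
    have h2 : HasSum (fun n => ((‖b n‖ ^ 2 : ℝ) : ℂ)) ((‖L F‖ ^ 2 : ℝ) : ℂ) := by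
      have e1 : (fun n => ((‖b n‖ ^ 2 : ℝ) : ℂ)) =
          fun n : ℕ => innerSL ℂ (L F) (b n • fourierLp (T := T) 2 (n : ℤ)) := by
        funext n
        rw [innerSL_apply_apply, inner_smul_right, ← inner_conj_symm, hcoef, RCLike.mul_conj]
        push_cast
        rfl
      have e2 : ((‖L F‖ ^ 2 : ℝ) : ℂ) = innerSL ℂ (L F) (L F) := by
        rw [innerSL_apply_apply, inner_self_eq_norm_sq_to_K]
        push_cast
        rfl
      rw [e1, e2]
      exact h
    exact_mod_cast h2
  have hint : ENNReal.ofReal (‖L F‖ ^ 2) = ∫⁻ x, ‖F x‖ₑ ^ 2 ∂AddCircle.haarAddCircle := by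
    rw [Lp.norm_def, ENNReal.ofReal_pow ENNReal.toReal_nonneg, ENNReal.ofReal_toReal (Lp.eLpNorm_ne_top _),
      eLpNorm_congr_ae (ContinuousMap.coeFn_toLp _ F), eLpNorm_eq_lintegral_rpow_enorm_toReal (by simp) (by simp)]
    rw [← ENNReal.rpow_natCast, ← ENNReal.rpow_mul]
    simp
  have hts : ∑' n, ‖b n‖ₑ ^ 2 = ENNReal.ofReal (‖L F‖ ^ 2) := by
    rw [← hnorm.tsum_eq, ENNReal.ofReal_tsum_of_nonneg (fun n => by positivity) hnorm.summable]
    refine tsum_congr fun n => ?_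
    rw [ENNReal.ofReal_pow (norm_nonneg _), ofReal_norm]
  rw [hts, hint]
  have h1 := AddCircle.lintegral_preimage T (-Real.pi) fun x => ‖F x‖ₑ ^ 2
  have h2 : -Real.pi + T = Real.pi := by simp only [T]; ring
  rw [h2, AddCircle.volume_eq_smul_haarAddCircle, lintegral_smul_measure] at h1
  rw [restrict_Ioo_eq_restrict_Ioc]
  simp only [hFx] at h1
  exact h1


/-- Taylor coefficients at the origin. -/
noncomputable def coeff (g : ℂ → ℂ) (n : ℕ) : ℂ := (n.factorial : ℂ)⁻¹ * iteratedDeriv n g 0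

theorem hasSum_coeff {g : ℂ → ℂ} (hg : DifferentiableOn ℂ g (ball 0 1)) {z : ℂ} (hz : ‖z‖ < 1) :
    HasSum (fun n => coeff g n * z ^ n) (g z) := by
  have h := Complex.hasSum_taylorSeries_on_ball hg (mem_ball_zero_iff.2 hz)
  have e : (fun n => coeff g n * z ^ n) =
      fun n : ℕ => (n.factorial : ℂ)⁻¹ • (z - 0) ^ n • iteratedDeriv n g 0 := by
    funext n
    rw [sub_zero, smul_eq_mul, smul_eq_mul, coeff]
    ring
  rw [e]
  exact h

theorem summable_norm_coeff {g : ℂ → ℂ} (hg : DifferentiableOn ℂ g (ball 0 1)) {r : ℝ}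
    (hr0 : 0 ≤ r) (hr : r < 1) : Summable fun n => ‖coeff g n‖ * r ^ n := by
  obtain ⟨s, hrs, hs⟩ := exists_between hr
  have hs0 : 0 < s := hr0.trans_lt hrs
  have h := (hasSum_coeff hg (z := (s : ℂ)) (by
    rwa [Complex.norm_real, Real.norm_of_nonneg hs0.le])).summable
  have ht := h.tendsto_atTop_zero
  obtain ⟨C, hC⟩ := ht.norm.bddAbove_range
  refine Summable.of_nonneg_of_le (fun n => by positivity) (fun n => ?_)
    ((summable_geometric_of_lt_one (div_nonneg hr0 hs0.le) ((div_lt_one hs0).2 hrs)).mul_left C)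
  have hCn : ‖coeff g n‖ * s ^ n ≤ C := by
    have := hC ⟨n, rfl⟩
    simpa [norm_mul, abs_of_pos hs0] using this
  calc ‖coeff g n‖ * r ^ n = ‖coeff g n‖ * s ^ n * (r / s) ^ n := by
        rw [div_pow]; field_simp
    _ ≤ C * (r / s) ^ n := by gcongr

theorem coeff_deriv (g : ℂ → ℂ) (n : ℕ) : coeff (deriv g) n = (n + 1) * coeff g (n + 1) := by
  rw [coeff, coeff, iteratedDeriv_succ', Nat.factorial_succ]
  push_cast
  have : (n.factorial : ℂ) ≠ 0 := by exact_mod_cast n.factorial_ne_zero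
  have : (n + 1 : ℂ) ≠ 0 := by exact_mod_cast n.succ_ne_zero
  field_simp

theorem lintegral_circle {g : ℂ → ℂ} (hg : DifferentiableOn ℂ g (ball 0 1)) {r : ℝ}
    (hr0 : 0 ≤ r) (hr : r < 1) :
    ∫⁻ θ in Ioo (-Real.pi) Real.pi, ‖g (r * Complex.exp (θ * Complex.I))‖ₑ ^ 2 =
      ENNReal.ofReal (2 * Real.pi) * ∑' n, (‖coeff g n‖ₑ * ENNReal.ofReal r ^ n) ^ 2 := by
  have h := lintegral_norm_sq_tsum (b := fun n => coeff g n * (r : ℂ) ^ n) (by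
    simpa [abs_of_nonneg hr0] using summable_norm_coeff hg hr0 hr)
  have e1 : ∀ θ : ℝ, g (r * Complex.exp (θ * Complex.I)) =
      ∑' n : ℕ, coeff g n * (r : ℂ) ^ n * Complex.exp (n * θ * Complex.I) := by
    intro θ
    rw [← (hasSum_coeff hg (z := r * Complex.exp (θ * Complex.I)) (by
      rwa [norm_mul, Complex.norm_real, Real.norm_of_nonneg hr0, Complex.norm_exp_ofReal_mul_I,
        mul_one])).tsum_eq]
    refine tsum_congr fun n => ?_
    rw [mul_pow, ← Complex.exp_nat_mul, ← mul_assoc, ← mul_assoc]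
  simp only [e1, h]
  congr 1
  refine tsum_congr fun n => ?_
  rw [enorm_mul, enorm_pow, ← ofReal_norm (r : ℂ), Complex.norm_real, Real.norm_of_nonneg hr0]

/-- The Dirichlet integral of a holomorphic function in terms of its Taylor coefficients. -/
theorem lintegral_deriv_sq {g : ℂ → ℂ} (hg : DifferentiableOn ℂ g (ball 0 1)) :
    ∫⁻ z in ball (0 : ℂ) 1, ‖deriv g z‖ₑ ^ 2 =
      ENNReal.ofReal Real.pi * ∑' n : ℕ, (n : ℝ≥0∞) * ‖coeff g n‖ₑ ^ 2 := by
  have hgd : DifferentiableOn ℂ (deriv g) (ball 0 1) := hg.deriv isOpen_ball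
  have hmeas : Measurable ((ball (0 : ℂ) 1).indicator fun z => ‖deriv g z‖ₑ ^ 2) :=
    ((measurable_deriv g).enorm.pow_const 2).indicator measurableSet_ball
  rw [← lintegral_indicator measurableSet_ball, ← Complex.lintegral_comp_polarCoord_symm,
    polarCoord_target, Measure.volume_eq_prod, ← Measure.prod_restrict, lintegral_prod _ (by
      refine Measurable.aemeasurable ?_
      refine (ENNReal.measurable_ofReal.comp measurable_fst).smul (hmeas.comp ?_)
      have : (fun p : ℝ × ℝ => Complex.polarCoord.symm p) =
          fun p => (p.1 : ℂ) * (Real.cos p.2 + Real.sin p.2 * Complex.I) := by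
        funext p
        rw [Complex.polarCoord_symm_apply]
      have hc : Continuous fun p : ℝ × ℝ => (p.1 : ℂ) * (Real.cos p.2 + Real.sin p.2 * Complex.I) := by
        fun_prop
      rw [← this] at hc
      exact hc.measurable)]
  -- In polar coordinates the angular integral over each circle of radius r < 1 is Parseval's
  -- identity for `deriv g`.
  have hin : ∀ r ∈ Ioi (0 : ℝ), (∫⁻ θ in Ioo (-Real.pi) Real.pi, ENNReal.ofReal r •
      (ball (0 : ℂ) 1).indicator (fun z => ‖deriv g z‖ₑ ^ 2) (Complex.polarCoord.symm (r, θ))) =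
      (Ioo (0 : ℝ) 1).indicator (fun r => ENNReal.ofReal r * (ENNReal.ofReal (2 * Real.pi) *
        ∑' n, (‖coeff (deriv g) n‖ₑ * ENNReal.ofReal r ^ n) ^ 2)) r := by
    intro r hr
    have hr0 : (0 : ℝ) < r := hr
    have hpol : ∀ θ : ℝ, Complex.polarCoord.symm (r, θ) = r * Complex.exp (θ * Complex.I) := by
      intro θ
      rw [Complex.polarCoord_symm_apply, Complex.exp_mul_I]
      simp
    have hn : ∀ θ : ℝ, ‖(r : ℂ) * Complex.exp (θ * Complex.I)‖ = r := fun θ => by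
      rw [norm_mul, Complex.norm_real, Real.norm_of_nonneg hr0.le, Complex.norm_exp_ofReal_mul_I,
        mul_one]
    simp only [hpol, smul_eq_mul]
    by_cases h1 : r < 1
    · rw [indicator_of_mem (show r ∈ Ioo (0 : ℝ) 1 from ⟨hr0, h1⟩), lintegral_const_mul' _ _ ENNReal.ofReal_ne_top,
        ← lintegral_circle hgd hr0.le h1]
      congr 1
      refine lintegral_congr fun θ => ?_
      rw [indicator_of_mem (by rw [mem_ball_zero_iff, hn]; exact h1)]
    · rw [indicator_of_notMem (fun h => h1 h.2)]
      have hz : ∀ θ : ℝ, (ball (0 : ℂ) 1).indicator (fun z => ‖deriv g z‖ₑ ^ 2)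
          (r * Complex.exp (θ * Complex.I)) = 0 := fun θ =>
        indicator_of_notMem (by rw [mem_ball_zero_iff, hn]; exact h1) _
      simp only [hz, mul_zero, lintegral_zero]
  rw [setLIntegral_congr_fun measurableSet_Ioi hin, setLIntegral_indicator measurableSet_Ioo,
    inter_eq_left.2 (fun r hr => hr.1)]
  -- The radial integral of r^(2n+1) is 1/(2n+2). Against the factor 2π and the (n+1)² of
  -- `coeff_deriv` it leaves π(n+1).
  have hterm : ∀ n : ℕ, ∫⁻ r in Ioo (0 : ℝ) 1, ENNReal.ofReal r *
      (‖coeff (deriv g) n‖ₑ * ENNReal.ofReal r ^ n) ^ 2 =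
      ‖coeff (deriv g) n‖ₑ ^ 2 * ENNReal.ofReal (2 * n + 2)⁻¹ := by
    intro n
    have e1 : ∀ r ∈ Ioo (0 : ℝ) 1, ENNReal.ofReal r *
        (‖coeff (deriv g) n‖ₑ * ENNReal.ofReal r ^ n) ^ 2 =
        ‖coeff (deriv g) n‖ₑ ^ 2 * ENNReal.ofReal (r ^ (2 * n + 1)) := by
      intro r hr
      rw [ENNReal.ofReal_pow hr.1.le]
      ring
    rw [setLIntegral_congr_fun measurableSet_Ioo e1, lintegral_const_mul' _ _ (by simp)]
    congr 1
    rw [restrict_Ioo_eq_restrict_Ioc, ← ofReal_integral_eq_lintegral_ofReal,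
      ← intervalIntegral.integral_of_le zero_le_one, integral_pow]
    · congr 1
      push_cast
      rw [one_pow, zero_pow (by omega)]
      ring
    · exact ((continuous_pow _).integrableOn_Icc).mono_set Ioc_subset_Icc_self
    · filter_upwards [ae_restrict_mem measurableSet_Ioc] with r hr
      exact pow_nonneg hr.1.le _
  have hswap : ∀ r : ℝ, ENNReal.ofReal r * (ENNReal.ofReal (2 * Real.pi) *
      ∑' n, (‖coeff (deriv g) n‖ₑ * ENNReal.ofReal r ^ n) ^ 2) =
      ENNReal.ofReal (2 * Real.pi) * ∑' n, ENNReal.ofReal r *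
        (‖coeff (deriv g) n‖ₑ * ENNReal.ofReal r ^ n) ^ 2 := by
    intro r
    rw [ENNReal.tsum_mul_left]
    ring
  simp only [hswap]
  rw [lintegral_const_mul' _ _ ENNReal.ofReal_ne_top, lintegral_tsum (fun n => by fun_prop)]
  simp only [hterm]
  rw [tsum_eq_zero_add' (f := fun n : ℕ => (n : ℝ≥0∞) * ‖coeff g n‖ₑ ^ 2) ENNReal.summable,
    Nat.cast_zero, zero_mul, zero_add, ← ENNReal.tsum_mul_left, ← ENNReal.tsum_mul_left]
  refine tsum_congr fun n => ?_
  have hnn : ‖(n + 1 : ℂ)‖ₑ = ENNReal.ofReal (n + 1) := by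
    rw [← ofReal_norm]
    congr 1
    have : (n + 1 : ℂ) = ((n + 1 : ℝ) : ℂ) := by push_cast; rfl
    rw [this, Complex.norm_real, Real.norm_of_nonneg (by positivity)]
  have hcast : ((n + 1 : ℕ) : ℝ≥0∞) = ENNReal.ofReal (n + 1) := by
    rw [← ENNReal.ofReal_natCast]
    push_cast
    rfl
  rw [coeff_deriv, enorm_mul, mul_pow, hnn, hcast]
  have key : ENNReal.ofReal (2 * Real.pi) * (ENNReal.ofReal (n + 1) ^ 2 *
      ENNReal.ofReal (2 * n + 2)⁻¹) = ENNReal.ofReal Real.pi * ENNReal.ofReal (n + 1) := by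
    rw [← ENNReal.ofReal_pow (by positivity), ← ENNReal.ofReal_mul (by positivity),
      ← ENNReal.ofReal_mul (by positivity), ← ENNReal.ofReal_mul (by positivity)]
    congr 1
    field_simp
  calc _ = ENNReal.ofReal (2 * Real.pi) * (ENNReal.ofReal (n + 1) ^ 2 *
      ENNReal.ofReal (2 * n + 2)⁻¹) * ‖coeff g (n + 1)‖ₑ ^ 2 := by ring
    _ = _ := by rw [key, mul_assoc]


/-- Bounded holomorphic functions on the unit disc with finite Dirichlet integral. -/
structure BoundedDirichlet (g : ℂ → ℂ) : Prop where
  diff : DifferentiableOn ℂ g (ball 0 1)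
  bdd : ∃ C : ℝ, 0 < C ∧ ∀ z ∈ ball (0 : ℂ) 1, ‖g z‖ ≤ C
  energy : ∫⁻ z in ball (0 : ℂ) 1, ‖deriv g z‖ₑ ^ 2 < ∞

/-- Common source of the closure properties below. The summand 1 is harmless since the disc has
finite area; it is needed for difference quotients, whose derivative also involves the bounded
function itself. -/
theorem energy_lt_top_of_le {g k h : ℂ → ℂ} (hg : BoundedDirichlet g) (hk : BoundedDirichlet k)
    {C : ℝ} (hC : ∀ z ∈ ball (0 : ℂ) 1, ‖deriv h z‖ ≤ C * (‖deriv g z‖ + ‖deriv k z‖ + 1)) :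
    ∫⁻ z in ball (0 : ℂ) 1, ‖deriv h z‖ₑ ^ 2 < ∞ := by
  have hle : ∀ z ∈ ball (0 : ℂ) 1, ‖deriv h z‖ₑ ^ 2 ≤
      ENNReal.ofReal (3 * C ^ 2) * (‖deriv g z‖ₑ ^ 2 + ‖deriv k z‖ₑ ^ 2 + 1) := by
    intro z hz
    have h1 : ‖deriv h z‖ ^ 2 ≤ 3 * C ^ 2 * (‖deriv g z‖ ^ 2 + ‖deriv k z‖ ^ 2 + 1) := by
      have h2 : ‖deriv h z‖ ^ 2 ≤ (C * (‖deriv g z‖ + ‖deriv k z‖ + 1)) ^ 2 := by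
        gcongr
        exact hC z hz
      have h3 : (‖deriv g z‖ + ‖deriv k z‖ + 1) ^ 2 ≤
          3 * (‖deriv g z‖ ^ 2 + ‖deriv k z‖ ^ 2 + 1) := by
        nlinarith [sq_nonneg (‖deriv g z‖ - ‖deriv k z‖), sq_nonneg (‖deriv g z‖ - 1),
          sq_nonneg (‖deriv k z‖ - 1)]
      rw [mul_pow] at h2
      nlinarith [sq_nonneg C]
    have h4 := ENNReal.ofReal_le_ofReal h1
    rw [ENNReal.ofReal_mul (by positivity), ENNReal.ofReal_add (by positivity) (by positivity),
      ENNReal.ofReal_add (by positivity) (by positivity), ENNReal.ofReal_one,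
      ENNReal.ofReal_pow (norm_nonneg _), ENNReal.ofReal_pow (norm_nonneg _),
      ENNReal.ofReal_pow (norm_nonneg _), ofReal_norm, ofReal_norm, ofReal_norm] at h4
    exact h4
  refine (setLIntegral_mono' measurableSet_ball hle).trans_lt ?_
  rw [lintegral_const_mul' _ _ ENNReal.ofReal_ne_top]
  refine ENNReal.mul_lt_top ENNReal.ofReal_lt_top ?_
  have m1 : Measurable fun z => ‖deriv g z‖ₑ ^ 2 := (measurable_deriv g).enorm.pow_const 2
  have m2 : Measurable fun z => ‖deriv k z‖ₑ ^ 2 := (measurable_deriv k).enorm.pow_const 2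
  rw [lintegral_add_left (by fun_prop), lintegral_add_left m1]
  refine ENNReal.add_lt_top.2 ⟨ENNReal.add_lt_top.2 ⟨hg.energy, hk.energy⟩, ?_⟩
  simp

theorem BoundedDirichlet.differentiableAt {g : ℂ → ℂ} (hg : BoundedDirichlet g) {z : ℂ}
    (hz : z ∈ ball (0 : ℂ) 1) : DifferentiableAt ℂ g z :=
  (hg.diff z hz).differentiableAt (isOpen_ball.mem_nhds hz)

theorem BoundedDirichlet.sub_const {g : ℂ → ℂ} (hg : BoundedDirichlet g) (c : ℂ) :
    BoundedDirichlet fun z => g z - c := by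
  obtain ⟨C, hC, hb⟩ := hg.bdd
  refine ⟨hg.diff.sub_const c, ⟨C + ‖c‖, by positivity, fun z hz =>
    (norm_sub_le _ _).trans (by gcongr; exact hb z hz)⟩, ?_⟩
  simpa using hg.energy

theorem BoundedDirichlet.mul {g k : ℂ → ℂ} (hg : BoundedDirichlet g) (hk : BoundedDirichlet k) :
    BoundedDirichlet fun z => g z * k z := by
  obtain ⟨C, hC, hbg⟩ := hg.bdd
  obtain ⟨D, hD, hbk⟩ := hk.bdd
  refine ⟨hg.diff.mul hk.diff, ⟨C * D, by positivity, fun z hz => ?_⟩,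
    energy_lt_top_of_le hg hk (C := C + D) fun z hz => ?_⟩
  · rw [norm_mul]
    exact mul_le_mul (hbg z hz) (hbk z hz) (norm_nonneg _) hC.le
  · have hd : deriv (fun z => g z * k z) z = deriv g z * k z + g z * deriv k z :=
      deriv_fun_mul (hg.differentiableAt hz) (hk.differentiableAt hz)
    rw [hd]
    have h1 := norm_add_le (deriv g z * k z) (g z * deriv k z)
    rw [norm_mul, norm_mul] at h1
    have h2 := mul_le_mul_of_nonneg_left (hbk z hz) (norm_nonneg (deriv g z))
    have h3 := mul_le_mul_of_nonneg_right (hbg z hz) (norm_nonneg (deriv k z))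
    nlinarith [norm_nonneg (deriv g z), norm_nonneg (deriv k z), mul_nonneg hC.le (norm_nonneg (deriv g z)),
      mul_nonneg hD.le (norm_nonneg (deriv k z))]

theorem BoundedDirichlet.inv {g : ℂ → ℂ} (hg : BoundedDirichlet g) {δ : ℝ} (hδ : 0 < δ)
    (hb : ∀ z ∈ ball (0 : ℂ) 1, δ ≤ ‖g z‖) : BoundedDirichlet fun z => (g z)⁻¹ := by
  have hne : ∀ z ∈ ball (0 : ℂ) 1, g z ≠ 0 := fun z hz => norm_pos_iff.1 (hδ.trans_le (hb z hz))
  refine ⟨hg.diff.fun_inv hne, ⟨δ⁻¹, by positivity, fun z hz => ?_⟩,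
    energy_lt_top_of_le hg hg (C := (δ ^ 2)⁻¹) fun z hz => ?_⟩
  · rw [norm_inv]
    exact inv_anti₀ hδ (hb z hz)
  · have hd : deriv (fun z => (g z)⁻¹) z = -deriv g z / g z ^ 2 :=
      deriv_fun_inv'' (hg.differentiableAt hz) (hne z hz)
    have h2 : δ ^ 2 ≤ ‖g z‖ ^ 2 := by gcongr; exact hb z hz
    rw [hd, norm_div, norm_neg, norm_pow, div_eq_inv_mul]
    have h3 : (‖g z‖ ^ 2)⁻¹ ≤ (δ ^ 2)⁻¹ := inv_anti₀ (by positivity) h2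
    gcongr
    linarith [norm_nonneg (deriv g z)]

/-- The real Jacobian of a holomorphic map is |g'|², so for injective g the Dirichlet integral is
the area of the image. -/
theorem BoundedDirichlet.of_injOn {g : ℂ → ℂ} (hg : DifferentiableOn ℂ g (ball 0 1))
    (hinj : InjOn g (ball 0 1)) (hb : Bornology.IsBounded (g '' ball 0 1)) :
    BoundedDirichlet g := by
  obtain ⟨C, hC, hsub⟩ := hb.subset_ball_lt 0 0
  refine ⟨hg, ⟨C, hC, fun z hz => (mem_ball_zero_iff.1 (hsub (mem_image_of_mem g hz))).le⟩, ?_⟩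
  have h := lintegral_abs_det_fderiv_eq_addHaar_image (volume : Measure ℂ) measurableSet_ball
    (f' := fun z => (ContinuousLinearMap.toSpanSingleton ℂ (deriv g z)).restrictScalars ℝ)
    (fun z hz => (((hg z hz).differentiableAt (isOpen_ball.mem_nhds hz)).hasDerivAt.hasFDerivAt.restrictScalars
      ℝ).hasFDerivWithinAt) hinj
  have hdet : ∀ c : ℂ, ENNReal.ofReal |((ContinuousLinearMap.toSpanSingleton ℂ c).restrictScalars ℝ).det|
      = ‖c‖ₑ ^ 2 := by
    intro c
    rw [ContinuousLinearMap.det, ContinuousLinearMap.coe_restrictScalars, LinearMap.det_restrictScalars,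
      Algebra.norm_complex_eq]
    have hdc : LinearMap.det ((ContinuousLinearMap.toSpanSingleton ℂ c : ℂ →L[ℂ] ℂ) : ℂ →ₗ[ℂ] ℂ) = c := by
      rw [LinearMap.det_ring]
      simp
    rw [hdc]
    change ENNReal.ofReal |Complex.normSq c| = _
    rw [abs_of_nonneg (Complex.normSq_nonneg c), Complex.normSq_eq_norm_sq,
      ENNReal.ofReal_pow (norm_nonneg _), ofReal_norm]
  simp only [hdet] at h
  rw [h]
  exact hb.measure_lt_top

/-- On a small closed disc about z₀ the quotient and its derivative are bounded by compactness.
Outside it the denominator is at least ρ, and the derivative (g'(z) - quotient)/(z - z₀) is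
dominated by |g'(z)| plus a constant. -/
theorem boundedDirichlet_dslope {g : ℂ → ℂ} (hg : BoundedDirichlet g) {z₀ : ℂ}
    (hz₀ : z₀ ∈ ball (0 : ℂ) 1) : BoundedDirichlet (dslope g z₀) := by
  have hd : DifferentiableOn ℂ (dslope g z₀) (ball 0 1) :=
    (Complex.differentiableOn_dslope (isOpen_ball.mem_nhds hz₀)).2 hg.diff
  obtain ⟨ρ, hρ, hsub⟩ := Metric.nhds_basis_closedBall.mem_iff.1 (isOpen_ball.mem_nhds hz₀)
  obtain ⟨C, hC, hbg⟩ := hg.bdd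
  obtain ⟨B, hB⟩ := (isCompact_closedBall z₀ ρ).exists_bound_of_continuousOn (hd.continuousOn.mono hsub)
  obtain ⟨B', hB'⟩ := (isCompact_closedBall z₀ ρ).exists_bound_of_continuousOn
    ((hd.deriv isOpen_ball).continuousOn.mono hsub)
  have hout : ∀ z ∈ ball (0 : ℂ) 1, z ∉ closedBall z₀ ρ → ‖dslope g z₀ z‖ ≤ 2 * C / ρ := by
    intro z hz hzρ
    have hlt : ρ < ‖z - z₀‖ := by simpa [dist_eq_norm] using hzρ
    have hne : z ≠ z₀ := by
      rintro rfl
      simp at hlt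
      linarith
    rw [dslope_of_ne _ hne, slope_def_field, norm_div]
    have h1 : ‖g z - g z₀‖ ≤ 2 * C := (norm_sub_le _ _).trans (by linarith [hbg z hz, hbg z₀ hz₀])
    gcongr
  have hCB : ∀ z ∈ ball (0 : ℂ) 1, ‖dslope g z₀ z‖ ≤ max B (2 * C / ρ) := by
    intro z hz
    by_cases hzρ : z ∈ closedBall z₀ ρ
    · exact (hB z hzρ).trans (le_max_left _ _)
    · exact (hout z hz hzρ).trans (le_max_right _ _)
  refine ⟨hd, ⟨max B (2 * C / ρ), lt_max_of_lt_right (by positivity), hCB⟩,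
    energy_lt_top_of_le hg hg (C := max B' ((1 + 2 * C / ρ) / ρ)) fun z hz => ?_⟩
  have hn := norm_nonneg (deriv g z)
  by_cases hzρ : z ∈ closedBall z₀ ρ
  · have h0 : 0 ≤ max B' ((1 + 2 * C / ρ) / ρ) := le_max_of_le_right (by positivity)
    have h1 := (hB' z hzρ).trans (le_max_left B' ((1 + 2 * C / ρ) / ρ))
    nlinarith
  · have hlt : ρ < ‖z - z₀‖ := by simpa [dist_eq_norm] using hzρ
    have hne : z ≠ z₀ := by
      rintro rfl
      simp at hlt
      linarith
    have hz0 : z - z₀ ≠ 0 := sub_ne_zero.2 hne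
    have hds : HasDerivAt (dslope g z₀) ((deriv g z - dslope g z₀ z) / (z - z₀)) z := by
      have h1 := ((hg.differentiableAt hz).hasDerivAt.sub_const (g z₀)).div
        ((hasDerivAt_id z).sub_const z₀) hz0
      have h2 : dslope g z₀ =ᶠ[𝓝 z] fun w => (g w - g z₀) / (w - z₀) := by
        filter_upwards [isOpen_ne.mem_nhds hne] with w hw
        rw [dslope_of_ne _ hw, slope_def_field]
      refine (h1.congr_of_eventuallyEq h2).congr_deriv ?_
      rw [dslope_of_ne _ hne, slope_def_field]
      simp only [id]
      field_simp
    rw [hds.deriv, norm_div]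
    have h1 : ‖deriv g z - dslope g z₀ z‖ ≤ ‖deriv g z‖ + 2 * C / ρ :=
      (norm_sub_le _ _).trans (by gcongr; exact hout z hz hzρ)
    have h2 : ‖deriv g z - dslope g z₀ z‖ / ‖z - z₀‖ ≤ (‖deriv g z‖ + 2 * C / ρ) / ρ := by gcongr
    refine h2.trans (le_trans ?_ (mul_le_mul_of_nonneg_right (le_max_right _ _) (by positivity)))
    rw [div_mul_eq_mul_div]
    gcongr
    have : 0 ≤ 2 * C / ρ := by positivity
    nlinarith

/-- Near z₀ the quotient is close to g'(z₀) ≠ 0. The image of this neighbourhood contains a disc of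
radius ε about g(z₀); by injectivity every other z has |g(z) - g(z₀)| ≥ ε, and |z - z₀| ≤ 2 gives
ε/2. -/
theorem exists_le_norm_dslope {g : ℂ → ℂ} (hg : DifferentiableOn ℂ g (ball 0 1))
    (hinj : InjOn g (ball 0 1)) {z₀ : ℂ} (hz₀ : z₀ ∈ ball (0 : ℂ) 1) (hder : deriv g z₀ ≠ 0) :
    ∃ δ > 0, ∀ z ∈ ball (0 : ℂ) 1, δ ≤ ‖dslope g z₀ z‖ := by
  have hd : DifferentiableOn ℂ (dslope g z₀) (ball 0 1) :=
    (Complex.differentiableOn_dslope (isOpen_ball.mem_nhds hz₀)).2 hg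
  have hnhds := isOpen_ball.mem_nhds hz₀
  obtain ⟨δ₁, hδ₁, h1⟩ : ∃ δ₁ > 0, ∀ᶠ z in 𝓝 z₀, δ₁ ≤ ‖dslope g z₀ z‖ := by
    refine ⟨‖deriv g z₀‖ / 2, by positivity, ?_⟩
    have hc : Tendsto (fun z => ‖dslope g z₀ z‖) (𝓝 z₀) (𝓝 ‖deriv g z₀‖) := by
      have := (hd.continuousOn.continuousAt hnhds).norm
      rwa [ContinuousAt, dslope_same] at this
    exact (hc.eventually (lt_mem_nhds (half_lt_self (norm_pos_iff.2 hder)))).mono fun z hz => hz.le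
  have hst : HasStrictDerivAt g (deriv g z₀) z₀ := (hg.analyticAt hnhds).hasStrictDerivAt
  have himg : g '' ({z | δ₁ ≤ ‖dslope g z₀ z‖} ∩ ball 0 1) ∈ 𝓝 (g z₀) := by
    rw [← hst.map_nhds_eq hder]
    exact image_mem_map (inter_mem h1 hnhds)
  obtain ⟨ε, hε, hsub⟩ := Metric.mem_nhds_iff.1 himg
  refine ⟨min δ₁ (ε / 2), by positivity, fun z hz => ?_⟩
  by_cases hzε : g z ∈ ball (g z₀) ε
  · obtain ⟨w, ⟨hw1, hw2⟩, hw3⟩ := hsub hzε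
    rw [← hinj hw2 hz hw3]
    exact (min_le_left _ _).trans hw1
  · have h2 : ε ≤ ‖g z - g z₀‖ := by simpa [dist_eq_norm] using hzε
    have hne : z ≠ z₀ := by
      rintro rfl
      simp at h2
      linarith
    rw [dslope_of_ne _ hne, slope_def_field, norm_div]
    refine (min_le_right _ _).trans ?_
    have h3 : ‖z - z₀‖ ≤ 2 := by
      have := mem_ball_zero_iff.1 hz
      have := mem_ball_zero_iff.1 hz₀
      exact (norm_sub_le _ _).trans (by linarith)
    have h4 : 0 < ‖z - z₀‖ := norm_pos_iff.2 (sub_ne_zero.2 hne)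
    gcongr

theorem BoundedDirichlet.summable_coeff {g : ℂ → ℂ} (hg : BoundedDirichlet g) :
    Summable fun n : ℕ => n * ‖coeff g n‖ ^ 2 := by
  have h := hg.energy
  rw [lintegral_deriv_sq hg.diff] at h
  have h2 : ∑' n : ℕ, (n : ℝ≥0∞) * ‖coeff g n‖ₑ ^ 2 ≠ ∞ := by
    intro htop
    rw [htop, ENNReal.mul_top (by simpa using Real.pi_pos)] at h
    exact lt_irrefl _ h
  have h3 := ENNReal.summable_toReal h2
  simpa using h3

end DiscDirichlet

end

/-! ### The sequence space ℓ² and compactness criteria -/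

section

open Filter Metric Set
open scoped Topology ENNReal InnerProductSpace

/-- The Hilbert space of square summable complex sequences. -/
abbrev SqSeq : Type := lp (fun _ : ℕ => ℂ) 2

namespace SqSeq

noncomputable abbrev basisVec (i : ℕ) : SqSeq := lp.single 2 i (1 : ℂ)

theorem hasSum_norm_sq (f : SqSeq) : HasSum (fun i => ‖f i‖ ^ 2) (‖f‖ ^ 2) := by
  have h := lp.hasSum_norm (p := 2) (by norm_num) f
  simpa using h

theorem sum_norm_sq_le (f : SqSeq) (s : Finset ℕ) : ∑ i ∈ s, ‖f i‖ ^ 2 ≤ ‖f‖ ^ 2 :=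
  sum_le_hasSum s (fun _ _ => by positivity) (hasSum_norm_sq f)

theorem norm_apply_le (f : SqSeq) (i : ℕ) : ‖f i‖ ≤ ‖f‖ :=
  lp.norm_apply_le_norm (by norm_num) f i

theorem norm_le_of_sum_le {f : SqSeq} {C : ℝ} (hC : 0 ≤ C)
    (h : ∀ s : Finset ℕ, ∑ i ∈ s, ‖f i‖ ^ 2 ≤ C ^ 2) : ‖f‖ ≤ C :=
  lp.norm_le_of_forall_sum_le (by norm_num) hC (by simpa using h)

theorem memℓp_of_summable {f : ℕ → ℂ} (h : Summable fun i => ‖f i‖ ^ 2) : Memℓp f 2 := by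
  rw [memℓp_gen_iff (by norm_num)]
  simpa using h

theorem memℓp_of_sum_le {f : ℕ → ℂ} {C : ℝ} (h : ∀ s : Finset ℕ, ∑ i ∈ s, ‖f i‖ ^ 2 ≤ C) :
    Memℓp f 2 :=
  memℓp_of_summable (summable_of_sum_le (fun _ => by positivity) h)

/-- The sequence `f` as an element of the Hilbert space. -/
def ofSummable (f : ℕ → ℂ) (h : Summable fun i => ‖f i‖ ^ 2) : SqSeq := ⟨f, memℓp_of_summable h⟩

@[simp] theorem ofSummable_apply (f : ℕ → ℂ) (h : Summable fun i => ‖f i‖ ^ 2) (i : ℕ) :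
    ofSummable f h i = f i := rfl

theorem norm_sq_ofSummable (f : ℕ → ℂ) (h : Summable fun i => ‖f i‖ ^ 2) :
    ‖ofSummable f h‖ ^ 2 = ∑' i, ‖f i‖ ^ 2 := (hasSum_norm_sq _).tsum_eq.symm

theorem basisVec_apply (i j : ℕ) : basisVec i j = if j = i then 1 else 0 := by
  rw [basisVec, lp.single_apply, Pi.single_apply]

theorem inner_basisVec (i : ℕ) (f : SqSeq) : ⟪basisVec i, f⟫_ℂ = f i := by
  rw [basisVec, lp.inner_single_left]
  simp

theorem norm_basisVec (i : ℕ) : ‖basisVec i‖ = 1 := by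
  rw [basisVec, lp.norm_single (by norm_num), norm_one]

theorem hasSum_basisVec (f : SqSeq) : HasSum (fun i => f i • basisVec i) f := by
  have h := lp.hasSum_single (p := 2) (by norm_num) f
  have e : (fun i => f i • basisVec i) = fun i => lp.single 2 i (f i) := by
    funext i
    rw [basisVec, ← lp.single_smul, smul_eq_mul, mul_one]
  rw [e]
  exact h

theorem ext_basisVec {E : Type*} [NormedAddCommGroup E] [NormedSpace ℂ E] {A B : SqSeq →L[ℂ] E}
    (h : ∀ i, A (basisVec i) = B (basisVec i)) : A = B := by
  ext f
  have h1 := (hasSum_basisVec f).mapL A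
  have h2 := (hasSum_basisVec f).mapL B
  have e : (fun i => A (f i • basisVec i)) = fun i => B (f i • basisVec i) := by
    funext i
    rw [map_smul, map_smul, h]
  rw [e] at h1
  exact h1.unique h2

/-- The bounded operator with prescribed square summable coordinates. -/
noncomputable def mkOp (F : SqSeq →ₗ[ℂ] (ℕ → ℂ)) (C : ℝ) (hC : 0 ≤ C)
    (h : ∀ f s, ∑ i ∈ s, ‖F f i‖ ^ 2 ≤ (C * ‖f‖) ^ 2) : SqSeq →L[ℂ] SqSeq :=
  LinearMap.mkContinuous
    { toFun := fun f => ⟨F f, memℓp_of_sum_le (h f)⟩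
      map_add' := fun f g => Subtype.ext (map_add F f g)
      map_smul' := fun c f => Subtype.ext (map_smul F c f) } C
    (fun f => norm_le_of_sum_le (by positivity) (h f))

@[simp] theorem mkOp_apply (F : SqSeq →ₗ[ℂ] (ℕ → ℂ)) (C : ℝ) (hC : 0 ≤ C)
    (h : ∀ f s, ∑ i ∈ s, ‖F f i‖ ^ 2 ≤ (C * ‖f‖) ^ 2) (f : SqSeq) (i : ℕ) :
    mkOp F C hC h f i = F f i := rfl

theorem norm_mkOp_le (F : SqSeq →ₗ[ℂ] (ℕ → ℂ)) (C : ℝ) (hC : 0 ≤ C)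
    (h : ∀ f s, ∑ i ∈ s, ‖F f i‖ ^ 2 ≤ (C * ‖f‖) ^ 2) : ‖mkOp F C hC h‖ ≤ C :=
  LinearMap.mkContinuous_norm_le _ hC _

/-- The coordinate functional. -/
noncomputable def coord (i : ℕ) : SqSeq →L[ℂ] ℂ := innerSL ℂ (basisVec i)

@[simp] theorem coord_apply (i : ℕ) (f : SqSeq) : coord i f = f i := by
  rw [coord, innerSL_apply_apply, inner_basisVec]

section Compact

variable {E : Type*} [NormedAddCommGroup E] [InnerProductSpace ℂ E]

theorem isCompactOperator_smulRight {E₁ : Type*} [NormedAddCommGroup E₁] [NormedSpace ℂ E₁]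
    (φ : E₁ →L[ℂ] ℂ) (x : E) : IsCompactOperator (φ.smulRight x) := by
  have h : IsCompactOperator (ContinuousLinearMap.toSpanSingleton ℂ x) :=
    (isCompactOperator_id (E := ℂ)).continuous_comp (ContinuousLinearMap.continuous _)
  exact h.comp_clm φ

theorem isCompactOperator_sum {ι : Type*} (s : Finset ι) {E₁ E₂ : Type*} [NormedAddCommGroup E₁]
    [NormedSpace ℂ E₁] [NormedAddCommGroup E₂] [NormedSpace ℂ E₂] {A : ι → E₁ →L[ℂ] E₂}
    (h : ∀ i ∈ s, IsCompactOperator (A i)) : IsCompactOperator (∑ i ∈ s, A i : E₁ →L[ℂ] E₂) := by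
  classical
  induction s using Finset.induction_on with
  | empty => simpa using isCompactOperator_zero
  | insert a s ha ih =>
    rw [Finset.sum_insert ha]
    exact (h a (Finset.mem_insert_self _ _)).add
      (ih fun i hi => h i (Finset.mem_insert_of_mem hi))

/-- Projection onto the first `N` coordinates. -/
noncomputable def trunc (N : ℕ) : SqSeq →L[ℂ] SqSeq :=
  ∑ i ∈ Finset.range N, (coord i).smulRight (basisVec i)

theorem trunc_apply (N : ℕ) (f : SqSeq) (j : ℕ) : trunc N f j = if j < N then f j else 0 := by
  have h : trunc N f = ∑ i ∈ Finset.range N, f i • basisVec i := by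
    simp [trunc]
  rw [h, lp.coeFn_sum, Finset.sum_apply]
  have h2 : ∀ i, (f i • basisVec i) j = if j = i then f i else 0 := fun i => by
    rw [lp.coeFn_smul, Pi.smul_apply, basisVec_apply]
    split_ifs <;> simp
  simp only [h2, Finset.sum_ite_eq, Finset.mem_range]

theorem norm_sub_trunc_le (N : ℕ) (f : SqSeq) : ‖f - trunc N f‖ ≤ ‖f‖ := by
  refine norm_le_of_sum_le (norm_nonneg _) fun s => le_trans (Finset.sum_le_sum fun i _ => ?_)
    (sum_norm_sq_le f s)
  rw [lp.coeFn_sub, Pi.sub_apply, trunc_apply]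
  split_ifs <;> simp

/-- The hypothesis says that C differs from its restriction to the first N coordinates by at most ε
N in norm, so C is a norm limit of finite rank operators. -/
theorem isCompactOperator_of_tail [CompleteSpace E] {C : SqSeq →L[ℂ] E} {ε : ℕ → ℝ}
    (hε : Tendsto ε atTop (𝓝 0))
    (h : ∀ N (f : SqSeq), (∀ i < N, f i = 0) → ‖C f‖ ≤ ε N * ‖f‖) : IsCompactOperator C := by
  have hε0 : ∀ N, 0 ≤ ε N := fun N => by
    have := h N (basisVec N) (fun i hi => by rw [basisVec_apply, if_neg hi.ne])
    rw [norm_basisVec, mul_one] at this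
    exact (norm_nonneg _).trans this
  have hlim : Tendsto (fun N => C ∘L trunc N) atTop (𝓝 C) := by
    rw [tendsto_iff_norm_sub_tendsto_zero]
    refine squeeze_zero (fun _ => norm_nonneg _) (fun N => ?_) hε
    refine ContinuousLinearMap.opNorm_le_bound _ (hε0 N) fun f => ?_
    have h1 := h N (f - trunc N f) (fun i hi => by
      rw [lp.coeFn_sub, Pi.sub_apply, trunc_apply, if_pos hi, sub_self])
    rw [_root_.sub_apply, ContinuousLinearMap.comp_apply, ← map_sub, ← norm_neg,
      ← map_neg, neg_sub]
    exact h1.trans (mul_le_mul_of_nonneg_left (norm_sub_trunc_le N f) (hε0 N))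
  refine isCompactOperator_of_tendsto hlim (Eventually.of_forall fun N => ?_)
  have : IsCompactOperator (trunc N) :=
    isCompactOperator_sum _ fun i _ => isCompactOperator_smulRight _ _
  exact this.clm_comp C

/-- Hilbert–Schmidt operators are compact: by Cauchy–Schwarz the norm of C on vectors supported past
N is at most the square root of the tail of the series. -/
theorem isCompactOperator_of_summable [CompleteSpace E] {C : SqSeq →L[ℂ] E}
    (h : Summable fun k => ‖C (basisVec k)‖ ^ 2) : IsCompactOperator C := by
  have htail : Tendsto (fun N => ∑' k, ‖C (basisVec (k + N))‖ ^ 2) atTop (𝓝 0) :=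
    tendsto_sum_nat_add fun k => ‖C (basisVec k)‖ ^ 2
  refine isCompactOperator_of_tail (ε := fun N => √(∑' k, ‖C (basisVec (k + N))‖ ^ 2))
    (by simpa using htail.sqrt) fun N f hf => ?_
  have hsum := (hasSum_basisVec f).mapL C
  have hsum' := (hasSum_nat_add_iff' N).2 hsum
  rw [Finset.sum_eq_zero (fun i hi => by rw [hf i (Finset.mem_range.1 hi)]; simp), sub_zero] at hsum'
  refine le_of_tendsto hsum'.norm (Eventually.of_forall fun s => ?_)
  have hN : Summable fun k => ‖C (basisVec (k + N))‖ ^ 2 := (summable_nat_add_iff N).2 h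
  calc ‖∑ k ∈ s, C (f (k + N) • basisVec (k + N))‖
      ≤ ∑ k ∈ s, ‖C (basisVec (k + N))‖ * ‖f (k + N)‖ := by
        refine (norm_sum_le _ _).trans (Finset.sum_le_sum fun k _ => ?_)
        rw [map_smul, norm_smul, mul_comm]
    _ ≤ √(∑ k ∈ s, ‖C (basisVec (k + N))‖ ^ 2) * √(∑ k ∈ s, ‖f (k + N)‖ ^ 2) :=
        Real.sum_mul_le_sqrt_mul_sqrt _ _ _
    _ ≤ √(∑' k, ‖C (basisVec (k + N))‖ ^ 2) * ‖f‖ := by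
        gcongr
        · exact hN.sum_le_tsum s fun _ _ => by positivity
        · refine Real.sqrt_le_iff.2 ⟨norm_nonneg _, ?_⟩
          have := sum_norm_sq_le f (s.map (addRightEmbedding N))
          simpa using this

end Compact

end SqSeq

/-- The adjoint of a compact operator is compact. -/
theorem IsCompactOperator.adjoint_hilbert {E F : Type*} [NormedAddCommGroup E]
    [InnerProductSpace ℂ E] [CompleteSpace E] [NormedAddCommGroup F] [InnerProductSpace ℂ F]
    [CompleteSpace F] {C : E →L[ℂ] F} (hC : IsCompactOperator C) :
    IsCompactOperator (ContinuousLinearMap.adjoint C) := by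
  set D := ContinuousLinearMap.adjoint C with hD
  have hCD : IsCompactOperator (C ∘L D) := hC.comp_clm D
  have key := isCompactOperator_iff_isCompact_closure_image_ball (D : F →ₗ[ℂ] E) one_pos
  refine key.2 ?_
  have hT := (hCD.isCompact_closure_image_ball (f := ((C ∘L D : F →L[ℂ] F) : F →ₗ[ℂ] F))
    1).totallyBounded.subset subset_closure
  refine isCompact_iff_totallyBounded_isComplete.2 ⟨TotallyBounded.closure ?_, isClosed_closure.isComplete⟩
  rw [Metric.totallyBounded_iff]
  intro ε hε
  -- Since ‖D u‖² = ⟪u, C D u⟫ ≤ ‖C D u‖ ‖u‖ and differences of points of the unit ball have norm at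
  -- most 2, an (ε²/2)-net for C D yields an ε-net for D.
  obtain ⟨t, htsub, htfin, hcov⟩ := Metric.finite_approx_of_totallyBounded hT (ε ^ 2 / 2)
    (by positivity)
  have hpre : ∀ y ∈ t, ∃ x ∈ ball (0 : F) 1, C (D x) = y := fun y hy => htsub hy
  choose! p hp hpt using hpre
  refine ⟨(fun y => D (p y)) '' t, htfin.image _, ?_⟩
  rintro _ ⟨x, hx, rfl⟩
  obtain ⟨y, hy, hxy⟩ := mem_iUnion₂.1 (hcov (mem_image_of_mem _ hx))
  refine mem_iUnion₂.2 ⟨_, mem_image_of_mem _ hy, ?_⟩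
  have hpy := hp y hy
  rw [mem_ball_zero_iff] at hx hpy
  have h1 : ‖C (D x) - C (D (p y))‖ < ε ^ 2 / 2 := by
    have := hpt y hy
    rw [← this, mem_ball, dist_eq_norm] at hxy
    exact hxy
  have h2 : ‖D (x - p y)‖ ^ 2 ≤ ‖C (D (x - p y))‖ * ‖x - p y‖ := by
    have h3 : ⟪D (x - p y), D (x - p y)⟫_ℂ = ⟪x - p y, C (D (x - p y))⟫_ℂ := by
      rw [hD, ContinuousLinearMap.adjoint_inner_left]
    have h4 := norm_inner_le_norm (𝕜 := ℂ) (x - p y) (C (D (x - p y)))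
    rw [← h3, inner_self_eq_norm_sq_to_K, norm_pow, RCLike.norm_ofReal, abs_norm] at h4
    linarith
  have h5 : ‖x - p y‖ ≤ 2 := (norm_sub_le _ _).trans (by linarith)
  rw [map_sub, map_sub] at h2
  have h6 : ‖D x - D (p y)‖ ^ 2 < ε ^ 2 := by nlinarith [norm_nonneg (C (D x) - C (D (p y)))]
  rw [mem_ball, dist_eq_norm]
  exact lt_of_pow_lt_pow_left₀ 2 hε.le h6

end

/-! ### Coanalytic Toeplitz operators with bounded symbol -/

section

open Filter Metric Set MeasureTheory
open scoped Topology ENNReal InnerProductSpace ComplexConjugate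

namespace SqSeq
open DiscDirichlet

/-- Dropping the first `i` coordinates. -/
noncomputable def drop (i : ℕ) : SqSeq →L[ℂ] SqSeq :=
  mkOp (LinearMap.pi fun k => (coord (i + k) : SqSeq →ₗ[ℂ] ℂ)) 1 zero_le_one fun f s => by
    have := sum_norm_sq_le f (s.map (addLeftEmbedding i))
    simpa using this

@[simp] theorem drop_apply (i : ℕ) (f : SqSeq) (k : ℕ) : drop i f k = f (i + k) := by
  simp [drop]

theorem norm_drop_apply_le (i : ℕ) (f : SqSeq) : ‖drop i f‖ ≤ ‖f‖ := by
  have h := (drop i).le_of_opNorm_le (norm_mkOp_le _ _ _ _) f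
  rwa [one_mul] at h

theorem norm_exp_nat_mul (n : ℕ) (θ : ℝ) : ‖Complex.exp (n * θ * Complex.I)‖ = 1 := by
  have := Complex.norm_exp_ofReal_mul_I (n * θ)
  push_cast at this
  exact this

theorem tsum_conv_mul_exp {a f : ℕ → ℂ} (ha : Summable fun n => ‖a n‖)
    (hf : Summable fun n => ‖f n‖) (θ : ℝ) :
    ∑' n : ℕ, (∑ j ∈ Finset.range (n + 1), a j * f (n - j)) * Complex.exp (n * θ * Complex.I) =
      (∑' n : ℕ, a n * Complex.exp (n * θ * Complex.I)) *
        ∑' n : ℕ, f n * Complex.exp (n * θ * Complex.I) := by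
  rw [tsum_mul_tsum_eq_tsum_sum_range_of_summable_norm]
  · refine tsum_congr fun n => ?_
    rw [Finset.sum_mul]
    refine Finset.sum_congr rfl fun j hj => ?_
    have hjn : j + (n - j) = n := by have := Finset.mem_range.1 hj; omega
    have hsplit : Complex.exp (n * θ * Complex.I) = Complex.exp (j * θ * Complex.I) *
        Complex.exp ((n - j : ℕ) * θ * Complex.I) := by
      rw [← Complex.exp_add]
      congr 1
      have : (n : ℂ) = (j : ℂ) + ((n - j : ℕ) : ℂ) := by exact_mod_cast hjn.symm
      rw [this]
      ring
    rw [hsplit]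
    ring
  · simp_rw [norm_mul (a _), norm_exp_nat_mul, mul_one]
    exact ha
  · simp_rw [norm_mul (f _), norm_exp_nat_mul, mul_one]
    exact hf

/-- Convolution of coefficients is multiplication of functions on the circle; Parseval is used for
the product and for the factor that is not bounded by C. -/
theorem sum_norm_sq_conv_le_of_summable {a f : ℕ → ℂ} (ha : Summable fun n => ‖a n‖)
    (hf : Summable fun n => ‖f n‖) {C : ℝ} (hC : 0 ≤ C)
    (hb : ∀ θ : ℝ, ‖∑' n : ℕ, a n * Complex.exp (n * θ * Complex.I)‖ ≤ C)
    (hf2 : Summable fun n => ‖f n‖ ^ 2) (s : Finset ℕ) :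
    ∑ i ∈ s, ‖∑ j ∈ Finset.range (i + 1), a j * f (i - j)‖ ^ 2 ≤ C ^ 2 * ∑' n, ‖f n‖ ^ 2 := by
  have hP1 := lintegral_norm_sq_tsum (summable_norm_sum_mul_range_of_summable_norm ha hf)
  have hP2 := lintegral_norm_sq_tsum hf
  have hle : ∫⁻ θ in Ioo (-Real.pi) Real.pi, ‖∑' n : ℕ,
      (∑ j ∈ Finset.range (n + 1), a j * f (n - j)) * Complex.exp (n * θ * Complex.I)‖ₑ ^ 2 ≤
      ENNReal.ofReal C ^ 2 * ∫⁻ θ in Ioo (-Real.pi) Real.pi,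
        ‖∑' n, f n * Complex.exp (n * θ * Complex.I)‖ₑ ^ 2 := by
    rw [← lintegral_const_mul' _ _ (ENNReal.pow_ne_top ENNReal.ofReal_ne_top)]
    refine lintegral_mono fun θ => ?_
    rw [tsum_conv_mul_exp ha hf, enorm_mul, mul_pow]
    gcongr
    rw [← ofReal_norm]
    exact ENNReal.ofReal_le_ofReal (hb θ)
  rw [hP1, hP2, ← mul_assoc, mul_comm (_ ^ 2), mul_assoc,
    ENNReal.mul_le_mul_iff_right (by simpa using Real.pi_pos) ENNReal.ofReal_ne_top] at hle
  have hconv : ∀ c : ℂ, ‖c‖ₑ ^ 2 = ENNReal.ofReal (‖c‖ ^ 2) := fun c => by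
    rw [ENNReal.ofReal_pow (norm_nonneg _), ofReal_norm]
  have h3 := (ENNReal.sum_le_tsum s).trans hle
  simp only [hconv] at h3
  rw [← ENNReal.ofReal_tsum_of_nonneg (fun n => by positivity) hf2,
    ← ENNReal.ofReal_pow hC, ← ENNReal.ofReal_mul (by positivity),
    ← ENNReal.ofReal_sum_of_nonneg fun i _ => by positivity,
    ENNReal.ofReal_le_ofReal_iff (mul_nonneg (by positivity) (tsum_nonneg fun _ => by positivity))] at h3
  exact h3

/-- The coefficients need not be absolutely summable on the unit circle, so both sequences are
damped by r^n. The bound does not depend on r, and on a finite set of indices r can then tend to 1.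
-/
theorem sum_norm_sq_conv_le_of_lt {g : ℂ → ℂ} (hg : DifferentiableOn ℂ g (ball 0 1)) {C : ℝ}
    (hC : 0 ≤ C) (hb : ∀ z ∈ ball (0 : ℂ) 1, ‖g z‖ ≤ C) (f : SqSeq) (s : Finset ℕ) {r : ℝ}
    (hr0 : 0 < r) (hr1 : r < 1) :
    ∑ i ∈ s, (‖∑ j ∈ Finset.range (i + 1), coeff g j * f (i - j)‖ * r ^ i) ^ 2 ≤
      (C * ‖f‖) ^ 2 := by
  have hrn : ∀ n : ℕ, ‖(r : ℂ) ^ n‖ = r ^ n := fun n => by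
    rw [norm_pow, Complex.norm_real, Real.norm_of_nonneg hr0.le]
  have ha : Summable fun n => ‖coeff g n * (r : ℂ) ^ n‖ := by
    simp_rw [norm_mul, hrn]
    exact summable_norm_coeff hg hr0.le hr1
  have hfle : ∀ n, ‖f n * (r : ℂ) ^ n‖ ^ 2 ≤ ‖f n‖ ^ 2 := fun n => by
    rw [norm_mul, hrn]
    gcongr
    exact mul_le_of_le_one_right (norm_nonneg _) (pow_le_one₀ hr0.le hr1.le)
  have hf2 : Summable fun n => ‖f n * (r : ℂ) ^ n‖ ^ 2 :=
    Summable.of_nonneg_of_le (fun _ => by positivity) hfle (hasSum_norm_sq f).summable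
  have hf : Summable fun n => ‖f n * (r : ℂ) ^ n‖ := by
    refine Summable.of_nonneg_of_le (fun n => norm_nonneg _) (fun n => ?_)
      ((summable_geometric_of_lt_one hr0.le hr1).mul_left ‖f‖)
    rw [norm_mul, hrn]
    gcongr
    exact norm_apply_le f n
  have hsup : ∀ θ : ℝ, ‖∑' n : ℕ, coeff g n * (r : ℂ) ^ n * Complex.exp (n * θ * Complex.I)‖ ≤ C := by
    intro θ
    have hn : ‖(r : ℂ) * Complex.exp (θ * Complex.I)‖ < 1 := by
      rwa [norm_mul, Complex.norm_real, Real.norm_of_nonneg hr0.le,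
        Complex.norm_exp_ofReal_mul_I, mul_one]
    have h1 : ∑' n : ℕ, coeff g n * (r : ℂ) ^ n * Complex.exp (n * θ * Complex.I) =
        g (r * Complex.exp (θ * Complex.I)) := by
      rw [← (hasSum_coeff hg hn).tsum_eq]
      refine tsum_congr fun n => ?_
      rw [mul_pow, ← Complex.exp_nat_mul, ← mul_assoc, ← mul_assoc]
    rw [h1]
    exact hb _ (mem_ball_zero_iff.2 hn)
  have h := sum_norm_sq_conv_le_of_summable ha hf hC hsup hf2 s
  have hle : ∑' n, ‖f n * (r : ℂ) ^ n‖ ^ 2 ≤ ‖f‖ ^ 2 :=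
    hf2.tsum_le_of_sum_le fun t => (Finset.sum_le_sum fun n _ => hfle n).trans (sum_norm_sq_le f t)
  rw [mul_pow]
  refine le_trans (le_of_eq (Finset.sum_congr rfl fun i _ => ?_))
    (h.trans (mul_le_mul_of_nonneg_left hle (by positivity)))
  have hcr : ∑ j ∈ Finset.range (i + 1), (coeff g j * (r : ℂ) ^ j) *
      (f (i - j) * (r : ℂ) ^ (i - j)) =
      (∑ j ∈ Finset.range (i + 1), coeff g j * f (i - j)) * (r : ℂ) ^ i := by
    rw [Finset.sum_mul]
    refine Finset.sum_congr rfl fun j hj => ?_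
    have : (r : ℂ) ^ i = (r : ℂ) ^ j * (r : ℂ) ^ (i - j) := by
      rw [← pow_add]
      congr 1
      have := Finset.mem_range.1 hj
      omega
    rw [this]
    ring
  rw [hcr, norm_mul, hrn]

theorem sum_norm_sq_conv_le {g : ℂ → ℂ} (hg : DifferentiableOn ℂ g (ball 0 1)) {C : ℝ} (hC : 0 ≤ C)
    (hb : ∀ z ∈ ball (0 : ℂ) 1, ‖g z‖ ≤ C) (f : SqSeq) (s : Finset ℕ) :
    ∑ i ∈ s, ‖∑ j ∈ Finset.range (i + 1), coeff g j * f (i - j)‖ ^ 2 ≤ (C * ‖f‖) ^ 2 := by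
  have hcont : Tendsto (fun r : ℝ => ∑ i ∈ s,
      (‖∑ j ∈ Finset.range (i + 1), coeff g j * f (i - j)‖ * r ^ i) ^ 2) (𝓝[<] 1)
      (𝓝 (∑ i ∈ s, (‖∑ j ∈ Finset.range (i + 1), coeff g j * f (i - j)‖ * 1 ^ i) ^ 2)) := by
    refine Tendsto.mono_left (Continuous.tendsto ?_ _) nhdsWithin_le_nhds
    refine continuous_finsetSum _ fun i _ => ?_
    fun_prop
  have := le_of_tendsto hcont (by
    filter_upwards [Ioo_mem_nhdsLT (show (0 : ℝ) < 1 by norm_num)] with r hr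
    exact sum_norm_sq_conv_le_of_lt hg hC hb f s hr.1 hr.2)
  simpa only [one_pow, mul_one] using this

/-- Convolution with the conjugated Taylor coefficients of `g`. -/
noncomputable def convOp {g : ℂ → ℂ} (hg : BoundedDirichlet g) : SqSeq →L[ℂ] SqSeq :=
  mkOp (LinearMap.pi fun i => ∑ j ∈ Finset.range (i + 1),
      conj (coeff g j) • (coord (i - j) : SqSeq →ₗ[ℂ] ℂ)) hg.bdd.choose
    hg.bdd.choose_spec.1.le fun f s => by
    -- The estimate concerns the unconjugated coefficients; conjugating the whole convolution sum
    -- turns it into the one for `star f`.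
    have h := sum_norm_sq_conv_le hg.diff hg.bdd.choose_spec.1.le hg.bdd.choose_spec.2 (star f) s
    rw [norm_star] at h
    refine le_trans (le_of_eq (Finset.sum_congr rfl fun i _ => ?_)) h
    rw [← RCLike.norm_conj, LinearMap.pi_apply]
    simp [map_sum]

theorem convOp_apply {g : ℂ → ℂ} (hg : BoundedDirichlet g) (f : SqSeq) (i : ℕ) :
    convOp hg f i = ∑ j ∈ Finset.range (i + 1), conj (coeff g j) * f (i - j) := by
  simp [convOp]

theorem convOp_basisVec {g : ℂ → ℂ} (hg : BoundedDirichlet g) (i j : ℕ) :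
    convOp hg (basisVec i) j = if i ≤ j then conj (coeff g (j - i)) else 0 := by
  rw [convOp_apply]
  simp only [basisVec_apply, mul_ite, mul_one, mul_zero]
  split_ifs with h
  · rw [Finset.sum_eq_single_of_mem (j - i) (Finset.mem_range.2 (by omega))]
    · rw [if_pos (by omega)]
    · intro k hk hne
      rw [if_neg]
      have := Finset.mem_range.1 hk
      omega
  · refine Finset.sum_eq_zero fun k hk => if_neg ?_
    omega

/-- The coanalytic Toeplitz operator with matrix entries `coeff g (j - i)`, `i ≤ j`. -/
noncomputable def toeplitz {g : ℂ → ℂ} (hg : BoundedDirichlet g) : SqSeq →L[ℂ] SqSeq :=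
  ContinuousLinearMap.adjoint (convOp hg)

theorem hasSum_toeplitz {g : ℂ → ℂ} (hg : BoundedDirichlet g) (f : SqSeq) (i : ℕ) :
    HasSum (fun k => coeff g k * f (i + k)) (toeplitz hg f i) := by
  have h := lp.hasSum_inner (𝕜 := ℂ) (convOp hg (basisVec i)) f
  rw [← ContinuousLinearMap.adjoint_inner_right, inner_basisVec] at h
  have h2 := (hasSum_nat_add_iff' i).2 h
  rw [Finset.sum_eq_zero (fun j hj => by
    rw [convOp_basisVec, if_neg (by have := Finset.mem_range.1 hj; omega), inner_zero_left]),
    sub_zero] at h2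
  have e : (fun k => coeff g k * f (i + k)) =
      fun k => ⟪convOp hg (basisVec i) (k + i), f (k + i)⟫_ℂ := by
    funext k
    rw [convOp_basisVec, if_pos (by omega), Nat.add_sub_cancel, RCLike.inner_apply,
      RingHomCompTriple.comp_apply, add_comm k i, mul_comm]
    simp
  rw [e]
  exact h2

end SqSeq

end

/-! ### Weights, and weighted Toeplitz operators as compact perturbations -/

section

open Filter Metric Set MeasureTheory
open scoped Topology ENNReal InnerProductSpace ComplexConjugate

namespace SqSeq
open DiscDirichlet

/-- A Hilbert-Schmidt operator, given by its rows. -/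
theorem exists_hilbertSchmidt (ρ : ℕ → SqSeq →L[ℂ] ℂ) (R : ℕ → ℝ)
    (hR : Summable fun i => R i ^ 2) (h : ∀ i f, ‖ρ i f‖ ≤ R i * ‖f‖) :
    ∃ T : SqSeq →L[ℂ] SqSeq, IsCompactOperator T ∧ ∀ f i, T f i = ρ i f := by
  have hR0 : ∀ i, 0 ≤ R i := fun i => by
    have := h i (basisVec 0)
    rw [norm_basisVec, mul_one] at this
    exact (norm_nonneg _).trans this
  let T := mkOp (LinearMap.pi fun i => (ρ i : SqSeq →ₗ[ℂ] ℂ)) (√(∑' i, R i ^ 2))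
    (Real.sqrt_nonneg _) fun f s => by
      rw [mul_pow, Real.sq_sqrt (tsum_nonneg fun _ => by positivity)]
      calc ∑ i ∈ s, ‖ρ i f‖ ^ 2 ≤ ∑ i ∈ s, R i ^ 2 * ‖f‖ ^ 2 := by
            refine Finset.sum_le_sum fun i _ => ?_
            rw [← mul_pow]
            gcongr
            exact h i f
        _ = (∑ i ∈ s, R i ^ 2) * ‖f‖ ^ 2 := by rw [Finset.sum_mul]
        _ ≤ _ := by
            gcongr
            exact hR.sum_le_tsum s fun _ _ => by positivity
  have hT : ∀ f i, T f i = ρ i f := fun f i => rfl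
  refine ⟨T, ?_, hT⟩
  -- The data bound the rows of T, while the compactness criterion is about images of basis vectors;
  -- the rows of T are those images for the adjoint.
  have hadj : IsCompactOperator (ContinuousLinearMap.adjoint T) := by
    refine isCompactOperator_of_summable (Summable.of_nonneg_of_le (fun _ => by positivity)
      (fun i => ?_) hR)
    gcongr
    set x := ContinuousLinearMap.adjoint T (basisVec i) with hx
    have h1 : ‖⟪x, x⟫_ℂ‖ ≤ R i * ‖x‖ := by
      nth_rw 1 [hx]
      rw [ContinuousLinearMap.adjoint_inner_left, inner_basisVec, hT]
      exact h i x
    rw [inner_self_eq_norm_sq_to_K, norm_pow, RCLike.norm_ofReal, abs_norm, sq] at h1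
    by_cases hx0 : ‖x‖ = 0
    · rw [hx0]
      exact hR0 i
    · exact le_of_mul_le_mul_right h1 (lt_of_le_of_ne (norm_nonneg _) (Ne.symm hx0))
  have := hadj.adjoint_hilbert
  rwa [ContinuousLinearMap.adjoint_adjoint] at this

/-- The weights `(i + 1) ^ p`. -/
noncomputable def weight (p : ℝ) (i : ℕ) : ℝ := ((i : ℝ) + 1) ^ p

theorem weight_pos (p : ℝ) (i : ℕ) : 0 < weight p i := Real.rpow_pos_of_pos (by positivity) p

theorem one_le_weight {p : ℝ} (hp : 0 ≤ p) (i : ℕ) : 1 ≤ weight p i :=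
  Real.one_le_rpow (by linarith [Nat.cast_nonneg (α := ℝ) i]) hp

theorem weight_zero (p : ℝ) : weight p 0 = 1 := by simp [weight]

theorem weight_mono {p : ℝ} (hp : 0 ≤ p) : Monotone (weight p) := fun i j hij =>
  Real.rpow_le_rpow (by positivity) (by gcongr) hp

theorem weight_mul (p q : ℝ) (i : ℕ) : weight p i * weight q i = weight (p + q) i :=
  (Real.rpow_add (by positivity) p q).symm

theorem sum_inv_sqrt_le (k : ℕ) : ∑ i ∈ Finset.range k, (√((i : ℝ) + 1))⁻¹ ≤ 2 * √k := by
  induction k with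
  | zero => simp
  | succ k ih =>
    rw [Finset.sum_range_succ]
    have h1 : (√((k : ℝ) + 1))⁻¹ ≤ 2 * √((k : ℝ) + 1) - 2 * √k := by
      have hpos : 0 < √((k : ℝ) + 1) := Real.sqrt_pos.2 (by positivity)
      rw [inv_le_iff_one_le_mul₀ hpos]
      have e1 := Real.sq_sqrt (show (0 : ℝ) ≤ k + 1 by positivity)
      have e2 := Real.sq_sqrt (show (0 : ℝ) ≤ k by positivity)
      nlinarith [sq_nonneg (√((k : ℝ) + 1) - √k)]
    push_cast
    linarith

theorem sum_inv_sq_le (k n : ℕ) (hk : 0 < k) :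
    ∑ i ∈ Finset.Ico k (k + n), (((i : ℝ) + 1) ^ 2)⁻¹ ≤ (k : ℝ)⁻¹ - ((k + n : ℕ) : ℝ)⁻¹ := by
  induction n with
  | zero => simp
  | succ n ih =>
    rw [← add_assoc, Finset.sum_Ico_succ_top (by omega)]
    have hm : (0 : ℝ) < ((k + n : ℕ) : ℝ) := by exact_mod_cast (by omega : 0 < k + n)
    have h1 : ((((k + n : ℕ) : ℝ) + 1) ^ 2)⁻¹ ≤ ((k + n : ℕ) : ℝ)⁻¹ - ((k + n + 1 : ℕ) : ℝ)⁻¹ := by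
      have e : ((k + n + 1 : ℕ) : ℝ) = ((k + n : ℕ) : ℝ) + 1 := by push_cast; ring
      rw [e]
      set m := ((k + n : ℕ) : ℝ)
      have e2 : m⁻¹ - (m + 1)⁻¹ = (m * (m + 1))⁻¹ := by field_simp; ring
      rw [e2]
      refine inv_anti₀ (by positivity) ?_
      nlinarith
    linarith

/-- The ratio is (1 + k/(i+1))^p. The linear bound is good for i ≥ k. For i < k the square of the
ratio has exponent 2p ≤ 1/2 and base at most 2k/(i+1), giving a bound whose sum over i < k is still
O(k). -/
theorem weight_ratio_sub_one_le {p : ℝ} (hp0 : 0 ≤ p) (hp : p ≤ 1 / 4) (i k : ℕ) :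
    0 ≤ weight p (i + k) / weight p i - 1 ∧
      weight p (i + k) / weight p i - 1 ≤ k / ((i : ℝ) + 1) ∧
      (i < k → (weight p (i + k) / weight p i - 1) ^ 2 ≤ √(2 * k) * (√((i : ℝ) + 1))⁻¹) := by
  have hi : (0 : ℝ) < (i : ℝ) + 1 := by positivity
  have hratio : weight p (i + k) / weight p i = (1 + k / ((i : ℝ) + 1)) ^ p := by
    rw [weight, weight, ← Real.div_rpow (by positivity) (by positivity)]
    congr 1
    push_cast
    field_simp
    ring
  have hx : (0 : ℝ) ≤ k / ((i : ℝ) + 1) := by positivity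
  have h1 : 1 ≤ weight p (i + k) / weight p i :=
    (one_le_div (weight_pos p i)).2 (weight_mono hp0 (by omega))
  refine ⟨by linarith, ?_, fun hik => ?_⟩
  · rw [hratio]
    have : (1 + (k : ℝ) / ((i : ℝ) + 1)) ^ p ≤ (1 + (k : ℝ) / ((i : ℝ) + 1)) ^ (1 : ℝ) :=
      Real.rpow_le_rpow_of_exponent_le (by linarith) (by linarith)
    rw [Real.rpow_one] at this
    linarith
  · have hik' : (i : ℝ) + 1 ≤ k := by exact_mod_cast hik
    have h2 : (weight p (i + k) / weight p i - 1) ^ 2 ≤ (weight p (i + k) / weight p i) ^ 2 := by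
      gcongr
      linarith
    refine h2.trans ?_
    have h3 : 1 + (k : ℝ) / ((i : ℝ) + 1) ≤ 2 * k / ((i : ℝ) + 1) := by
      rw [← sub_nonneg]
      have : 2 * (k : ℝ) / ((i : ℝ) + 1) - (1 + (k : ℝ) / ((i : ℝ) + 1)) =
          (k - ((i : ℝ) + 1)) / ((i : ℝ) + 1) := by field_simp; ring
      rw [this]
      exact div_nonneg (by linarith) hi.le
    have h4 : (weight p (i + k) / weight p i) ^ 2 ≤ (1 + (k : ℝ) / ((i : ℝ) + 1)) ^ (1 / 2 : ℝ) := by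
      rw [hratio, ← Real.rpow_natCast, ← Real.rpow_mul (by positivity)]
      refine Real.rpow_le_rpow_of_exponent_le (by linarith) ?_
      push_cast
      linarith
    rw [← Real.sqrt_eq_rpow] at h4
    refine h4.trans ((Real.sqrt_le_sqrt h3).trans (le_of_eq ?_))
    rw [Real.sqrt_div (by positivity), div_eq_mul_inv]

/-- Linear growth in k is what ∑ k|a_k|² can absorb. Indices below k contribute at most 2√2 k ≤ 3k,
the others at most k² ∑_{i ≥ k} (i+1)^{-2} ≤ k. -/
theorem sum_weight_ratio_le {p : ℝ} (hp0 : 0 ≤ p) (hp : p ≤ 1 / 4) (k n : ℕ) :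
    ∑ i ∈ Finset.range n, (weight p (i + k) / weight p i - 1) ^ 2 ≤ 4 * (k : ℝ) := by
  rcases Nat.eq_zero_or_pos k with rfl | hk
  · refine le_of_eq ?_
    simp [div_self (weight_pos p _).ne', sub_self]
  have hk' : (0 : ℝ) < k := by exact_mod_cast hk
  have hle : ∑ i ∈ Finset.range n, (weight p (i + k) / weight p i - 1) ^ 2 ≤
      ∑ i ∈ Finset.range (k + n), (weight p (i + k) / weight p i - 1) ^ 2 :=
    Finset.sum_le_sum_of_subset_of_nonneg (Finset.range_mono (by omega))
      fun _ _ _ => by positivity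
  rw [← Finset.sum_range_add_sum_Ico _ (show k ≤ k + n by omega)] at hle
  have h1 : ∑ i ∈ Finset.range k, (weight p (i + k) / weight p i - 1) ^ 2 ≤ 3 * (k : ℝ) := by
    calc _ ≤ ∑ i ∈ Finset.range k, √(2 * k) * (√((i : ℝ) + 1))⁻¹ :=
          Finset.sum_le_sum fun i hi =>
            (weight_ratio_sub_one_le hp0 hp i k).2.2 (Finset.mem_range.1 hi)
      _ = √(2 * k) * ∑ i ∈ Finset.range k, (√((i : ℝ) + 1))⁻¹ := by rw [Finset.mul_sum]
      _ ≤ √(2 * k) * (2 * √k) := by gcongr; exact sum_inv_sqrt_le k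
      _ ≤ 3 * k := by
          rw [Real.sqrt_mul (by norm_num)]
          have e := Real.mul_self_sqrt hk'.le
          have e2 : √2 ≤ 3 / 2 := by rw [Real.sqrt_le_iff]; norm_num
          nlinarith
  have h2 : ∑ i ∈ Finset.Ico k (k + n), (weight p (i + k) / weight p i - 1) ^ 2 ≤ (k : ℝ) := by
    calc _ ≤ ∑ i ∈ Finset.Ico k (k + n), (k : ℝ) ^ 2 * (((i : ℝ) + 1) ^ 2)⁻¹ := by
          refine Finset.sum_le_sum fun i _ => ?_
          obtain ⟨h0, h1, -⟩ := weight_ratio_sub_one_le hp0 hp i k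
          rw [← div_eq_mul_inv, ← div_pow]
          gcongr
      _ = (k : ℝ) ^ 2 * ∑ i ∈ Finset.Ico k (k + n), (((i : ℝ) + 1) ^ 2)⁻¹ := by
          rw [Finset.mul_sum]
      _ ≤ (k : ℝ) ^ 2 * (k : ℝ)⁻¹ := by
          gcongr
          have := sum_inv_sq_le k n hk
          have h0 : (0 : ℝ) ≤ ((k + n : ℕ) : ℝ)⁻¹ := by positivity
          linarith
      _ = k := by field_simp
  linarith

theorem summable_coeff_sq {g : ℂ → ℂ} (hg : BoundedDirichlet g) :
    Summable fun k => ‖coeff g k‖ ^ 2 := by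
  have h := hg.summable_coeff
  rw [← summable_nat_add_iff 1] at h ⊢
  refine Summable.of_nonneg_of_le (fun _ => by positivity) (fun k => ?_) h
  refine le_mul_of_one_le_left (by positivity) ?_
  push_cast
  linarith [Nat.cast_nonneg (α := ℝ) k]

theorem summable_weight_coeff {g : ℂ → ℂ} (hg : BoundedDirichlet g) {p : ℝ} (hp0 : 0 ≤ p)
    (hp : p ≤ 1 / 4) : Summable fun x : ℕ × ℕ =>
      ‖conj (coeff g x.2) * (weight p (x.1 + x.2) / weight p x.1 - 1 : ℝ)‖ ^ 2 := by
  have hs : ∀ k, Summable fun i => (weight p (i + k) / weight p i - 1) ^ 2 := fun k =>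
    summable_of_sum_range_le (fun _ => by positivity) (sum_weight_ratio_le hp0 hp k)
  have e : ∀ i k, ‖conj (coeff g k) * (weight p (i + k) / weight p i - 1 : ℝ)‖ ^ 2 =
      ‖coeff g k‖ ^ 2 * (weight p (i + k) / weight p i - 1) ^ 2 := fun i k => by
    rw [norm_mul, RCLike.norm_conj, mul_pow, Complex.norm_real, Real.norm_eq_abs, sq_abs]
  have hswap : Summable fun x : ℕ × ℕ =>
      ‖conj (coeff g x.1) * (weight p (x.2 + x.1) / weight p x.2 - 1 : ℝ)‖ ^ 2 := by
    rw [summable_prod_of_nonneg (fun _ => by positivity)]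
    simp only [e]
    refine ⟨fun k => (hs k).mul_left _, ?_⟩
    refine Summable.of_nonneg_of_le (fun k => tsum_nonneg fun _ => by positivity) (fun k => ?_)
      (hg.summable_coeff.mul_left 4)
    rw [tsum_mul_left]
    have := Real.tsum_le_of_sum_range_le (fun i => by positivity) (sum_weight_ratio_le hp0 hp k)
    calc _ ≤ ‖coeff g k‖ ^ 2 * (4 * k) := by gcongr
      _ = _ := by ring
  exact hswap.prod_symm

/-- The correction to `toeplitz hg` has entries a_k (w(i+k)/w(i) - 1), where w(i) = (i+1)^p, and is
Hilbert–Schmidt. Defining the weighted operator as this sum gives its boundedness and the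
compactness of the difference together. -/
theorem exists_weightedToeplitz {g : ℂ → ℂ} (hg : BoundedDirichlet g) {p : ℝ} (hp0 : 0 ≤ p)
    (hp : p ≤ 1 / 4) : ∃ A : SqSeq →L[ℂ] SqSeq, IsCompactOperator (A - toeplitz hg) ∧
      ∀ f i, HasSum (fun k => coeff g k * (weight p (i + k) / weight p i : ℝ) * f (i + k)) (A f i) := by
  have hs := summable_weight_coeff hg hp0 hp
  have hs2 := (summable_prod_of_nonneg (fun _ => by positivity)).1 hs
  let ρ : ℕ → SqSeq := fun i => ofSummable _ (hs2.1 i)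
  obtain ⟨E, hE, hEa⟩ := exists_hilbertSchmidt (fun i => (innerSL ℂ (ρ i) : SqSeq →L[ℂ] ℂ) ∘L drop i) (fun i => ‖ρ i‖)
    (by simpa only [ρ, norm_sq_ofSummable] using hs2.2) (fun i f => by
      refine (norm_inner_le_norm (𝕜 := ℂ) (ρ i) (drop i f)).trans ?_
      gcongr
      exact norm_drop_apply_le i f)
  refine ⟨toeplitz hg + E, by simpa using hE, fun f i => ?_⟩
  have h1 := hasSum_toeplitz hg f i
  have h2 := lp.hasSum_inner (𝕜 := ℂ) (ρ i) (drop i f)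
  have h3 : ⟪ρ i, drop i f⟫_ℂ = E f i := (hEa f i).symm
  rw [h3] at h2
  have h4 := h1.add h2
  have e : (fun k => coeff g k * (weight p (i + k) / weight p i : ℝ) * f (i + k)) =
      fun k => coeff g k * f (i + k) + ⟪ρ i k, drop i f k⟫_ℂ := by
    funext k
    rw [drop_apply, RCLike.inner_apply]
    simp only [ρ, ofSummable_apply]
    rw [map_mul, Complex.conj_conj, Complex.conj_ofReal]
    push_cast
    ring
  rw [e]
  exact h4

/-- The coanalytic Toeplitz operator with symbol `g` on the space with weights `(i + 1) ^ p`. -/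
noncomputable def wToeplitz {g : ℂ → ℂ} (hg : BoundedDirichlet g) {p : ℝ}
    (hp : p ∈ Icc (0 : ℝ) (1 / 4)) : SqSeq →L[ℂ] SqSeq :=
  (exists_weightedToeplitz hg hp.1 hp.2).choose

theorem isCompactOperator_wToeplitz_sub {g : ℂ → ℂ} (hg : BoundedDirichlet g) {p : ℝ}
    (hp : p ∈ Icc (0 : ℝ) (1 / 4)) : IsCompactOperator (wToeplitz hg hp - toeplitz hg) :=
  (exists_weightedToeplitz hg hp.1 hp.2).choose_spec.1

theorem hasSum_wToeplitz {g : ℂ → ℂ} (hg : BoundedDirichlet g) {p : ℝ}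
    (hp : p ∈ Icc (0 : ℝ) (1 / 4)) (f : SqSeq) (i : ℕ) :
    HasSum (fun k => coeff g k * (weight p (i + k) / weight p i : ℝ) * f (i + k))
      (wToeplitz hg hp f i) :=
  (exists_weightedToeplitz hg hp.1 hp.2).choose_spec.2 f i

end SqSeq

end

/-! ### Kernel vectors, symbol calculus and weighted shifts -/

section

open Filter Metric Set MeasureTheory
open scoped Topology ENNReal InnerProductSpace ComplexConjugate

namespace SqSeq
open DiscDirichlet

/-- Parseval on the circle of radius 1/2. -/
theorem eq_zero_of_hasSum_pow_zero {a : ℕ → ℂ} {C : ℝ} (ha : ∀ n, ‖a n‖ ≤ C)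
    (h : ∀ z : ℂ, ‖z‖ < 1 → HasSum (fun n => a n * z ^ n) 0) (n : ℕ) : a n = 0 := by
  have hb : Summable fun n => ‖a n * ((1 / 2 : ℝ) : ℂ) ^ n‖ := by
    refine Summable.of_nonneg_of_le (fun _ => norm_nonneg _) (fun n => ?_)
      ((summable_geometric_of_lt_one (r := 1 / 2) (by norm_num) (by norm_num)).mul_left C)
    rw [norm_mul, norm_pow, Complex.norm_real, Real.norm_of_nonneg (by norm_num)]
    gcongr
    exact ha n
  have h1 := lintegral_norm_sq_tsum hb
  have h2 : ∀ θ : ℝ, ∑' n : ℕ, a n * ((1 / 2 : ℝ) : ℂ) ^ n * Complex.exp (n * θ * Complex.I) = 0 := by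
    intro θ
    have hn : ‖((1 / 2 : ℝ) : ℂ) * Complex.exp (θ * Complex.I)‖ < 1 := by
      rw [norm_mul, Complex.norm_real, Complex.norm_exp_ofReal_mul_I]
      norm_num
    rw [← (h _ hn).tsum_eq]
    refine tsum_congr fun n => ?_
    rw [mul_pow, ← Complex.exp_nat_mul, ← mul_assoc, ← mul_assoc]
  simp only [h2] at h1
  simp only [enorm_zero, ne_eq, OfNat.ofNat_ne_zero, not_false_eq_true, zero_pow,
    lintegral_zero] at h1
  rcases mul_eq_zero.1 h1.symm with h3 | h3
  · exact absurd h3 (by simpa using Real.pi_pos)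
  · have h4 := ENNReal.tsum_eq_zero.1 h3 n
    simpa using h4

theorem summable_kernelVec {p : ℝ} (hp : 0 ≤ p) {z : ℂ} (hz : ‖z‖ < 1) :
    Summable fun i => ‖z ^ i / (weight p i : ℂ)‖ ^ 2 := by
  refine Summable.of_nonneg_of_le (fun _ => by positivity) (fun n => ?_)
    (summable_geometric_of_lt_one (r := ‖z‖ ^ 2) (by positivity)
      (pow_lt_one₀ (norm_nonneg _) hz two_ne_zero))
  rw [norm_div, norm_pow, Complex.norm_real, Real.norm_of_nonneg (weight_pos p n).le, ← pow_mul,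
    mul_comm 2, pow_mul]
  have h0 : 0 ≤ ‖z‖ ^ n := by positivity
  exact pow_le_pow_left₀ (div_nonneg h0 (weight_pos p n).le)
    (div_le_self h0 (one_le_weight hp n)) 2

open Classical in
/-- The vector with coordinates `z ^ i / (i + 1) ^ p`. -/
noncomputable def kernelVec (p : ℝ) (z : ℂ) : SqSeq :=
  if h : Summable fun i => ‖z ^ i / (weight p i : ℂ)‖ ^ 2 then ofSummable _ h else 0

theorem kernelVec_apply {p : ℝ} (hp : 0 ≤ p) {z : ℂ} (hz : ‖z‖ < 1) (i : ℕ) :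
    kernelVec p z i = z ^ i / (weight p i : ℂ) := by
  rw [kernelVec, dif_pos (summable_kernelVec hp hz), ofSummable_apply]

theorem kernelVec_zero {p : ℝ} (hp : 0 ≤ p) {z : ℂ} (hz : ‖z‖ < 1) : kernelVec p z 0 = 1 := by
  rw [kernelVec_apply hp hz, weight_zero]
  simp

theorem weight_ne_zero (p : ℝ) (i : ℕ) : (weight p i : ℂ) ≠ 0 := by
  exact_mod_cast (weight_pos p i).ne'

/-- The weights cancel and leave the Taylor series of g at z. Together with `ext_kernelVec` this
reduces identities between these operators to identities between symbols. -/
theorem wToeplitz_kernelVec {g : ℂ → ℂ} (hg : BoundedDirichlet g) {p : ℝ}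
    (hp : p ∈ Icc (0 : ℝ) (1 / 4)) {z : ℂ} (hz : ‖z‖ < 1) :
    wToeplitz hg hp (kernelVec p z) = g z • kernelVec p z := by
  ext i
  have h1 := hasSum_wToeplitz hg hp (kernelVec p z) i
  have h2 := (hasSum_coeff hg.diff hz).mul_right (z ^ i / (weight p i : ℂ))
  have e : (fun k => coeff g k * (weight p (i + k) / weight p i : ℝ) * kernelVec p z (i + k)) =
      fun k => coeff g k * z ^ k * (z ^ i / (weight p i : ℂ)) := by
    funext k
    rw [kernelVec_apply hp.1 hz]
    have h3 := weight_ne_zero p i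
    have h4 := weight_ne_zero p (i + k)
    push_cast
    rw [pow_add]
    field_simp
  rw [e] at h1
  rw [h1.unique h2, lp.coeFn_smul, Pi.smul_apply, kernelVec_apply hp.1 hz, smul_eq_mul]

theorem eq_zero_of_inner_kernelVec {p : ℝ} (hp : 0 ≤ p) {y : SqSeq}
    (h : ∀ z : ℂ, ‖z‖ < 1 → ⟪y, kernelVec p z⟫_ℂ = 0) : y = 0 := by
  have key := eq_zero_of_hasSum_pow_zero (a := fun i => conj (y i) / (weight p i : ℂ)) (C := ‖y‖)
    (fun i => by
      rw [norm_div, RCLike.norm_conj, Complex.norm_real, Real.norm_of_nonneg (weight_pos p i).le]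
      exact (div_le_self (norm_nonneg _) (one_le_weight hp i)).trans (norm_apply_le y i))
    fun z hz => by
      have h1 := lp.hasSum_inner (𝕜 := ℂ) y (kernelVec p z)
      rw [h z hz] at h1
      have e : (fun i => conj (y i) / (weight p i : ℂ) * z ^ i) =
          fun i => ⟪y i, kernelVec p z i⟫_ℂ := by
        funext i
        rw [RCLike.inner_apply, kernelVec_apply hp hz]
        ring
      rw [e]
      exact h1
  ext i
  have := key i
  rw [div_eq_zero_iff, or_iff_left (weight_ne_zero p i)] at this
  simpa using this

theorem span_kernelVec {p : ℝ} (hp : 0 ≤ p) :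
    (Submodule.span ℂ (kernelVec p '' ball 0 1)).topologicalClosure = ⊤ := by
  rw [Submodule.topologicalClosure_eq_top_iff, Submodule.eq_bot_iff]
  intro y hy
  refine eq_zero_of_inner_kernelVec hp fun z hz => ?_
  rw [Submodule.mem_orthogonal'] at hy
  exact hy _ (Submodule.subset_span ⟨z, mem_ball_zero_iff.2 hz, rfl⟩)

theorem ext_kernelVec {E : Type*} [NormedAddCommGroup E] [NormedSpace ℂ E] {p : ℝ} (hp : 0 ≤ p)
    {A B : SqSeq →L[ℂ] E} (h : ∀ z : ℂ, ‖z‖ < 1 → A (kernelVec p z) = B (kernelVec p z)) :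
    A = B := by
  refine ContinuousLinearMap.ext_on (s := kernelVec p '' ball 0 1) ?_ ?_
  · have := congrArg (SetLike.coe) (span_kernelVec hp)
    rw [Submodule.topologicalClosure_coe, Submodule.top_coe] at this
    exact dense_iff_closure_eq.2 this
  · rintro _ ⟨z, hz, rfl⟩
    exact h z (mem_ball_zero_iff.1 hz)

theorem wToeplitz_mul {g h k : ℂ → ℂ} (hg : BoundedDirichlet g) (hh : BoundedDirichlet h)
    (hk : BoundedDirichlet k) {p : ℝ} (hp : p ∈ Icc (0 : ℝ) (1 / 4))
    (e : ∀ z ∈ ball (0 : ℂ) 1, k z = g z * h z) :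
    wToeplitz hk hp = wToeplitz hg hp * wToeplitz hh hp := by
  refine ext_kernelVec hp.1 fun z hz => ?_
  rw [mul_apply_eq_comp, wToeplitz_kernelVec hh hp hz, map_smul,
    wToeplitz_kernelVec hg hp hz, wToeplitz_kernelVec hk hp hz, smul_smul,
    e z (mem_ball_zero_iff.2 hz), mul_comm]

theorem wToeplitz_eq_sub {g k : ℂ → ℂ} (hg : BoundedDirichlet g) (hk : BoundedDirichlet k)
    {p : ℝ} (hp : p ∈ Icc (0 : ℝ) (1 / 4)) {c : ℂ} (e : ∀ z ∈ ball (0 : ℂ) 1, k z = g z - c) :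
    wToeplitz hk hp = wToeplitz hg hp - c • 1 := by
  refine ext_kernelVec hp.1 fun z hz => ?_
  rw [_root_.sub_apply, _root_.smul_apply, one_apply_eq_self,
    wToeplitz_kernelVec hg hp hz, wToeplitz_kernelVec hk hp hz, e z (mem_ball_zero_iff.2 hz),
    sub_smul]

theorem wToeplitz_eq_one {k : ℂ → ℂ} (hk : BoundedDirichlet k)
    {p : ℝ} (hp : p ∈ Icc (0 : ℝ) (1 / 4)) (e : ∀ z ∈ ball (0 : ℂ) 1, k z = 1) :
    wToeplitz hk hp = 1 := by
  refine ext_kernelVec hp.1 fun z hz => ?_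
  rw [one_apply_eq_self, wToeplitz_kernelVec hk hp hz, e z (mem_ball_zero_iff.2 hz),
    one_smul]

/-- The reciprocal of a symbol bounded below is again bounded with finite Dirichlet integral, so its
weighted Toeplitz operator is the inverse. -/
theorem isUnit_wToeplitz {g : ℂ → ℂ} (hg : BoundedDirichlet g) {p : ℝ}
    (hp : p ∈ Icc (0 : ℝ) (1 / 4)) {δ : ℝ} (hδ : 0 < δ) (hb : ∀ z ∈ ball (0 : ℂ) 1, δ ≤ ‖g z‖) :
    IsUnit (wToeplitz hg hp) := by
  have hne : ∀ z ∈ ball (0 : ℂ) 1, g z ≠ 0 := fun z hz => norm_pos_iff.1 (hδ.trans_le (hb z hz))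
  have hi := hg.inv hδ hb
  have h1 : wToeplitz hg hp * wToeplitz hi hp = 1 := by
    rw [← wToeplitz_mul hg hi (hg.mul hi) hp fun _ _ => rfl]
    exact wToeplitz_eq_one _ hp fun z hz => mul_inv_cancel₀ (hne z hz)
  have h2 : wToeplitz hi hp * wToeplitz hg hp = 1 := by
    rw [← wToeplitz_mul hi hg (hi.mul hg) hp fun _ _ => rfl]
    exact wToeplitz_eq_one _ hp fun z hz => inv_mul_cancel₀ (hne z hz)
  exact ⟨⟨_, _, h1, h2⟩, rfl⟩

theorem isUnit_wToeplitz_sub {g : ℂ → ℂ} (hg : BoundedDirichlet g) {p : ℝ}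
    (hp : p ∈ Icc (0 : ℝ) (1 / 4)) {w : ℂ} (hw : w ∉ closure (g '' ball 0 1)) :
    IsUnit (wToeplitz hg hp - w • 1) := by
  rw [Metric.mem_closure_iff] at hw
  push Not at hw
  obtain ⟨ε, hε, h⟩ := hw
  rw [← wToeplitz_eq_sub hg (hg.sub_const w) hp fun _ _ => rfl]
  refine isUnit_wToeplitz _ hp hε fun z hz => ?_
  rw [← dist_eq_norm, dist_comm]
  exact h _ (mem_image_of_mem g hz)

/-- The diagonal operator with entries `(i + 1) ^ (-s)`. -/
noncomputable def diagOp (s : ℝ) (hs : 0 ≤ s) : SqSeq →L[ℂ] SqSeq :=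
  mkOp (LinearMap.pi fun i => (weight (-s) i : ℂ) • (coord i : SqSeq →ₗ[ℂ] ℂ)) 1 zero_le_one
    fun f t => by
      rw [one_mul]
      refine (Finset.sum_le_sum fun i _ => ?_).trans (sum_norm_sq_le f t)
      have h1 : weight (-s) i ≤ 1 := by
        have h2 := weight_mul s (-s) i
        rw [add_neg_cancel] at h2
        have h3 : weight 0 i = 1 := by simp [weight]
        nlinarith [one_le_weight hs i, weight_pos (-s) i]
      have h2 : (LinearMap.pi (fun i => (weight (-s) i : ℂ) • (coord i : SqSeq →ₗ[ℂ] ℂ))) f i =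
        (weight (-s) i : ℂ) * f i := by simp
      rw [h2, norm_mul, Complex.norm_real, Real.norm_of_nonneg (weight_pos _ i).le]
      exact pow_le_pow_left₀ (mul_nonneg (weight_pos _ i).le (norm_nonneg _))
        (mul_le_of_le_one_left (norm_nonneg _) h1) 2

theorem diagOp_apply {s : ℝ} (hs : 0 ≤ s) (f : SqSeq) (i : ℕ) :
    diagOp s hs f i = (weight (-s) i : ℂ) * f i := by
  simp [diagOp]

theorem diagOp_injective {s : ℝ} (hs : 0 ≤ s) {f : SqSeq} (h : diagOp s hs f = 0) : f = 0 := by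
  ext i
  have h1 := diagOp_apply hs f i
  rw [h, lp.coeFn_zero, Pi.zero_apply] at h1
  exact (mul_eq_zero.1 h1.symm).resolve_left (weight_ne_zero _ _)

theorem diagOp_kernelVec {s q : ℝ} (hs : 0 ≤ s) (hq : 0 ≤ q) {z : ℂ} (hz : ‖z‖ < 1) :
    diagOp s hs (kernelVec q z) = kernelVec (q + s) z := by
  ext i
  rw [diagOp_apply, kernelVec_apply hq hz, kernelVec_apply (by positivity) hz, ← weight_mul]
  have h2 := weight_mul s (-s) i
  rw [add_neg_cancel] at h2
  have h3 : weight 0 i = 1 := by simp [weight]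
  have h4 : (weight s i : ℂ) * weight (-s) i = 1 := by exact_mod_cast h2.trans h3
  have h5 := weight_ne_zero q i
  have h6 := weight_ne_zero s i
  push_cast
  field_simp
  linear_combination z ^ i * h4

theorem isCompactOperator_diagOp {s : ℝ} (hs : 0 < s) : IsCompactOperator (diagOp s hs.le) := by
  have hanti : ∀ N i, N ≤ i → weight (-s) i ≤ weight (-s) N := fun N i h =>
    Real.rpow_le_rpow_of_nonpos (by positivity) (by gcongr) (by linarith)
  refine isCompactOperator_of_tail (ε := weight (-s)) ?_ fun N f hf => ?_
  · refine (tendsto_rpow_neg_atTop hs).comp ?_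
    exact tendsto_atTop_add_const_right _ _ tendsto_natCast_atTop_atTop
  · refine norm_le_of_sum_le (mul_nonneg (weight_pos _ _).le (norm_nonneg _)) fun t => ?_
    rw [mul_pow]
    refine le_trans (Finset.sum_le_sum fun i _ => ?_)
      ((Finset.mul_sum _ _ _).symm.le.trans
        (mul_le_mul_of_nonneg_left (sum_norm_sq_le f t) (by positivity)))
    rw [diagOp_apply, norm_mul, mul_pow, Complex.norm_real, Real.norm_of_nonneg (weight_pos _ i).le]
    by_cases h : i < N
    · simp [hf i h]
    · gcongr
      · exact (weight_pos _ _).le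
      · exact hanti N i (not_lt.1 h)

/-- `diagOp` maps the kernel vector of exponent q at z to the one of exponent q + s at z, and both
have eigenvalue g(z). For s > 0 this yields a compact injective intertwiner, the superdiagonal entry
of the model. -/
theorem wToeplitz_mul_diagOp {g : ℂ → ℂ} (hg : BoundedDirichlet g) {p q s : ℝ} (hs : 0 ≤ s)
    (hp : p ∈ Icc (0 : ℝ) (1 / 4)) (hq : q ∈ Icc (0 : ℝ) (1 / 4)) (h : p = q + s) :
    wToeplitz hg hp * diagOp s hs = diagOp s hs * wToeplitz hg hq := by
  refine ext_kernelVec hq.1 fun z hz => ?_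
  rw [mul_apply_eq_comp, mul_apply_eq_comp, diagOp_kernelVec hs hq.1 hz,
    wToeplitz_kernelVec hg hq hz, map_smul, diagOp_kernelVec hs hq.1 hz, ← h,
    wToeplitz_kernelVec hg hp hz]

/-- The backward shift on the space with weights `(i + 1) ^ p`. -/
noncomputable def backShift (p : ℝ) (hp0 : 0 ≤ p) (hp : p ≤ 1 / 4) : SqSeq →L[ℂ] SqSeq :=
  mkOp (LinearMap.pi fun i =>
    (weight p (i + 1) / weight p i : ℂ) • (coord (i + 1) : SqSeq →ₗ[ℂ] ℂ)) 2 zero_le_two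
    fun f t => by
      have h1 : ∀ i, weight p (i + 1) / weight p i ≤ 2 := fun i => by
        have := (weight_ratio_sub_one_le hp0 hp i 1).2.1
        have h2 : ((1 : ℕ) : ℝ) / ((i : ℝ) + 1) ≤ 1 := by
          rw [div_le_one (by positivity)]
          simp
        linarith
      have h2 : ∀ i, (LinearMap.pi fun i =>
          (weight p (i + 1) / weight p i : ℂ) • (coord (i + 1) : SqSeq →ₗ[ℂ] ℂ)) f i =
        (weight p (i + 1) / weight p i : ℝ) * f (i + 1) := fun i => by simp
      rw [mul_pow]
      have h3 := sum_norm_sq_le f (t.map (addRightEmbedding 1))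
      rw [Finset.sum_map] at h3
      refine le_trans (Finset.sum_le_sum fun i _ => ?_)
        ((Finset.mul_sum _ _ _).symm.le.trans (mul_le_mul_of_nonneg_left h3 (by positivity)))
      rw [h2, norm_mul, mul_pow, Complex.norm_real,
        Real.norm_of_nonneg (div_nonneg (weight_pos p _).le (weight_pos p _).le)]
      gcongr
      · exact div_nonneg (weight_pos p _).le (weight_pos p _).le
      · exact h1 i
      · exact le_rfl

theorem backShift_apply {p : ℝ} (hp0 : 0 ≤ p) (hp : p ≤ 1 / 4) (f : SqSeq) (i : ℕ) :
    backShift p hp0 hp f i = (weight p (i + 1) / weight p i : ℂ) * f (i + 1) := by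
  simp [backShift]

theorem backShift_kernelVec {p : ℝ} (hp0 : 0 ≤ p) (hp : p ≤ 1 / 4) {z : ℂ} (hz : ‖z‖ < 1) :
    backShift p hp0 hp (kernelVec p z) = z • kernelVec p z := by
  ext i
  rw [backShift_apply, lp.coeFn_smul, Pi.smul_apply, kernelVec_apply hp0 hz,
    kernelVec_apply hp0 hz, smul_eq_mul]
  have h3 := weight_ne_zero p i
  have h4 := weight_ne_zero p (i + 1)
  rw [pow_succ]
  field_simp

theorem eq_smul_kernelVec_of_backShift {p : ℝ} (hp0 : 0 ≤ p) (hp : p ≤ 1 / 4) {z : ℂ}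
    (hz : ‖z‖ < 1) {f : SqSeq} (h : backShift p hp0 hp f = z • f) : f = f 0 • kernelVec p z := by
  have h1 : ∀ i, f i = f 0 * (z ^ i / (weight p i : ℂ)) := fun i => by
    induction i with
    | zero => simp [weight_zero]
    | succ i ih =>
      have h2 := backShift_apply hp0 hp f i
      rw [h, lp.coeFn_smul, Pi.smul_apply, smul_eq_mul, ih] at h2
      have h3 := weight_ne_zero p i
      have h4 := weight_ne_zero p (i + 1)
      field_simp at h2 ⊢
      rw [pow_succ]
      linear_combination -h2
  ext i
  rw [lp.coeFn_smul, Pi.smul_apply, kernelVec_apply hp0 hz, smul_eq_mul]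
  exact h1 i

/-- The right inverse of the backward shift. -/
noncomputable def foreShift (p : ℝ) (hp0 : 0 ≤ p) : SqSeq →L[ℂ] SqSeq :=
  mkOp (LinearMap.pi fun i =>
    -- At `i = 0` the index `i - 1` truncates to `0`; the zero coefficient keeps that coordinate
    -- empty.
    (if i = 0 then 0 else weight p (i - 1) / weight p i : ℂ) • (coord (i - 1) : SqSeq →ₗ[ℂ] ℂ))
    1 zero_le_one fun f t => by
      have h2 : ∀ i, (LinearMap.pi fun i =>
          (if i = 0 then 0 else weight p (i - 1) / weight p i : ℂ) •
            (coord (i - 1) : SqSeq →ₗ[ℂ] ℂ)) f i =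
        (if i = 0 then 0 else weight p (i - 1) / weight p i : ℂ) * f (i - 1) := fun i => by
          rw [LinearMap.pi_apply, LinearMap.smul_apply, smul_eq_mul, ContinuousLinearMap.coe_coe,
            coord_apply]
      rw [one_mul]
      have hsub : t ⊆ Finset.range (t.sup id + 1) := fun i hi =>
        Finset.mem_range.2 (Nat.lt_succ_of_le (Finset.le_sup (f := id) hi))
      refine (Finset.sum_le_sum_of_subset_of_nonneg hsub fun _ _ _ => by positivity).trans ?_
      rw [Finset.sum_range_succ']
      refine le_trans ?_ (sum_norm_sq_le f (Finset.range (t.sup id)))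
      rw [h2, if_pos rfl, zero_mul, norm_zero, zero_pow two_ne_zero, add_zero]
      refine Finset.sum_le_sum fun i _ => ?_
      rw [h2, if_neg (Nat.succ_ne_zero i), Nat.add_sub_cancel, norm_mul, norm_div,
        Complex.norm_real, Complex.norm_real, Real.norm_of_nonneg (weight_pos p _).le,
        Real.norm_of_nonneg (weight_pos p _).le]
      refine pow_le_pow_left₀ (mul_nonneg (div_nonneg (weight_pos p _).le (weight_pos p _).le)
        (norm_nonneg _)) (mul_le_of_le_one_left (norm_nonneg _) ?_) 2
      exact (div_le_one (weight_pos p _)).2 (weight_mono hp0 (Nat.le_succ i))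

theorem norm_foreShift_le {p : ℝ} (hp0 : 0 ≤ p) : ‖foreShift p hp0‖ ≤ 1 := norm_mkOp_le _ _ _ _

theorem backShift_mul_foreShift {p : ℝ} (hp0 : 0 ≤ p) (hp : p ≤ 1 / 4) :
    backShift p hp0 hp * foreShift p hp0 = 1 := by
  ext f i
  have h3 := weight_ne_zero p i
  have h4 := weight_ne_zero p (i + 1)
  rw [mul_apply_eq_comp, backShift_apply, foreShift, mkOp_apply]
  simp
  field_simp

/-- With B and F the backward and forward shifts, BF = 1 gives (B - z)F = 1 - zF, which is
invertible by the Neumann series since ‖F‖ ≤ 1 and |z| < 1. -/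
theorem exists_rightInverse_backShift_sub {p : ℝ} (hp0 : 0 ≤ p) (hp : p ≤ 1 / 4) {z : ℂ}
    (hz : ‖z‖ < 1) : ∃ R, (backShift p hp0 hp - z • 1) * R = 1 := by
  have hlt : ‖z • foreShift p hp0‖ < 1 := by
    rw [norm_smul]
    exact (mul_le_of_le_one_right (norm_nonneg _) (norm_foreShift_le hp0)).trans_lt hz
  obtain ⟨R, hR⟩ := (isUnit_one_sub_of_norm_lt_one hlt).exists_right_inv
  refine ⟨foreShift p hp0 * R, ?_⟩
  rw [← mul_assoc, sub_mul, backShift_mul_foreShift, smul_mul_assoc, one_mul, hR]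

/-- On symbols this is g(u) - g(z) = (u - z) · `dslope g z u`; univalence bounds the second factor
below, so its operator is invertible. Kernel and range of the left side are thereby those of a
weighted backward shift, up to an invertible factor. -/
theorem exists_wToeplitz_sub_eq {g : ℂ → ℂ} (hg : BoundedDirichlet g) (hinj : InjOn g (ball 0 1))
    {p : ℝ} (hp : p ∈ Icc (0 : ℝ) (1 / 4)) {z : ℂ} (hz : z ∈ ball (0 : ℂ) 1)
    (hder : deriv g z ≠ 0) :
    ∃ S, IsUnit S ∧ wToeplitz hg hp - g z • 1 = S * (backShift p hp.1 hp.2 - z • 1) := by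
  obtain ⟨δ, hδ, hb⟩ := exists_le_norm_dslope hg.diff hinj hz hder
  have hd := boundedDirichlet_dslope hg hz
  refine ⟨wToeplitz hd hp, isUnit_wToeplitz hd hp hδ hb, ext_kernelVec hp.1 fun u hu => ?_⟩
  rw [mul_apply_eq_comp, _root_.sub_apply, _root_.sub_apply,
    _root_.smul_apply, one_apply_eq_self, _root_.smul_apply,
    one_apply_eq_self, wToeplitz_kernelVec hg hp hu, backShift_kernelVec hp.1 hp.2 hu,
    ← sub_smul, ← sub_smul, map_smul, wToeplitz_kernelVec hd hp hu, smul_smul, ← smul_eq_mul,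
    sub_smul_dslope]

theorem exists_rightInverse_wToeplitz_sub {g : ℂ → ℂ} (hg : BoundedDirichlet g)
    (hinj : InjOn g (ball 0 1)) {p : ℝ} (hp : p ∈ Icc (0 : ℝ) (1 / 4)) {z : ℂ}
    (hz : z ∈ ball (0 : ℂ) 1) (hder : deriv g z ≠ 0) :
    ∃ R, (wToeplitz hg hp - g z • 1) * R = 1 := by
  obtain ⟨S, hS, e⟩ := exists_wToeplitz_sub_eq hg hinj hp hz hder
  obtain ⟨Q, hQ⟩ := exists_rightInverse_backShift_sub hp.1 hp.2 (mem_ball_zero_iff.1 hz)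
  obtain ⟨S', hS'⟩ := hS.exists_right_inv
  refine ⟨Q * S', ?_⟩
  rw [e, mul_assoc, ← mul_assoc _ Q, hQ, one_mul, hS']

theorem eq_smul_kernelVec {g : ℂ → ℂ} (hg : BoundedDirichlet g)
    (hinj : InjOn g (ball 0 1)) {p : ℝ} (hp : p ∈ Icc (0 : ℝ) (1 / 4)) {z : ℂ}
    (hz : z ∈ ball (0 : ℂ) 1) (hder : deriv g z ≠ 0) {f : SqSeq}
    (hf : wToeplitz hg hp f = g z • f) : f = f 0 • kernelVec p z := by
  obtain ⟨S, hS, e⟩ := exists_wToeplitz_sub_eq hg hinj hp hz hder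
  obtain ⟨S', hS'⟩ := hS.exists_left_inv
  refine eq_smul_kernelVec_of_backShift hp.1 hp.2 (mem_ball_zero_iff.1 hz) ?_
  have h1 : (wToeplitz hg hp - g z • 1) f = 0 := by
    rw [_root_.sub_apply, _root_.smul_apply, one_apply_eq_self, hf,
      sub_self]
  have h2 := congrArg S' h1
  rw [e, map_zero, mul_apply_eq_comp, ← mul_apply_eq_comp, hS',
    one_apply_eq_self, _root_.sub_apply, _root_.smul_apply,
    one_apply_eq_self] at h2
  exact sub_eq_zero.1 h2

end SqSeq

end

/-! ### Essential normality of the Toeplitz operator; growth of kernel vectors -/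

section

open Filter Metric Set MeasureTheory
open scoped Topology ENNReal InnerProductSpace ComplexConjugate

namespace SqSeq
open DiscDirichlet

theorem summable_antidiagonal_of_nonneg {F : ℕ → ℝ} (hF : ∀ n, 0 ≤ F n)
    (h : Summable fun n : ℕ => ((n : ℝ) + 1) * F n) : Summable fun x : ℕ × ℕ => F (x.1 + x.2) := by
  rw [← Finset.HasAntidiagonal.sigmaAntidiagonalEquivProd.summable_iff]
  refine (summable_sigma_of_nonneg fun _ => hF _).2 ?_
  refine ⟨fun n => (hasSum_fintype _).summable, ?_⟩
  refine h.congr fun n => ?_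
  have e : ∀ y : Finset.HasAntidiagonal.antidiagonal n, F
      ((Finset.HasAntidiagonal.sigmaAntidiagonalEquivProd ⟨n, y⟩).1 +
        (Finset.HasAntidiagonal.sigmaAntidiagonalEquivProd ⟨n, y⟩).2) = F n := fun y =>
    congrArg F (Finset.HasAntidiagonal.mem_antidiagonal.1 y.2)
  rw [tsum_congr e, tsum_fintype, Finset.sum_const, Finset.card_univ,
    Fintype.card_coe, Finset.Nat.card_antidiagonal, nsmul_eq_mul]
  push_cast
  rfl

/-- The sequence of Taylor coefficients. -/
noncomputable def coeffVec {g : ℂ → ℂ} (hg : BoundedDirichlet g) : SqSeq :=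
  ofSummable _ (summable_coeff_sq hg)

/-- Summed over all tails, |a_n|² is counted n times, which is the Dirichlet integral again. -/
theorem summable_norm_drop_coeffVec {g : ℂ → ℂ} (hg : BoundedDirichlet g) :
    Summable fun j => ‖drop (j + 1) (coeffVec hg)‖ ^ 2 := by
  have h1 := (summable_nat_add_iff 1).2 hg.summable_coeff
  push_cast at h1
  have h2 := summable_antidiagonal_of_nonneg (F := fun n => ‖coeff g (n + 1)‖ ^ 2)
    (fun _ => by positivity) h1
  have h3 := ((summable_prod_of_nonneg (fun _ => by positivity)).1 h2).2
  refine h3.congr fun j => ?_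
  rw [← (hasSum_norm_sq (drop (j + 1) (coeffVec hg))).tsum_eq]
  refine tsum_congr fun k => ?_
  rw [drop_apply, coeffVec, ofSummable_apply, add_right_comm]

theorem toeplitz_basisVec {g : ℂ → ℂ} (hg : BoundedDirichlet g) (k i : ℕ) :
    toeplitz hg (basisVec k) i = if i ≤ k then coeff g (k - i) else 0 := by
  rw [← inner_basisVec, toeplitz, ContinuousLinearMap.adjoint_inner_right, ← inner_conj_symm,
    inner_basisVec, convOp_basisVec]
  split_ifs <;> simp

/-- Both inner products sum the same terms conj(a_m) a_{m+d}: the first over m ≤ j, the second over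
all m. The difference is a correlation of two tails. -/
theorem inner_toeplitz_sub {g : ℂ → ℂ} (hg : BoundedDirichlet g) (j d : ℕ) :
    ⟪toeplitz hg (basisVec j), toeplitz hg (basisVec (j + d))⟫_ℂ -
      ⟪convOp hg (basisVec j), convOp hg (basisVec (j + d))⟫_ℂ =
      -⟪drop (j + 1) (coeffVec hg), drop (j + d + 1) (coeffVec hg)⟫_ℂ := by
  set u : ℕ → ℂ := fun m => conj (coeff g m) * coeff g (m + d) with hu
  have h1 : ⟪toeplitz hg (basisVec j), toeplitz hg (basisVec (j + d))⟫_ℂ =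
      ∑ m ∈ Finset.range (j + 1), u m := by
    rw [← Finset.sum_range_reflect]
    refine (lp.hasSum_inner (𝕜 := ℂ) (toeplitz hg (basisVec j))
      (toeplitz hg (basisVec (j + d)))).unique ?_
    have e : ∑ i ∈ Finset.range (j + 1), u (j + 1 - 1 - i) = ∑ i ∈ Finset.range (j + 1),
        ⟪toeplitz hg (basisVec j) i, toeplitz hg (basisVec (j + d)) i⟫_ℂ := by
      refine Finset.sum_congr rfl fun i hi => ?_
      have hi' := Finset.mem_range.1 hi
      rw [toeplitz_basisVec, toeplitz_basisVec, if_pos (by omega), if_pos (by omega),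
        RCLike.inner_apply, hu]
      have e1 : j + 1 - 1 - i = j - i := by omega
      have e2 : j - i + d = j + d - i := by omega
      simp only [e1, e2]
      ring
    rw [e]
    refine hasSum_sum_of_ne_finset_zero fun i hi => ?_
    have hi' := Finset.mem_range.not.1 hi
    rw [toeplitz_basisVec hg j, if_neg (by omega), inner_zero_left]
  have h2 : HasSum u ⟪convOp hg (basisVec j), convOp hg (basisVec (j + d))⟫_ℂ := by
    have h := (hasSum_nat_add_iff' (j + d)).2 (lp.hasSum_inner (𝕜 := ℂ) (convOp hg (basisVec j))
      (convOp hg (basisVec (j + d))))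
    rw [Finset.sum_eq_zero (fun i hi => by
      rw [convOp_basisVec hg (j + d), if_neg (by have := Finset.mem_range.1 hi; omega),
        inner_zero_right]), sub_zero] at h
    have e : u = fun m => ⟪convOp hg (basisVec j) (m + (j + d)),
        convOp hg (basisVec (j + d)) (m + (j + d))⟫_ℂ := by
      funext m
      rw [convOp_basisVec, convOp_basisVec, if_pos (by omega), if_pos (by omega),
        RCLike.inner_apply, hu]
      have e1 : m + (j + d) - j = m + d := by omega
      simp only [e1, Nat.add_sub_cancel, Complex.conj_conj]
    rw [e]
    exact h
  have h3 := (hasSum_nat_add_iff' (j + 1)).2 h2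
  have h4 := lp.hasSum_inner (𝕜 := ℂ) (drop (j + 1) (coeffVec hg)) (drop (j + d + 1) (coeffVec hg))
  have e : (fun m => ⟪drop (j + 1) (coeffVec hg) m, drop (j + d + 1) (coeffVec hg) m⟫_ℂ) =
      fun m => u (m + (j + 1)) := by
    funext m
    rw [drop_apply, drop_apply, coeffVec, ofSummable_apply, ofSummable_apply, RCLike.inner_apply, hu]
    have e1 : j + 1 + m = m + (j + 1) := by omega
    have e2 : j + d + 1 + m = m + (j + 1) + d := by omega
    simp only [e1, e2]
    ring
  rw [e] at h4
  rw [h1, h4.unique h3]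
  ring

/-- By Cauchy–Schwarz the squared (j, k) entry is at most t_j t_k, where t_j is the squared norm of
the j-th tail. As ∑ t_j is the Dirichlet integral up to a constant factor, the self-commutator is
Hilbert–Schmidt. -/
theorem isCompactOperator_toeplitz_selfCommutator {g : ℂ → ℂ} (hg : BoundedDirichlet g) :
    IsCompactOperator (star (toeplitz hg) * toeplitz hg - toeplitz hg * star (toeplitz hg)) := by
  set A := toeplitz hg with hA
  have hstar : star A = convOp hg := by
    rw [hA, toeplitz, ContinuousLinearMap.star_eq_adjoint, ContinuousLinearMap.adjoint_adjoint]
  have hadj : ContinuousLinearMap.adjoint A = convOp hg := hstar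
  set C := star A * A - A * star A with hC
  set t : ℕ → ℝ := fun j => ‖drop (j + 1) (coeffVec hg)‖ ^ 2 with ht
  have hin : ∀ j k, C (basisVec k) j =
      ⟪A (basisVec j), A (basisVec k)⟫_ℂ - ⟪convOp hg (basisVec j), convOp hg (basisVec k)⟫_ℂ := by
    intro j k
    have e1 := ContinuousLinearMap.adjoint_inner_right A (basisVec j) (A (basisVec k))
    have e2 := ContinuousLinearMap.adjoint_inner_left A (convOp hg (basisVec k)) (basisVec j)
    rw [hadj] at e1 e2
    rw [← inner_basisVec, hC, _root_.sub_apply, inner_sub_right, mul_apply_eq_comp,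
      mul_apply_eq_comp, hstar, e1, e2]
  have hle : ∀ j k, ‖C (basisVec k) j‖ ^ 2 ≤ t j * t k := by
    have key : ∀ j d, ‖⟪A (basisVec j), A (basisVec (j + d))⟫_ℂ -
        ⟪convOp hg (basisVec j), convOp hg (basisVec (j + d))⟫_ℂ‖ ^ 2 ≤ t j * t (j + d) := by
      intro j d
      rw [hA, inner_toeplitz_sub, norm_neg, ht, ← mul_pow]
      exact pow_le_pow_left₀ (norm_nonneg _) (norm_inner_le_norm _ _) 2
    intro j k
    rw [hin]
    rcases le_total j k with h | h
    · obtain ⟨d, rfl⟩ := Nat.exists_eq_add_of_le h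
      exact key j d
    · obtain ⟨d, rfl⟩ := Nat.exists_eq_add_of_le h
      rw [← RCLike.norm_conj, map_sub, inner_conj_symm, inner_conj_symm, mul_comm]
      exact key k d
  have hts : Summable t := summable_norm_drop_coeffVec hg
  refine isCompactOperator_of_summable (Summable.of_nonneg_of_le (fun _ => by positivity)
    (fun k => ?_) (hts.mul_left (∑' j, t j)))
  rw [← (hasSum_norm_sq (C (basisVec k))).tsum_eq, ← tsum_mul_right]
  exact (hasSum_norm_sq (C (basisVec k))).summable.tsum_le_tsum (fun j => hle j k)
    (hts.mul_right _)

theorem weight_sq_le {p : ℝ} (hp : p ≤ 1 / 4) (i : ℕ) : weight p i ^ 2 ≤ √((i : ℝ) + 1) := by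
  rw [weight, Real.sqrt_eq_rpow, ← Real.rpow_natCast, ← Real.rpow_mul (by positivity)]
  refine Real.rpow_le_rpow_of_exponent_le (by linarith [Nat.cast_nonneg (α := ℝ) i]) ?_
  push_cast
  linarith

theorem weight_sq_le_self {p : ℝ} (hp : p ≤ 1 / 4) (i : ℕ) : weight p i ^ 2 ≤ (i : ℝ) + 1 := by
  refine (weight_sq_le hp i).trans ?_
  have h : (1 : ℝ) ≤ (i : ℝ) + 1 := by linarith [Nat.cast_nonneg (α := ℝ) i]
  rw [Real.sqrt_le_left (by linarith)]
  nlinarith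

/-- For such p the squared weights are at most i + 1, so the squared norm dominates ∑
|z|^{2i}/(i+1), whose partial sums approach those of the harmonic series. -/
theorem tendsto_norm_kernelVec {p : ℝ} (hp : p ∈ Icc (0 : ℝ) (1 / 4)) {z : ℕ → ℂ}
    (hz : ∀ m, ‖z m‖ < 1) (h : Tendsto (fun m => ‖z m‖) atTop (𝓝 1)) :
    Tendsto (fun m => ‖kernelVec p (z m)‖) atTop atTop := by
  rw [Filter.tendsto_atTop]
  intro C
  have hdiv := Real.tendsto_sum_range_one_div_nat_succ_atTop
  obtain ⟨N, hN⟩ := (hdiv.eventually (eventually_gt_atTop (C ^ 2))).exists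
  have hcont : Tendsto (fun m => ∑ i ∈ Finset.range N, (‖z m‖ ^ i) ^ 2 * (1 / ((i : ℝ) + 1))) atTop
      (𝓝 (∑ i ∈ Finset.range N, ((1 : ℝ) ^ i) ^ 2 * (1 / ((i : ℝ) + 1)))) :=
    tendsto_finsetSum _ fun i _ => ((h.pow i).pow 2).mul_const _
  simp only [one_pow, one_mul] at hcont
  filter_upwards [hcont.eventually (eventually_gt_nhds hN)] with m hm
  refine le_of_sq_le_sq ?_ (norm_nonneg _)
  refine hm.le.trans (le_trans (Finset.sum_le_sum fun i _ => ?_)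
    (sum_norm_sq_le (kernelVec p (z m)) (Finset.range N)))
  rw [kernelVec_apply hp.1 (hz m), norm_div, norm_pow, Complex.norm_real,
    Real.norm_of_nonneg (weight_pos p i).le, div_pow, div_eq_mul_one_div (_ ^ 2) (weight p i ^ 2)]
  gcongr
  · exact pow_pos (weight_pos p i) 2
  · exact weight_sq_le_self hp.2 i

end SqSeq

end

/-! ### Approximate eigenvectors of the adjoint and their defect -/

section

open Filter Metric Set MeasureTheory
open scoped Topology ENNReal InnerProductSpace ComplexConjugate

namespace SqSeq
open DiscDirichlet

/-- The factor by which the `k`-th Taylor coefficient enters the `i`-th coordinate of the defect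
of an approximate eigenvector on the circle of radius `r`. -/
noncomputable def defect (r : ℝ) (i k : ℕ) : ℝ := (if k ≤ i then r ^ (i - k) else 0) - r ^ (i + k)

theorem mul_sum_geom_le (x : ℝ) (N : ℕ) :
    (1 - x) * ∑ l ∈ Finset.range N, x ^ l ≤ 1 - x ^ N := by
  rw [mul_neg_geom_sum]

theorem sq_mul_sum_geom_le {x : ℝ} (hx0 : 0 ≤ x) (hx1 : x ≤ 1) (N : ℕ) :
    (1 - x) ^ 2 * ∑ l ∈ Finset.range N, ((l : ℝ) + 1) * x ^ l ≤ 1 := by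
  have h : (1 - x) ^ 2 * ∑ l ∈ Finset.range N, ((l : ℝ) + 1) * x ^ l =
      1 - (N + 1) * x ^ N + N * x ^ (N + 1) := by
    induction N with
    | zero => simp
    | succ N ih =>
      rw [Finset.sum_range_succ, mul_add, ih]
      push_cast
      ring
  rw [h]
  have h1 : x ^ (N + 1) ≤ x ^ N := pow_le_pow_of_le_one hx0 hx1 (Nat.le_succ N)
  have h2 : 0 ≤ x ^ N := by positivity
  nlinarith [Nat.cast_nonneg (α := ℝ) N]

/-- AM–GM in the form √(l+1) ≤ (s(l+1) + 1/s)/2. The choice s = √(1 - x) balances the two resulting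
sums, of orders (1-x)^{-2} and (1-x)^{-1}. -/
theorem sum_sqrt_mul_geom_le {x : ℝ} (hx0 : 0 ≤ x) (hx1 : x < 1) (N : ℕ) :
    (1 - x) * ∑ l ∈ Finset.range N, √((l : ℝ) + 1) * x ^ l ≤ (√(1 - x))⁻¹ := by
  set δ := 1 - x with hδ
  have hδ0 : 0 < δ := by linarith
  set s := √δ with hs
  have hs0 : 0 < s := Real.sqrt_pos.2 hδ0
  have hss : s * s = δ := Real.mul_self_sqrt hδ0.le
  have h1 : ∀ l : ℕ, √((l : ℝ) + 1) ≤ (s * (l + 1) + s⁻¹) / 2 := fun l => by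
    have e := Real.mul_self_sqrt (show (0 : ℝ) ≤ (l : ℝ) + 1 by positivity)
    rw [le_div_iff₀ two_pos, ← mul_le_mul_iff_of_pos_right hs0, add_mul, inv_mul_cancel₀ hs0.ne']
    nlinarith [sq_nonneg (√((l : ℝ) + 1) * s - 1)]
  have h2 : ∑ l ∈ Finset.range N, √((l : ℝ) + 1) * x ^ l ≤
      s / 2 * ∑ l ∈ Finset.range N, ((l : ℝ) + 1) * x ^ l +
        s⁻¹ / 2 * ∑ l ∈ Finset.range N, x ^ l := by
    rw [Finset.mul_sum, Finset.mul_sum, ← Finset.sum_add_distrib]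
    refine Finset.sum_le_sum fun l _ => ?_
    have := mul_le_mul_of_nonneg_right (h1 l) (show 0 ≤ x ^ l by positivity)
    linarith
  have h3 := sq_mul_sum_geom_le hx0 hx1.le N
  have h4 : δ * ∑ l ∈ Finset.range N, x ^ l ≤ 1 := by
    have := mul_sum_geom_le x N
    have h5 : 0 ≤ x ^ N := by positivity
    linarith
  rw [← hδ] at h3
  calc _ ≤ δ * (s / 2 * ∑ l ∈ Finset.range N, ((l : ℝ) + 1) * x ^ l +
        s⁻¹ / 2 * ∑ l ∈ Finset.range N, x ^ l) := by gcongr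
    _ = s⁻¹ / 2 * (δ ^ 2 * ∑ l ∈ Finset.range N, ((l : ℝ) + 1) * x ^ l) +
        s⁻¹ / 2 * (δ * ∑ l ∈ Finset.range N, x ^ l) := by
          rw [← hss]
          field_simp
    _ ≤ s⁻¹ / 2 * 1 + s⁻¹ / 2 * 1 := by gcongr
    _ = s⁻¹ := by ring

/-- The quantitative core of Property (H): linear in k, to be absorbed by the Dirichlet integral,
yet vanishing as r → 1. With x = r², δ = 1 - x and y = 1 - x^k, the squared defect is x^{i+k} for i
< k and y² x^l for i = k + l. The squared weights are at most √(i+1). From y ≤ 1 and y ≤ kδ follows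
y ≤ √(kδ), and these bounds yield √δ k from the first range and 2√δ k from the second. -/
theorem sum_weight_defect_le {p : ℝ} (hp : p ≤ 1 / 4) {r : ℝ} (hr0 : 0 < r) (hr1 : r < 1)
    (k N : ℕ) : (1 - r ^ 2) * ∑ i ∈ Finset.range N, weight p i ^ 2 * defect r i k ^ 2 ≤
      3 * √(1 - r ^ 2) * k := by
  set x := r ^ 2 with hx
  have hx0 : 0 ≤ x := by positivity
  have hx1 : x < 1 := pow_lt_one₀ hr0.le hr1 two_ne_zero
  set δ := 1 - x with hδ
  have hδ0 : 0 < δ := by linarith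
  set s := √δ with hs
  have hs0 : 0 < s := Real.sqrt_pos.2 hδ0
  have hss : s * s = δ := Real.mul_self_sqrt hδ0.le
  have hk : √(k : ℝ) * √(k : ℝ) = k := Real.mul_self_sqrt (Nat.cast_nonneg k)
  have hk0 : 0 ≤ √(k : ℝ) := Real.sqrt_nonneg _
  set y := 1 - x ^ k with hy
  have hxk0 : 0 ≤ x ^ k := by positivity
  have hxk1 : x ^ k ≤ 1 := pow_le_one₀ hx0 hx1.le
  have hy0 : 0 ≤ y := by linarith
  have hy1 : y ≤ 1 := by linarith
  have hyk : y ≤ k * δ := by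
    have := one_add_mul_le_pow (show (-2 : ℝ) ≤ x - 1 by linarith) k
    rw [add_sub_cancel] at this
    linarith
  have hysq : y ≤ √k * s := by
    refine le_of_sq_le_sq ?_ (by positivity)
    calc y ^ 2 ≤ y := by nlinarith
      _ ≤ (√k * √k) * (s * s) := by rw [hk, hss]; exact hyk
      _ = _ := by ring
  have hsub : ∑ i ∈ Finset.range N, weight p i ^ 2 * defect r i k ^ 2 ≤
      ∑ i ∈ Finset.range (k + N), weight p i ^ 2 * defect r i k ^ 2 :=
    Finset.sum_le_sum_of_subset_of_nonneg (Finset.range_mono (by omega))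
      fun _ _ _ => by positivity
  rw [Finset.sum_range_add] at hsub
  have hA : δ * ∑ i ∈ Finset.range k, weight p i ^ 2 * defect r i k ^ 2 ≤ s * k := by
    have h1 : ∑ i ∈ Finset.range k, weight p i ^ 2 * defect r i k ^ 2 ≤
        √k * ∑ i ∈ Finset.range k, x ^ i := by
      rw [Finset.mul_sum]
      refine Finset.sum_le_sum fun i hi => ?_
      have hi' := Finset.mem_range.1 hi
      have e : defect r i k ^ 2 = x ^ i * x ^ k := by
        rw [defect, if_neg (by omega), hx, ← pow_mul, ← pow_mul, ← pow_add, zero_sub, neg_sq,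
          ← pow_mul]
        congr 1
        ring
      rw [e]
      refine mul_le_mul ((weight_sq_le hp i).trans (Real.sqrt_le_sqrt ?_))
        (mul_le_of_le_one_right (by positivity) hxk1) (by positivity) hk0
      exact_mod_cast hi'
    calc _ ≤ δ * (√k * ∑ i ∈ Finset.range k, x ^ i) := by gcongr
      _ = √k * (δ * ∑ i ∈ Finset.range k, x ^ i) := by ring
      _ ≤ √k * y := by
        gcongr
        exact mul_sum_geom_le x k
      _ ≤ √k * (√k * s) := by gcongr
      _ = s * k := by rw [← mul_assoc, hk, mul_comm]
  have hB : δ * ∑ l ∈ Finset.range N, weight p (k + l) ^ 2 * defect r (k + l) k ^ 2 ≤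
      2 * (s * k) := by
    have h1 : ∑ l ∈ Finset.range N, weight p (k + l) ^ 2 * defect r (k + l) k ^ 2 ≤
        y ^ 2 * (√k * ∑ l ∈ Finset.range N, x ^ l +
          ∑ l ∈ Finset.range N, √((l : ℝ) + 1) * x ^ l) := by
      rw [Finset.mul_sum, ← Finset.sum_add_distrib, Finset.mul_sum]
      refine Finset.sum_le_sum fun l _ => ?_
      have e : defect r (k + l) k ^ 2 = y ^ 2 * x ^ l := by
        rw [defect, if_pos (by omega), hy, hx, Nat.add_sub_cancel_left, pow_add, pow_add, ← pow_mul,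
          ← pow_mul, mul_comm 2 k, mul_comm 2 l, pow_mul, pow_mul]
        ring
      have e2 : weight p (k + l) ^ 2 ≤ √k + √((l : ℝ) + 1) := by
        refine (weight_sq_le hp _).trans ?_
        push_cast
        rw [add_assoc]
        rw [Real.sqrt_le_left (by positivity)]
        have e3 := Real.sq_sqrt (show (0 : ℝ) ≤ (l : ℝ) + 1 by positivity)
        nlinarith [mul_nonneg hk0 (Real.sqrt_nonneg ((l : ℝ) + 1))]
      rw [e]
      have := mul_le_mul_of_nonneg_right e2 (show 0 ≤ y ^ 2 * x ^ l by positivity)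
      linarith
    have h2 : δ * ∑ l ∈ Finset.range N, x ^ l ≤ 1 := by
      have := mul_sum_geom_le x N
      have h5 : 0 ≤ x ^ N := by positivity
      linarith
    have h3 := sum_sqrt_mul_geom_le hx0 hx1 N
    have hsinv : 0 < s⁻¹ := inv_pos.2 hs0
    calc _ ≤ δ * (y ^ 2 * (√k * ∑ l ∈ Finset.range N, x ^ l +
          ∑ l ∈ Finset.range N, √((l : ℝ) + 1) * x ^ l)) := by gcongr
      _ = y ^ 2 * (√k * (δ * ∑ l ∈ Finset.range N, x ^ l) +
          δ * ∑ l ∈ Finset.range N, √((l : ℝ) + 1) * x ^ l) := by ring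
      _ ≤ y ^ 2 * (√k * 1 + s⁻¹) := by gcongr
      _ = y ^ 2 * √k + y ^ 2 * s⁻¹ := by ring
      _ ≤ (√k * s) * √k + (k * δ) * s⁻¹ := by
        gcongr
        · nlinarith
        · nlinarith
      _ = 2 * (s * k) := by
        rw [← hss, mul_right_comm, hk]
        field_simp
        ring
  calc _ ≤ δ * (∑ i ∈ Finset.range k, weight p i ^ 2 * defect r i k ^ 2 +
        ∑ l ∈ Finset.range N, weight p (k + l) ^ 2 * defect r (k + l) k ^ 2) := by gcongr
    _ ≤ s * k + 2 * (s * k) := by rw [mul_add]; gcongr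
    _ = _ := by ring

theorem summable_testVec {p : ℝ} (hp : p ≤ 1 / 4) {z : ℂ} (hz : ‖z‖ < 1) :
    Summable fun i => ‖(weight p i : ℂ) * z ^ i‖ ^ 2 := by
  have h1 : ‖z‖ ^ 2 < 1 := pow_lt_one₀ (norm_nonneg _) hz two_ne_zero
  have h0 : ‖‖z‖ ^ 2‖ < 1 := by rwa [Real.norm_of_nonneg (by positivity)]
  have h2 := (summable_pow_mul_geometric_of_norm_lt_one 1 h0).add
    (summable_geometric_of_lt_one (by positivity) h1)
  refine Summable.of_nonneg_of_le (fun _ => by positivity) (fun i => ?_) h2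
  rw [norm_mul, mul_pow, Complex.norm_real, Real.norm_of_nonneg (weight_pos p i).le, norm_pow,
    pow_right_comm]
  have := mul_le_mul_of_nonneg_right (weight_sq_le_self hp i)
    (show 0 ≤ (‖z‖ ^ 2) ^ i by positivity)
  simp only [pow_one]
  linarith

theorem enorm_sq_eq_tsum (f : SqSeq) : ‖f‖ₑ ^ 2 = ∑' i, ‖f i‖ₑ ^ 2 := by
  have hconv : ∀ {E : Type} [NormedAddCommGroup E] (c : E), ‖c‖ₑ ^ 2 = ENNReal.ofReal (‖c‖ ^ 2) := fun c => by
    rw [ENNReal.ofReal_pow (norm_nonneg _), ofReal_norm]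
  simp only [hconv]
  rw [← (hasSum_norm_sq f).tsum_eq, ENNReal.ofReal_tsum_of_nonneg (fun _ => by positivity)
    (hasSum_norm_sq f).summable]

theorem wToeplitz_basisVec {g : ℂ → ℂ} (hg : BoundedDirichlet g) {p : ℝ}
    (hp : p ∈ Icc (0 : ℝ) (1 / 4)) (i j : ℕ) : wToeplitz hg hp (basisVec i) j =
      if j ≤ i then coeff g (i - j) * (weight p i / weight p j : ℝ) else 0 := by
  refine (hasSum_wToeplitz hg hp (basisVec i) j).unique ?_
  simp only [basisVec_apply, mul_ite, mul_one, mul_zero]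
  split_ifs with h
  · have e : i = j + (i - j) := by omega
    have h1 := hasSum_single (f := fun k => if j + k = i then
      coeff g k * (weight p (j + k) / weight p j : ℝ) else 0) (i - j) (fun k hk => if_neg (by omega))
    rw [if_pos (by omega), ← e] at h1
    exact h1
  · have e : (fun k => if j + k = i then
      coeff g k * (weight p (j + k) / weight p j : ℝ) else (0 : ℂ)) = fun _ => 0 := by
      funext k
      exact if_neg (by omega)
    rw [e]
    exact hasSum_zero

/-- The `i`-th coordinate of `(A* - conj (g z)) w` for the test vector `w` at `z = r e^{iθ}`. -/
theorem norm_inner_testVec {g : ℂ → ℂ} (hg : BoundedDirichlet g) {p : ℝ}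
    (hp : p ∈ Icc (0 : ℝ) (1 / 4)) {r : ℝ} (hr0 : 0 < r) (hr1 : r < 1) (θ : ℝ) {z : ℂ}
    (hz : z = r * Complex.exp (θ * Complex.I)) {w : SqSeq}
    (hw : ∀ i, w i = (weight p i : ℂ) * z ^ i) (i : ℕ) :
    ‖(ContinuousLinearMap.adjoint (wToeplitz hg hp - g z • 1 : SqSeq →L[ℂ] SqSeq) w : SqSeq) i‖ =
      weight p i * ‖∑' k : ℕ, coeff g k * defect r i k * Complex.exp (k * θ * Complex.I)‖ := by
  have hzn : ‖z‖ < 1 := by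
    rwa [hz, norm_mul, Complex.norm_real, Real.norm_of_nonneg hr0.le,
      Complex.norm_exp_ofReal_mul_I, mul_one]
  have h1 : ⟪w, wToeplitz hg hp (basisVec i)⟫_ℂ =
      ∑ k ∈ Finset.range (i + 1), (weight p i : ℂ) * (coeff g k * conj z ^ (i - k)) := by
    rw [← Finset.sum_range_reflect]
    refine (lp.hasSum_inner (𝕜 := ℂ) w (wToeplitz hg hp (basisVec i))).unique ?_
    have e : ∑ j ∈ Finset.range (i + 1), (weight p i : ℂ) *
        (coeff g (i + 1 - 1 - j) * conj z ^ (i - (i + 1 - 1 - j))) =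
        ∑ j ∈ Finset.range (i + 1), ⟪w j, wToeplitz hg hp (basisVec i) j⟫_ℂ := by
      refine Finset.sum_congr rfl fun j hj => ?_
      have hj' := Finset.mem_range.1 hj
      rw [wToeplitz_basisVec, if_pos (by omega), RCLike.inner_apply, hw, map_mul, map_pow,
        Complex.conj_ofReal]
      have e1 : i + 1 - 1 - j = i - j := by omega
      have e2 : i - (i - j) = j := by omega
      rw [e1, e2]
      have h3 := weight_ne_zero p j
      push_cast
      field_simp
    rw [e]
    refine hasSum_sum_of_ne_finset_zero fun j hj => ?_
    have hj' := Finset.mem_range.not.1 hj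
    rw [wToeplitz_basisVec, if_neg (by omega), inner_zero_right]
  have h2 : HasSum (fun k => (weight p i : ℂ) * (coeff g k * (if k ≤ i then conj z ^ (i - k) else 0)))
      ⟪w, wToeplitz hg hp (basisVec i)⟫_ℂ := by
    rw [h1]
    have e : ∑ k ∈ Finset.range (i + 1), (weight p i : ℂ) * (coeff g k * conj z ^ (i - k)) =
        ∑ k ∈ Finset.range (i + 1),
          (weight p i : ℂ) * (coeff g k * (if k ≤ i then conj z ^ (i - k) else 0)) := by
      refine Finset.sum_congr rfl fun k hk => ?_
      rw [if_pos (by have := Finset.mem_range.1 hk; omega)]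
    rw [e]
    refine hasSum_sum_of_ne_finset_zero fun k hk => ?_
    have hk' := Finset.mem_range.not.1 hk
    rw [if_neg (by omega), mul_zero, mul_zero]
  have h3 := ((hasSum_coeff hg.diff hzn).mul_right (conj z ^ i)).mul_left (weight p i : ℂ)
  have h4 := h2.sub h3
  have hpos := weight_pos p i
  have hexp : ∀ m : ℕ, conj z ^ m = (r : ℂ) ^ m * Complex.exp (-(m * θ * Complex.I)) := fun m => by
    rw [hz, map_mul, Complex.conj_ofReal, ← Complex.exp_conj, mul_pow, ← Complex.exp_nat_mul,
      map_mul, Complex.conj_ofReal, Complex.conj_I]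
    congr 2
    ring
  have hexp2 : ∀ m : ℕ, z ^ m = (r : ℂ) ^ m * Complex.exp (m * θ * Complex.I) := fun m => by
    rw [hz, mul_pow, ← Complex.exp_nat_mul]
    congr 2
    ring
  -- The phase e^{-iθ·i} is common to all k. Once it is pulled out, a Fourier series in θ with
  -- coefficients a_k · `defect r i k` remains, ready for Parseval.
  have e : (fun k => (weight p i : ℂ) * (coeff g k * (if k ≤ i then conj z ^ (i - k) else 0)) -
      (weight p i : ℂ) * (coeff g k * z ^ k * conj z ^ i)) =
      fun k : ℕ => ((weight p i : ℂ) * Complex.exp (-(i * θ * Complex.I))) *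
        (coeff g k * defect r i k * Complex.exp (k * θ * Complex.I)) := by
    funext k
    have e1 : (if k ≤ i then conj z ^ (i - k) else 0) = ((if k ≤ i then r ^ (i - k) else 0 : ℝ) : ℂ) *
        (Complex.exp (-(i * θ * Complex.I)) * Complex.exp (k * θ * Complex.I)) := by
      split_ifs with h
      · rw [hexp, ← Complex.exp_add, Nat.cast_sub h]
        push_cast
        congr 2
        ring
      · simp
    rw [e1, hexp, hexp2, defect]
    push_cast
    ring
  rw [e] at h4
  have h5 : (ContinuousLinearMap.adjoint (wToeplitz hg hp - g z • 1 : SqSeq →L[ℂ] SqSeq) w : SqSeq) i =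
      conj (⟪w, wToeplitz hg hp (basisVec i)⟫_ℂ - (weight p i : ℂ) * (g z * conj z ^ i)) := by
    rw [← inner_basisVec, ContinuousLinearMap.adjoint_inner_right, ← inner_conj_symm,
      _root_.sub_apply, inner_sub_right, _root_.smul_apply, one_apply_eq_self, inner_smul_right,
      ← inner_conj_symm w (basisVec i), inner_basisVec, hw, map_mul (starRingEnd ℂ), map_pow, Complex.conj_ofReal]
    congr 1
    ring
  rw [h5, RCLike.norm_conj, ← h4.tsum_eq, tsum_mul_left, norm_mul, norm_mul, Complex.norm_real,
    Real.norm_of_nonneg hpos.le]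
  have h6 : ‖Complex.exp (-(i * θ * Complex.I))‖ = 1 := by
    have := Complex.norm_exp_ofReal_mul_I (-(i * θ))
    push_cast at this
    rwa [neg_mul] at this
  rw [h6, mul_one]

end SqSeq

end

/-! ### Property (H) for weighted Toeplitz operators -/

section

open Filter Metric Set MeasureTheory
open scoped Topology ENNReal InnerProductSpace ComplexConjugate

namespace SqSeq
open DiscDirichlet

theorem summable_coeff_mul_defect {g : ℂ → ℂ} (hg : BoundedDirichlet g) {r : ℝ} (hr0 : 0 < r)
    (hr1 : r < 1) (i : ℕ) : Summable fun k => ‖coeff g k * defect r i k‖ := by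
  have h1 : Summable fun k => ‖coeff g k‖ * r ^ k := summable_norm_coeff hg.diff hr0.le hr1
  rw [← summable_nat_add_iff (i + 1)] at h1 ⊢
  refine Summable.of_nonneg_of_le (fun _ => norm_nonneg _) (fun k => ?_) h1
  rw [defect, if_neg (by omega), zero_sub, norm_mul, Complex.norm_real, norm_neg,
    Real.norm_of_nonneg (by positivity)]
  refine mul_le_mul_of_nonneg_left ?_ (norm_nonneg _)
  rw [pow_add]
  exact mul_le_of_le_one_left (by positivity) (pow_le_one₀ hr0.le hr1.le)

theorem norm_kernelVec_sq_le {p : ℝ} (hp : 0 ≤ p) {z : ℂ} (hz : ‖z‖ < 1) :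
    ‖kernelVec p z‖ ^ 2 ≤ (1 - ‖z‖ ^ 2)⁻¹ := by
  have h1 : ‖z‖ ^ 2 < 1 := pow_lt_one₀ (norm_nonneg _) hz two_ne_zero
  refine hasSum_le (fun i => ?_) (hasSum_norm_sq _) (hasSum_geometric_of_lt_one (by positivity) h1)
  rw [kernelVec_apply hp hz, norm_div, norm_pow, Complex.norm_real,
    Real.norm_of_nonneg (weight_pos p i).le, pow_right_comm]
  have h0 : 0 ≤ ‖z‖ ^ i := by positivity
  exact pow_le_pow_left₀ (div_nonneg h0 (weight_pos p i).le) (div_le_self h0 (one_le_weight hp i)) 2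

/-- The test vector multiplies by the weights where the kernel vector divides by them, so the
pairing is the plain geometric series. -/
theorem inner_testVec_kernelVec {p : ℝ} (hp : 0 ≤ p) {z : ℂ} (hz : ‖z‖ < 1) {w : SqSeq}
    (hw : ∀ i, w i = (weight p i : ℂ) * z ^ i) :
    ⟪w, kernelVec p z⟫_ℂ = ((1 - ‖z‖ ^ 2)⁻¹ : ℝ) := by
  have h1 : ‖z‖ ^ 2 < 1 := pow_lt_one₀ (norm_nonneg _) hz two_ne_zero
  have h2 := Complex.hasSum_ofReal.2 (hasSum_geometric_of_lt_one (r := ‖z‖ ^ 2) (by positivity) h1)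
  refine (lp.hasSum_inner (𝕜 := ℂ) w (kernelVec p z)).unique ?_
  have e : (fun i => ⟪w i, kernelVec p z i⟫_ℂ) = fun i => (((‖z‖ ^ 2) ^ i : ℝ) : ℂ) := by
    funext i
    have h3 := weight_ne_zero p i
    rw [RCLike.inner_apply, hw, kernelVec_apply hp hz, map_mul, Complex.conj_ofReal, map_pow]
    push_cast
    rw [← Complex.mul_conj', mul_pow]
    field_simp
  rw [e]
  exact h2

/-- On the kernel vector k_q(z) the commutator form of X becomes (A_p - g(z)) Z k_q(z). Pairing with
w gives c/(1 - |z|²) on one side and at most ‖(A_p - g(z))* w‖ ‖Z‖ (1 - |z|²)^{-1/2} on the other.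
-/
theorem norm_sq_symbol_le {g : ℂ → ℂ} (hg : BoundedDirichlet g) {p q : ℝ}
    (hp : p ∈ Icc (0 : ℝ) (1 / 4)) (hq : q ∈ Icc (0 : ℝ) (1 / 4)) {X Z : SqSeq →L[ℂ] SqSeq}
    (hZ : X = wToeplitz hg hp * Z - Z * wToeplitz hg hq) {z : ℂ} (hz : ‖z‖ < 1) {c : ℂ}
    (hc : X (kernelVec q z) = c • kernelVec p z) {w : SqSeq}
    (hw : ∀ i, w i = (weight p i : ℂ) * z ^ i) :
    ‖c‖ ^ 2 ≤ (1 - ‖z‖ ^ 2) * ‖Z‖ ^ 2 *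
      ‖ContinuousLinearMap.adjoint (wToeplitz hg hp - g z • 1 : SqSeq →L[ℂ] SqSeq) w‖ ^ 2 := by
  set D : SqSeq →L[ℂ] SqSeq := wToeplitz hg hp - g z • 1 with hD
  have h1 : ‖z‖ ^ 2 < 1 := pow_lt_one₀ (norm_nonneg _) hz two_ne_zero
  set δ := 1 - ‖z‖ ^ 2 with hδ
  have hδ0 : 0 < δ := by linarith
  have hX : X (kernelVec q z) = D (Z (kernelVec q z)) := by
    rw [hZ, hD, _root_.sub_apply, _root_.sub_apply, mul_apply_eq_comp, mul_apply_eq_comp,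
      wToeplitz_kernelVec hg hq hz, map_smul, _root_.smul_apply, one_apply_eq_self]
  have h2 : c * (δ⁻¹ : ℝ) = ⟪ContinuousLinearMap.adjoint D w, Z (kernelVec q z)⟫_ℂ := by
    rw [ContinuousLinearMap.adjoint_inner_left, ← hX, hc, inner_smul_right,
      inner_testVec_kernelVec hp.1 hz hw]
  have h3 : ‖c‖ * δ⁻¹ ≤ ‖ContinuousLinearMap.adjoint D w‖ * (‖Z‖ * ‖kernelVec q z‖) := by
    have h4 : ‖c * (δ⁻¹ : ℝ)‖ = ‖c‖ * δ⁻¹ := by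
      rw [norm_mul, Complex.norm_real, Real.norm_of_nonneg (by positivity)]
    rw [← h4, h2]
    refine (norm_inner_le_norm _ _).trans ?_
    gcongr
    exact Z.le_opNorm _
  have h4 := pow_le_pow_left₀ (by positivity) h3 2
  have h5 := norm_kernelVec_sq_le hq.1 hz
  calc ‖c‖ ^ 2 = (‖c‖ * δ⁻¹) ^ 2 * δ ^ 2 := by field_simp
    _ ≤ (‖ContinuousLinearMap.adjoint D w‖ * (‖Z‖ * ‖kernelVec q z‖)) ^ 2 * δ ^ 2 := by gcongr
    _ = ‖ContinuousLinearMap.adjoint D w‖ ^ 2 * ‖Z‖ ^ 2 * δ ^ 2 * ‖kernelVec q z‖ ^ 2 := by ring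
    _ ≤ ‖ContinuousLinearMap.adjoint D w‖ ^ 2 * ‖Z‖ ^ 2 * δ ^ 2 * δ⁻¹ := by gcongr
    _ = _ := by field_simp

/-- After exchanging the sums, `sum_weight_defect_le` applies for each k, and its factor k completes
|a_k|² to the Dirichlet integral. -/
theorem lintegral_testVec_le {g : ℂ → ℂ} (hg : BoundedDirichlet g) {p : ℝ} (hp : p ≤ 1 / 4) {r : ℝ}
    (hr0 : 0 < r) (hr1 : r < 1) :
    ENNReal.ofReal (1 - r ^ 2) * ∑' i, ENNReal.ofReal (weight p i ^ 2) *
      ∑' k, ‖coeff g k * defect r i k‖ₑ ^ 2 ≤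
    ENNReal.ofReal (3 * √(1 - r ^ 2) * ∑' k : ℕ, k * ‖coeff g k‖ ^ 2) := by
  have h1 : r ^ 2 < 1 := pow_lt_one₀ hr0.le hr1 two_ne_zero
  have hconv : ∀ c : ℂ, ‖c‖ₑ ^ 2 = ENNReal.ofReal (‖c‖ ^ 2) := fun c => by
    rw [ENNReal.ofReal_pow (norm_nonneg _), ofReal_norm]
  have e : ∀ i k, ENNReal.ofReal (weight p i ^ 2) * ‖coeff g k * defect r i k‖ₑ ^ 2 =
      ENNReal.ofReal (‖coeff g k‖ ^ 2) * ENNReal.ofReal (weight p i ^ 2 * defect r i k ^ 2) := by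
    intro i k
    rw [hconv, norm_mul, Complex.norm_real, mul_pow, Real.norm_eq_abs, sq_abs,
      ← ENNReal.ofReal_mul (by positivity), ← ENNReal.ofReal_mul (by positivity)]
    congr 1
    ring
  simp_rw [← ENNReal.tsum_mul_left, e]
  rw [ENNReal.tsum_comm, ENNReal.ofReal_mul (by positivity), ENNReal.ofReal_tsum_of_nonneg
    (fun _ => by positivity) hg.summable_coeff, ← ENNReal.tsum_mul_left]
  refine ENNReal.tsum_le_tsum fun k => ?_
  simp_rw [mul_left_comm (ENNReal.ofReal (1 - r ^ 2))]
  rw [ENNReal.tsum_mul_left, mul_comm (k : ℝ), ENNReal.ofReal_mul (by positivity : 0 ≤ ‖coeff g k‖ ^ 2),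
    mul_left_comm (ENNReal.ofReal (3 * √(1 - r ^ 2)))]
  refine mul_le_mul_right ?_ _
  rw [← ENNReal.ofReal_mul (by positivity)]
  refine ENNReal.tsum_le_of_sum_range_le fun N => ?_
  rw [← Finset.mul_sum, ← ENNReal.ofReal_sum_of_nonneg fun _ _ => by positivity,
    ← ENNReal.ofReal_mul (by linarith)]
  exact ENNReal.ofReal_le_ofReal (sum_weight_defect_le hp hr0 hr1 k N)

/-- The zeroth coordinate of `X v` as a power series, `v` the kernel vector at `z`. -/
theorem hasSum_apply_kernelVec {q : ℝ} (hq : 0 ≤ q) (X : SqSeq →L[ℂ] SqSeq) {z : ℂ} (hz : ‖z‖ < 1) :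
    HasSum (fun i => conj (ContinuousLinearMap.adjoint X (basisVec 0) i) / (weight q i : ℂ) * z ^ i)
      (X (kernelVec q z) 0) := by
  have h1 := lp.hasSum_inner (𝕜 := ℂ) (ContinuousLinearMap.adjoint X (basisVec 0)) (kernelVec q z)
  rw [ContinuousLinearMap.adjoint_inner_left, inner_basisVec] at h1
  have e : (fun i => conj (ContinuousLinearMap.adjoint X (basisVec 0) i) / (weight q i : ℂ) * z ^ i) =
      fun i => ⟪ContinuousLinearMap.adjoint X (basisVec 0) i, kernelVec q z i⟫_ℂ := by
    funext i
    rw [RCLike.inner_apply, kernelVec_apply hq hz]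
    ring
  rw [e]
  exact h1

theorem norm_div_weight_le {q : ℝ} (hq : 0 ≤ q) (y : SqSeq) (i : ℕ) :
    ‖conj (y i) / (weight q i : ℂ)‖ ≤ ‖y‖ := by
  rw [norm_div, RCLike.norm_conj, Complex.norm_real, Real.norm_of_nonneg (weight_pos q i).le]
  exact (div_le_self (norm_nonneg _) (one_le_weight hq i)).trans (norm_apply_le y i)

/-- Property (H) for the pair of weighted Toeplitz operators with the same symbol. -/
theorem eq_zero_of_intertwines {g : ℂ → ℂ} (hg : BoundedDirichlet g)
    (hinj : InjOn g (ball 0 1)) (hder : ∀ z ∈ ball (0 : ℂ) 1, deriv g z ≠ 0) {p q : ℝ}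
    (hp : p ∈ Icc (0 : ℝ) (1 / 4)) (hq : q ∈ Icc (0 : ℝ) (1 / 4)) {X Z : SqSeq →L[ℂ] SqSeq}
    (hX : wToeplitz hg hp * X = X * wToeplitz hg hq)
    (hZ : X = wToeplitz hg hp * Z - Z * wToeplitz hg hq) : X = 0 := by
  set y := ContinuousLinearMap.adjoint X (basisVec 0) with hy
  set a : ℕ → ℂ := fun i => conj (y i) / (weight q i : ℂ) with ha
  have hXv : ∀ z : ℂ, ‖z‖ < 1 → X (kernelVec q z) = X (kernelVec q z) 0 • kernelVec p z := by
    intro z hz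
    have hz' := mem_ball_zero_iff.2 hz
    refine eq_smul_kernelVec hg hinj hp hz' (hder z hz') ?_
    rw [← mul_apply_eq_comp, hX, mul_apply_eq_comp, wToeplitz_kernelVec hg hq hz, map_smul]
  have hc : ∀ z : ℂ, ‖z‖ < 1 → HasSum (fun i => a i * z ^ i) (X (kernelVec q z) 0) :=
    fun z hz => hasSum_apply_kernelVec hq.1 X hz
  have hale : ∀ i, ‖a i‖ ≤ ‖y‖ := norm_div_weight_le hq.1 y
  set E := ∑' k : ℕ, k * ‖coeff g k‖ ^ 2 with hE
  have hE0 : 0 ≤ E := tsum_nonneg fun _ => by positivity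
  -- The pointwise bound on |c(re^{iθ})|² is integrated over θ, with Parseval on both sides; on the
  -- left only the i-th term is kept.
  have hkey : ∀ i, ∀ r ∈ Ioo (0 : ℝ) 1, (‖a i‖ * r ^ i) ^ 2 ≤ ‖Z‖ ^ 2 * (3 * √(1 - r ^ 2) * E) := by
    intro i r ⟨hr0, hr1⟩
    have hr2 : r ^ 2 < 1 := pow_lt_one₀ hr0.le hr1 two_ne_zero
    have hrn : ∀ n : ℕ, ‖(r : ℂ) ^ n‖ = r ^ n := fun n => by
      rw [norm_pow, Complex.norm_real, Real.norm_of_nonneg hr0.le]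
    have hsum : Summable fun n => ‖a n * (r : ℂ) ^ n‖ := by
      refine Summable.of_nonneg_of_le (fun _ => norm_nonneg _) (fun n => ?_)
        ((summable_geometric_of_lt_one hr0.le hr1).mul_left ‖y‖)
      rw [norm_mul, hrn]
      gcongr
      exact hale n
    have hP := lintegral_norm_sq_tsum hsum
    have hzn : ∀ θ : ℝ, ‖(r : ℂ) * Complex.exp (θ * Complex.I)‖ = r := fun θ => by
      rw [norm_mul, Complex.norm_real, Real.norm_of_nonneg hr0.le,
        Complex.norm_exp_ofReal_mul_I, mul_one]
    have hpt : ∀ θ : ℝ, ‖∑' n, a n * (r : ℂ) ^ n * Complex.exp (n * θ * Complex.I)‖ₑ ^ 2 ≤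
        ENNReal.ofReal ((1 - r ^ 2) * ‖Z‖ ^ 2) * ∑' i, ENNReal.ofReal (weight p i ^ 2) *
          ‖∑' k, coeff g k * defect r i k * Complex.exp (k * θ * Complex.I)‖ₑ ^ 2 := by
      intro θ
      set z := (r : ℂ) * Complex.exp (θ * Complex.I) with hz
      have hz1 : ‖z‖ < 1 := by rw [hzn θ]; exact hr1
      have h1 : ∑' n, a n * (r : ℂ) ^ n * Complex.exp (n * θ * Complex.I) =
          X (kernelVec q z) 0 := by
        rw [← (hc z hz1).tsum_eq]
        refine tsum_congr fun n => ?_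
        rw [hz, mul_pow, ← Complex.exp_nat_mul, ← mul_assoc, ← mul_assoc]
      set w := ofSummable _ (summable_testVec hp.2 hz1) with hw
      have h2 := norm_sq_symbol_le hg hp hq hZ hz1 (hXv z hz1) (w := w)
        fun i => by rw [hw, ofSummable_apply]
      have h3 := enorm_sq_eq_tsum
        (ContinuousLinearMap.adjoint (wToeplitz hg hp - g z • 1 : SqSeq →L[ℂ] SqSeq) w)
      have hconv : ∀ {F : Type} [NormedAddCommGroup F] (c : F),
          ‖c‖ₑ ^ 2 = ENNReal.ofReal (‖c‖ ^ 2) := fun c => by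
        rw [ENNReal.ofReal_pow (norm_nonneg _), ofReal_norm]
      have h4 : ∀ i, ENNReal.ofReal (weight p i ^ 2) *
          ‖∑' k, coeff g k * defect r i k * Complex.exp (k * θ * Complex.I)‖ₑ ^ 2 =
          ‖(ContinuousLinearMap.adjoint (wToeplitz hg hp - g z • 1 : SqSeq →L[ℂ] SqSeq) w :
            SqSeq) i‖ₑ ^ 2 := fun i => by
        rw [hconv, hconv, norm_inner_testVec hg hp hr0 hr1 θ hz
          (fun i => by rw [hw, ofSummable_apply]) i, mul_pow, ENNReal.ofReal_mul (by positivity)]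
      rw [h1, tsum_congr h4, ← h3, hconv, hconv, ← ENNReal.ofReal_mul (mul_nonneg (by linarith)
        (by positivity))]
      rw [hzn θ] at h2
      exact ENNReal.ofReal_le_ofReal h2
    have hmeas : ∀ i, Measurable fun θ : ℝ => ENNReal.ofReal (weight p i ^ 2) *
        ‖∑' k, coeff g k * defect r i k * Complex.exp (k * θ * Complex.I)‖ₑ ^ 2 := by
      intro i
      have hcont : Continuous fun θ : ℝ =>
          ∑' k, coeff g k * defect r i k * Complex.exp (k * θ * Complex.I) := by
        refine continuous_tsum (fun k => by fun_prop) (summable_coeff_mul_defect hg hr0 hr1 i)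
          fun k θ => ?_
        rw [norm_mul _ (Complex.exp _), norm_exp_nat_mul, mul_one]
      exact (hcont.enorm.measurable.pow_const 2).const_mul _
    have hint := lintegral_mono (μ := volume.restrict (Ioo (-Real.pi) Real.pi)) hpt
    rw [hP, lintegral_const_mul' _ _ ENNReal.ofReal_ne_top,
      lintegral_tsum fun i => (hmeas i).aemeasurable] at hint
    have h5 : ∀ i, ∫⁻ θ in Ioo (-Real.pi) Real.pi, ENNReal.ofReal (weight p i ^ 2) *
        ‖∑' k, coeff g k * defect r i k * Complex.exp (k * θ * Complex.I)‖ₑ ^ 2 =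
        ENNReal.ofReal (2 * Real.pi) * (ENNReal.ofReal (weight p i ^ 2) *
          ∑' k, ‖coeff g k * defect r i k‖ₑ ^ 2) := fun i => by
      rw [lintegral_const_mul' _ _ ENNReal.ofReal_ne_top,
        lintegral_norm_sq_tsum (summable_coeff_mul_defect hg hr0 hr1 i), mul_left_comm]
    rw [tsum_congr h5, ENNReal.tsum_mul_left, mul_left_comm,
      ENNReal.mul_le_mul_iff_right (by simpa using Real.pi_pos) ENNReal.ofReal_ne_top,
      mul_comm (1 - r ^ 2), ENNReal.ofReal_mul (by positivity), mul_assoc] at hint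
    have h6 := (ENNReal.le_tsum i).trans (hint.trans
      (mul_le_mul_right (lintegral_testVec_le hg hp.2 hr0 hr1) _))
    rw [← ENNReal.ofReal_mul (by positivity), ← ofReal_norm, ← ENNReal.ofReal_pow (norm_nonneg _),
      ENNReal.ofReal_le_ofReal_iff (by positivity), norm_mul, hrn] at h6
    exact h6
  -- As r → 1 the left side of `hkey` tends to |a_i|² and the right side to 0.
  have ha0 : ∀ i, a i = 0 := by
    intro i
    have hl : Tendsto (fun r : ℝ => (‖a i‖ * r ^ i) ^ 2) (𝓝[<] 1) (𝓝 ((‖a i‖ * 1 ^ i) ^ 2)) :=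
      Tendsto.mono_left (Continuous.tendsto (by fun_prop) _) nhdsWithin_le_nhds
    have hr : Tendsto (fun r : ℝ => ‖Z‖ ^ 2 * (3 * √(1 - r ^ 2) * E)) (𝓝[<] 1)
        (𝓝 (‖Z‖ ^ 2 * (3 * √(1 - 1 ^ 2) * E))) :=
      Tendsto.mono_left (Continuous.tendsto (by fun_prop) _) nhdsWithin_le_nhds
    have h1 := le_of_tendsto_of_tendsto hl hr (by
      filter_upwards [Ioo_mem_nhdsLT (show (0 : ℝ) < 1 by norm_num)] with r hr
      exact hkey i r hr)
    simp only [one_pow, mul_one, sub_self, Real.sqrt_zero, mul_zero, zero_mul] at h1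
    have h2 : ‖a i‖ = 0 := by nlinarith [norm_nonneg (a i)]
    exact norm_eq_zero.1 h2
  refine ext_kernelVec hq.1 fun z hz => ?_
  have h1 := hc z hz
  simp only [ha0, zero_mul] at h1
  rw [hXv z hz, ← hasSum_zero.unique h1, zero_smul, _root_.zero_apply]

end SqSeq

end

/-! ### Orthogonal sums of copies of ℓ² and bidiagonal operator matrices -/

section

open Filter Metric Set MeasureTheory
open scoped Topology ENNReal InnerProductSpace ComplexConjugate InnerProduct

namespace SqSeq
open DiscDirichlet

variable {H : Type*} [NormedAddCommGroup H] [InnerProductSpace ℂ H] [CompleteSpace H]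

/-- Isometries `V 0, …, V (n - 1)` identifying `H` with a direct sum of `n` copies of `ℓ²`. -/
structure IsFrame (n : ℕ) (V : ℕ → SqSeq →L[ℂ] H) : Prop where
  eq_zero : ∀ j, n ≤ j → V j = 0
  adj : ∀ i j f, j < n → ((V i)†) (V j f) = if i = j then f else 0
  sum_eq : ∀ x, ∑ j ∈ Finset.range n, V j (((V j)†) x) = x

/-- Distinct basis vectors are √2 apart, so the balls of radius 1/2 around them are disjoint, and a
separable space admits only countably many. -/
theorem exists_countable_infinite_hilbertBasis [TopologicalSpace.SeparableSpace H]
    (hH : ¬ FiniteDimensional ℂ H) :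
    ∃ w : Set H, Countable w ∧ Infinite w ∧ Nonempty (HilbertBasis w ℂ H) := by
  obtain ⟨w, b, hb⟩ := exists_hilbertBasis ℂ H
  refine ⟨w, ?_, ?_, ⟨b⟩⟩
  · have ho := b.orthonormal
    have hd : ∀ i j, i ≠ j → √2 ≤ dist (b i) (b j) := fun i j hij => by
      rw [dist_eq_norm, Real.sqrt_le_left (norm_nonneg _), norm_sub_sq (𝕜 := ℂ), ho.1, ho.1, ho.2 hij]
      norm_num
    refine Pairwise.countable_of_isOpen_disjoint (s := fun i => ball (b i) (1 / 2)) ?_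
      (fun i => isOpen_ball) fun i => ⟨b i, mem_ball_self (by norm_num)⟩
    intro i j hij
    refine ball_disjoint_ball ?_
    have h1 : (1 : ℝ) ≤ √2 := by rw [Real.one_le_sqrt]; norm_num
    linarith [hd i j hij]
  · by_contra hfin
    rw [not_infinite_iff_finite] at hfin
    refine hH ?_
    have := Fintype.ofFinite w
    exact Module.Finite.of_basis b.toOrthonormalBasis.toBasis

theorem exists_isFrame [TopologicalSpace.SeparableSpace H] (hH : ¬ FiniteDimensional ℂ H)
    {n : ℕ} (hn : 1 ≤ n) : ∃ V : ℕ → SqSeq →L[ℂ] H, IsFrame n V := by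
  obtain ⟨w, hw1, hw2, ⟨b⟩⟩ := exists_countable_infinite_hilbertBasis hH
  have : NeZero n := ⟨by omega⟩
  obtain ⟨e⟩ := nonempty_equiv_of_countable (α := Fin n × ℕ) (β := w)
  let v : Fin n × ℕ → H := fun x => b (e x)
  have hv : Orthonormal ℂ v := b.orthonormal.comp e e.injective
  have hvj : ∀ j : Fin n, Orthonormal ℂ fun i => v (j, i) := fun j =>
    hv.comp _ fun a b h => (Prod.ext_iff.1 h).2
  let U : Fin n → SqSeq →L[ℂ] H := fun j =>
    (hvj j).orthogonalFamily.linearIsometry.toContinuousLinearMap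
  have hU : ∀ j i, U j (basisVec i) = v (j, i) := fun j i => by
    simp [U]
  have hadj : ∀ i j f, ((U i)†) (U j f) = if i = j then f else 0 := by
    intro i j f
    have h1 : ((U i)†) ∘L U j = if i = j then ContinuousLinearMap.id ℂ SqSeq else 0 := by
      refine ext_basisVec fun k => ?_
      ext l
      rw [← inner_basisVec, ContinuousLinearMap.comp_apply, ContinuousLinearMap.adjoint_inner_right,
        hU, hU, orthonormal_iff_ite.1 hv]
      split_ifs with h2 h3 h3
      · rw [ContinuousLinearMap.id_apply, basisVec_apply, if_pos (Prod.ext_iff.1 h2).2]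
      · exact absurd (Prod.ext_iff.1 h2).1 h3
      · rw [ContinuousLinearMap.id_apply, basisVec_apply, if_neg fun h4 => h2 (Prod.ext h3 h4)]
      · simp
    have h2 := DFunLike.congr_fun h1 f
    rw [ContinuousLinearMap.comp_apply] at h2
    rw [h2]
    split_ifs <;> simp
  refine ⟨fun j => if h : j < n then U ⟨j, h⟩ else 0, fun j hj => dif_neg (not_lt.2 hj), ?_, ?_⟩
  · intro i j f hj
    by_cases hi : i < n
    · simp only [dif_pos hi, dif_pos hj]
      rw [hadj]
      simp [Fin.ext_iff]
    · simp only [dif_neg hi, map_zero, _root_.zero_apply]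
      rw [if_neg (by omega)]
  · intro x
    have h1 : ∑ j : Fin n, U j ∘L ((U j)†) = ContinuousLinearMap.id ℂ H := by
      refine ContinuousLinearMap.ext_on (s := Set.range v) ?_ ?_
      · have h2 := congrArg SetLike.coe b.dense_span
        rw [Submodule.topologicalClosure_coe, Submodule.top_coe] at h2
        have h3 : Set.range v = Set.range b := e.surjective.range_comp b
        rw [h3]
        exact dense_iff_closure_eq.2 h2
      · rintro _ ⟨⟨j, i⟩, rfl⟩
        rw [_root_.sum_apply, ContinuousLinearMap.id_apply, ← hU]
        simp only [ContinuousLinearMap.comp_apply, hadj]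
        rw [Finset.sum_eq_single j (fun k _ hk => by rw [if_neg hk, map_zero]) (by simp), if_pos rfl]
    have h2 := DFunLike.congr_fun h1 x
    rw [_root_.sum_apply, ContinuousLinearMap.id_apply] at h2
    rw [← Fin.sum_univ_eq_sum_range (fun j => (if h : j < n then U ⟨j, h⟩ else 0)
      ((ContinuousLinearMap.adjoint (if h : j < n then U ⟨j, h⟩ else 0)) x)) n]
    simpa using h2

/-- The operator with diagonal entries `A j` and superdiagonal entries `B`. -/
noncomputable def bidiag (n : ℕ) (V : ℕ → SqSeq →L[ℂ] H) (A : ℕ → SqSeq →L[ℂ] SqSeq)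
    (B : SqSeq →L[ℂ] SqSeq) : H →L[ℂ] H :=
  ∑ j ∈ Finset.range n, V j ∘L (A j ∘L ((V j)†) + B ∘L ((V (j + 1))†))

namespace IsFrame

variable {n : ℕ} {V : ℕ → SqSeq →L[ℂ] H}

theorem adj_sum (hV : IsFrame n V) (F : ℕ → SqSeq) {i : ℕ} (hi : i < n) :
    ((V i)†) (∑ j ∈ Finset.range n, V j (F j)) = F i := by
  rw [map_sum, Finset.sum_eq_single_of_mem i (Finset.mem_range.2 hi), hV.adj _ _ _ hi, if_pos rfl]
  intro j hj hne
  rw [hV.adj _ _ _ (Finset.mem_range.1 hj), if_neg hne.symm]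

theorem adj_self (hV : IsFrame n V) {j : ℕ} (hj : j < n) (f : SqSeq) : ((V j)†) (V j f) = f := by
  rw [hV.adj _ _ _ hj, if_pos rfl]

theorem adj_of_le (hV : IsFrame n V) {j : ℕ} (hj : n ≤ j) (x : H) : ((V j)†) x = 0 := by
  rw [hV.eq_zero j hj, map_zero, _root_.zero_apply]

theorem ext (hV : IsFrame n V) {x y : H} (h : ∀ j < n, ((V j)†) x = ((V j)†) y) : x = y := by
  rw [← hV.sum_eq x, ← hV.sum_eq y]
  exact Finset.sum_congr rfl fun j hj => by rw [h j (Finset.mem_range.1 hj)]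

theorem eq_zero_of_descent (hV : IsFrame n V) {x : H}
    (h : ∀ j < n, ((V (j + 1))†) x = 0 → ((V j)†) x = 0) : x = 0 := by
  have h1 : ∀ m ≤ n, ((V (n - m))†) x = 0 := by
    intro m
    induction m with
    | zero => exact fun _ => hV.adj_of_le (by omega) x
    | succ m ih =>
      intro hm
      have h2 := ih (by omega)
      have e : n - m = n - (m + 1) + 1 := by omega
      rw [e] at h2
      exact h _ (by omega) h2
  refine hV.ext fun j hj => ?_
  have h2 := h1 (n - j) (by omega)
  have e : n - (n - j) = j := by omega
  rw [map_zero, ← h2, e]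

/-- Back substitution. `G m` is the coordinate of index n - m, and the recursion starts from the
coordinate of index n, which is zero because V n = 0; the last row thus needs no separate case. -/
theorem exists_of_recursion (hV : IsFrame n V) (Φ : ℕ → SqSeq → SqSeq) :
    ∃ x : H, ∀ j < n, ((V j)†) x = Φ j (((V (j + 1))†) x) := by
  let G : ℕ → SqSeq := fun m => Nat.rec 0 (fun k g => Φ (n - 1 - k) g) m
  have hG : ∀ m, G (m + 1) = Φ (n - 1 - m) (G m) := fun m => rfl
  refine ⟨∑ j ∈ Finset.range n, V j (G (n - j)), fun j hj => ?_⟩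
  rw [hV.adj_sum (fun j => G (n - j)) hj]
  have e1 : n - j = (n - 1 - j) + 1 := by omega
  have e2 : n - 1 - (n - 1 - j) = j := by omega
  have h1 : ((V (j + 1))†) (∑ j ∈ Finset.range n, V j (G (n - j))) = G (n - 1 - j) := by
    rcases Nat.lt_or_ge (j + 1) n with h | h
    · rw [hV.adj_sum (fun j => G (n - j)) h]
      congr 1
      omega
    · rw [hV.adj_of_le h]
      have e3 : n - 1 - j = 0 := by omega
      rw [e3]
      rfl
  rw [h1, e1, hG, e2]

theorem adj_bidiag (hV : IsFrame n V) (A : ℕ → SqSeq →L[ℂ] SqSeq) (B : SqSeq →L[ℂ] SqSeq) (x : H)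
    {i : ℕ} (hi : i < n) :
    ((V i)†) (bidiag n V A B x) = A i (((V i)†) x) + B (((V (i + 1))†) x) := by
  have h := hV.adj_sum (fun j => A j (((V j)†) x) + B (((V (j + 1))†) x)) hi
  rw [← h, bidiag, _root_.sum_apply]
  rfl

theorem bidiag_zero (hV : IsFrame n V) (A : ℕ → SqSeq →L[ℂ] SqSeq) (B : SqSeq →L[ℂ] SqSeq)
    (hn : 0 < n) (f : SqSeq) : bidiag n V A B (V 0 f) = V 0 (A 0 f) := by
  refine hV.ext fun i hi => ?_
  rw [hV.adj_bidiag A B _ hi, hV.adj _ _ _ hn, hV.adj _ _ _ hn, hV.adj _ _ _ hn,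
    if_neg (Nat.succ_ne_zero i), map_zero, add_zero]
  split_ifs with h
  · rw [h]
  · rw [map_zero]

theorem bidiag_succ (hV : IsFrame n V) (A : ℕ → SqSeq →L[ℂ] SqSeq) (B : SqSeq →L[ℂ] SqSeq) {j : ℕ}
    (hj : j + 1 < n) (f : SqSeq) :
    bidiag n V A B (V (j + 1) f) = V (j + 1) (A (j + 1) f) + V j (B f) := by
  refine hV.ext fun i hi => ?_
  have hj' : j < n := by omega
  rw [hV.adj_bidiag A B _ hi, map_add, hV.adj _ _ _ hj, hV.adj _ _ _ hj, hV.adj _ _ _ hj,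
    hV.adj _ _ _ hj']
  simp only [Nat.add_right_cancel_iff]
  congr 1
  · split_ifs with h
    · rw [h]
    · rw [map_zero]
  · split_ifs with h
    · rfl
    · rw [map_zero]

theorem isUnit_bidiag_sub (hV : IsFrame n V) {A : ℕ → SqSeq →L[ℂ] SqSeq} {B : SqSeq →L[ℂ] SqSeq}
    {w : ℂ} (hA : ∀ j < n, IsUnit (A j - w • 1)) : IsUnit (bidiag n V A B - w • 1) := by
  have hbij : ∀ j < n, Function.Bijective (A j - w • 1 : SqSeq →L[ℂ] SqSeq) := fun j hj =>
    ContinuousLinearMap.isUnit_iff_bijective.1 (hA j hj)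
  have hcoord : ∀ x, ∀ i < n, ((V i)†) ((bidiag n V A B - w • 1) x) =
      (A i - w • 1) (((V i)†) x) + B (((V (i + 1))†) x) := fun x i hi => by
    rw [_root_.sub_apply, _root_.smul_apply, one_apply_eq_self, map_sub, map_smul,
      hV.adj_bidiag A B x hi, _root_.sub_apply, _root_.smul_apply, one_apply_eq_self]
    abel
  rw [ContinuousLinearMap.isUnit_iff_bijective]
  constructor
  · rw [injective_iff_map_eq_zero]
    intro x hx
    refine hV.eq_zero_of_descent fun j hj h1 => ?_
    have h2 := hcoord x j hj
    rw [hx, map_zero, h1, map_zero, add_zero] at h2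
    exact (injective_iff_map_eq_zero _).1 (hbij j hj).1 _ h2.symm
  · intro y
    obtain ⟨x, hx⟩ := hV.exists_of_recursion fun j f =>
      if hj : j < n then ((hbij j hj).2 (((V j)†) y - B f)).choose else 0
    refine ⟨x, hV.ext fun j hj => ?_⟩
    rw [hcoord x j hj, hx j hj, dif_pos hj, ((hbij j hj).2 _).choose_spec, sub_add_cancel]

/-- Prescribing the zeroth entry of each component uses up the one-dimensional freedom in each row.
For y = 0 these n numbers are linear coordinates on the kernel, whence its dimension. -/
theorem exists_bidiag_sub_eq (hV : IsFrame n V) {A : ℕ → SqSeq →L[ℂ] SqSeq} {B : SqSeq →L[ℂ] SqSeq}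
    {w : ℂ} (hA : ∀ j < n, ∀ (y : SqSeq) (c : ℂ), ∃ f : SqSeq, (A j - w • 1) f = y ∧ f 0 = c)
    (y : H) (c : ℕ → ℂ) :
    ∃ x, (bidiag n V A B - w • 1) x = y ∧ ∀ j < n, (((V j)†) x) 0 = c j := by
  obtain ⟨x, hx⟩ := hV.exists_of_recursion fun j f =>
    if hj : j < n then (hA j hj (((V j)†) y - B f) (c j)).choose else 0
  refine ⟨x, hV.ext fun j hj => ?_, fun j hj => ?_⟩
  · have h1 := (hA j hj (((V j)†) y - B (((V (j + 1))†) x)) (c j)).choose_spec.1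
    have h2 := hx j hj
    rw [dif_pos hj] at h2
    rw [← h2] at h1
    rw [_root_.sub_apply, _root_.smul_apply, one_apply_eq_self] at h1 ⊢
    rw [map_sub, map_smul, hV.adj_bidiag A B x hj, add_sub_right_comm, h1, sub_add_cancel]
  · have h1 := (hA j hj (((V j)†) y - B (((V (j + 1))†) x)) (c j)).choose_spec.2
    have h2 := hx j hj
    rw [dif_pos hj] at h2
    rw [h2]
    exact h1

theorem eq_zero_of_bidiag_sub (hV : IsFrame n V) {A : ℕ → SqSeq →L[ℂ] SqSeq}
    {B : SqSeq →L[ℂ] SqSeq} {w : ℂ}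
    (hA : ∀ j < n, ∀ f : SqSeq, (A j - w • 1) f = 0 → f 0 = 0 → f = 0) {x : H}
    (hx : (bidiag n V A B - w • 1) x = 0) (h0 : ∀ j < n, (((V j)†) x) 0 = 0) : x = 0 := by
  refine hV.eq_zero_of_descent fun j hj h1 => hA j hj _ ?_ (h0 j hj)
  rw [_root_.sub_apply, _root_.smul_apply, one_apply_eq_self] at hx ⊢
  have h2 := congrArg ((V j)†) hx
  rw [map_sub, map_smul, hV.adj_bidiag A B x hj, h1, map_zero, map_zero, add_zero] at h2
  exact h2

theorem rank_ker_bidiag_sub (hV : IsFrame n V) {A : ℕ → SqSeq →L[ℂ] SqSeq} {B : SqSeq →L[ℂ] SqSeq}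
    {w : ℂ} (hA : ∀ j < n, ∀ (y : SqSeq) (c : ℂ), ∃ f : SqSeq, (A j - w • 1) f = y ∧ f 0 = c)
    (hA' : ∀ j < n, ∀ f : SqSeq, (A j - w • 1) f = 0 → f 0 = 0 → f = 0) :
    Module.Finite ℂ (bidiag n V A B - w • 1 : H →L[ℂ] H).ker ∧
      Module.finrank ℂ (bidiag n V A B - w • 1 : H →L[ℂ] H).ker = n := by
  set D : H →L[ℂ] H := bidiag n V A B - w • 1 with hD
  let L : D.ker →ₗ[ℂ] (Fin n → ℂ) := LinearMap.pi fun j =>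
    ((coord 0 ∘L ((V j)†) : H →L[ℂ] ℂ) : H →ₗ[ℂ] ℂ) ∘ₗ D.ker.subtype
  have hL : ∀ x j, L x j = (((V (j : ℕ))†) (x : H)) 0 := fun x j => by simp [L]
  have hbij : Function.Bijective L := by
    constructor
    · rw [injective_iff_map_eq_zero]
      intro x hx
      refine Subtype.ext (hV.eq_zero_of_bidiag_sub hA' x.2 fun j hj => ?_)
      rw [← hL x ⟨j, hj⟩, hx, Pi.zero_apply]
    · intro c
      obtain ⟨x, hx1, hx2⟩ := hV.exists_bidiag_sub_eq (B := B) hA 0 fun j =>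
        if h : j < n then c ⟨j, h⟩ else 0
      refine ⟨⟨x, hx1⟩, ?_⟩
      funext j
      rw [hL, hx2 j j.2, dif_pos j.2]
  let e := LinearEquiv.ofBijective L hbij
  refine ⟨Module.Finite.equiv e.symm, ?_⟩
  rw [e.finrank_eq, Module.finrank_fin_fun]

end IsFrame

theorem isFredholm_of_surjective {D : H →L[ℂ] H} (hs : Function.Surjective D)
    (hfin : Module.Finite ℂ D.ker) : D.IsFredholm := by
  have hr : D.range = ⊤ := LinearMap.range_eq_top.2 hs
  refine ⟨(D.isOpenMap hs).isStrictMap D.continuous, ?_, hfin, ?_, ?_⟩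
  · rw [hr]
    exact isClosed_univ
  · rw [hr]
    exact Submodule.CoFG.top
  · exact Submodule.ClosedComplemented.of_finiteDimensional _

/-- A sequence of unit vectors that are approximately in the kernel of a Fredholm operator has a
convergent subsequence. -/
theorem exists_tendsto_subseq_of_isFredholm {H : Type*} [NormedAddCommGroup H] [InnerProductSpace ℂ H]
    {D : H →L[ℂ] H} (hD : D.IsFredholm) {u : ℕ → H}
    (hu : ∀ m, ‖u m‖ = 1) (h0 : Tendsto (fun m => D (u m)) atTop (𝓝 0)) :
    ∃ (x : H) (ψ : ℕ → ℕ), StrictMono ψ ∧ Tendsto (u ∘ ψ) atTop (𝓝 x) := by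
  obtain ⟨Q, hQ⟩ := hD.exists_isQuasiInverse
  have h1 := hQ.1
  rw [LinearMap.IsLeftQuasiInverse, LinearMap.FiniteRangeSetoid.equiv_iff_hasFiniteRange] at h1
  -- K has finite rank, and u = Q D u - K u: the first term converges, and the second is bounded in
  -- a finite-dimensional space.
  set K : H →L[ℂ] H := Q ∘L D - ContinuousLinearMap.id ℂ H with hK
  have hfin : FiniteDimensional ℂ K.range := by
    have e : (K : H →ₗ[ℂ] H) = (Q : H →ₗ[ℂ] H) ∘ₗ (D : H →ₗ[ℂ] H) - LinearMap.id := by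
      ext x
      simp [hK]
    rw [e]
    exact Module.Finite.iff_fg.2 h1
  have : ProperSpace K.range := FiniteDimensional.proper ℂ _
  have hb : ∀ m, K.rangeRestrict (u m) ∈ closedBall (0 : K.range) ‖K‖ := fun m => by
    rw [mem_closedBall_zero_iff]
    have h2 := K.le_opNorm (u m)
    rw [hu, mul_one] at h2
    exact h2
  obtain ⟨y, -, ψ, hψ, hy⟩ := tendsto_subseq_of_bounded isBounded_closedBall hb
  refine ⟨Q 0 - (y : H), ψ, hψ, ?_⟩
  have h2 : Tendsto (fun m => Q (D (u (ψ m)))) atTop (𝓝 (Q 0)) :=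
    (Q.continuous.tendsto 0).comp (h0.comp hψ.tendsto_atTop)
  have h3 : Tendsto (fun m => ((K.rangeRestrict (u (ψ m)) : K.range) : H)) atTop (𝓝 (y : H)) :=
    (continuous_subtype_val.tendsto y).comp hy
  have e : u ∘ ψ = fun m => Q (D (u (ψ m))) - ((K.rangeRestrict (u (ψ m)) : K.range) : H) := by
    funext m
    have : ((K.rangeRestrict (u (ψ m)) : K.range) : H) = K (u (ψ m)) := rfl
    rw [this, hK]
    simp
  rw [e]
  exact h2.sub h3

end SqSeq

end

/-! ### The model operator: kernels, spectrum and Fredholm domain -/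

section

open Filter Metric Set MeasureTheory
open scoped Topology ENNReal InnerProductSpace ComplexConjugate InnerProduct

namespace SqSeq
open DiscDirichlet

/-- A Riemann map of `Ω` of class `BoundedDirichlet`. -/
structure IsConformal (φ : ℂ → ℂ) (Ω : Set ℂ) : Prop where
  bdd : BoundedDirichlet φ
  inj : InjOn φ (ball 0 1)
  der : ∀ z ∈ ball (0 : ℂ) 1, deriv φ z ≠ 0
  image : φ '' ball 0 1 = Ω

variable {φ : ℂ → ℂ} {Ω : Set ℂ}

theorem IsConformal.exists_wToeplitz_sub_eq (hφ : IsConformal φ Ω) {p : ℝ}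
    (hp : p ∈ Icc (0 : ℝ) (1 / 4)) {z : ℂ} (hz : z ∈ ball (0 : ℂ) 1) (y : SqSeq) (c : ℂ) :
    ∃ f : SqSeq, (wToeplitz hφ.bdd hp - φ z • 1) f = y ∧ f 0 = c := by
  obtain ⟨R, hR⟩ := exists_rightInverse_wToeplitz_sub hφ.bdd hφ.inj hp hz (hφ.der z hz)
  have hz' := mem_ball_zero_iff.1 hz
  have h1 : (wToeplitz hφ.bdd hp - φ z • 1) (kernelVec p z) = 0 := by
    rw [_root_.sub_apply, _root_.smul_apply, one_apply_eq_self, wToeplitz_kernelVec hφ.bdd hp hz',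
      sub_self]
  refine ⟨R y + (c - R y 0) • kernelVec p z, ?_, ?_⟩
  · rw [map_add, map_smul, h1, smul_zero, add_zero, ← mul_apply_eq_comp, hR, one_apply_eq_self]
  · rw [lp.coeFn_add, Pi.add_apply, lp.coeFn_smul, Pi.smul_apply, kernelVec_zero hp.1 hz',
      smul_eq_mul, mul_one, add_sub_cancel]

theorem IsConformal.eq_zero_of_wToeplitz_sub (hφ : IsConformal φ Ω) {p : ℝ}
    (hp : p ∈ Icc (0 : ℝ) (1 / 4)) {z : ℂ} (hz : z ∈ ball (0 : ℂ) 1) {f : SqSeq}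
    (hf : (wToeplitz hφ.bdd hp - φ z • 1) f = 0) (h0 : f 0 = 0) : f = 0 := by
  rw [_root_.sub_apply, _root_.smul_apply, one_apply_eq_self, sub_eq_zero] at hf
  rw [eq_smul_kernelVec hφ.bdd hφ.inj hp hz (hφ.der z hz) hf, h0, zero_smul]

theorem IsConformal.isCowenDouglas (hφ : IsConformal φ Ω) {p : ℝ} (hp : p ∈ Icc (0 : ℝ) (1 / 4)) :
    EssCowenDouglas.IsCowenDouglas 1 Ω (wToeplitz hφ.bdd hp) := by
  have hmem : ∀ z ∈ ball (0 : ℂ) 1, kernelVec p z ∈ (wToeplitz hφ.bdd hp - φ z • 1 : SqSeq →L[ℂ] SqSeq).ker := by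
    intro z hz
    rw [LinearMap.mem_ker, ContinuousLinearMap.coe_coe, _root_.sub_apply, _root_.smul_apply,
      one_apply_eq_self, wToeplitz_kernelVec hφ.bdd hp (mem_ball_zero_iff.1 hz), sub_self]
  refine ⟨?_, ?_, ?_⟩
  · intro w hw
    obtain ⟨z, hz, rfl⟩ := hφ.image.symm ▸ hw
    intro y
    obtain ⟨f, hf, -⟩ := hφ.exists_wToeplitz_sub_eq hp hz y 0
    exact ⟨f, hf⟩
  · intro w hw
    obtain ⟨z, hz, rfl⟩ := hφ.image.symm ▸ hw
    have hz' := mem_ball_zero_iff.1 hz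
    rw [Nat.cast_one, rank_submodule_eq_one_iff]
    refine ⟨kernelVec p z, hmem z hz, fun h => ?_, fun f hf => ?_⟩
    · have := kernelVec_zero hp.1 hz'
      rw [h] at this
      simp at this
    · rw [LinearMap.mem_ker, ContinuousLinearMap.coe_coe, _root_.sub_apply, _root_.smul_apply,
        one_apply_eq_self, sub_eq_zero] at hf
      exact Submodule.mem_span_singleton.2
        ⟨f 0, (eq_smul_kernelVec hφ.bdd hφ.inj hp hz (hφ.der z hz) hf).symm⟩
  · rw [eq_top_iff, ← span_kernelVec hp.1]
    refine Submodule.topologicalClosure_mono (Submodule.span_le.2 ?_)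
    rintro _ ⟨z, hz, rfl⟩
    have hw : φ z ∈ Ω := hφ.image ▸ mem_image_of_mem φ hz
    exact Submodule.mem_iSup_of_mem (φ z) (Submodule.mem_iSup_of_mem hw (hmem z hz))

/-- Exponents in `[0, 1/4]` with constant decrement `s`. -/
structure IsExponents (n : ℕ) (s : ℝ) (p : ℕ → ℝ) : Prop where
  pos : 0 < s
  mem : ∀ j, p j ∈ Icc (0 : ℝ) (1 / 4)
  step : ∀ j, j + 1 < n → p j = p (j + 1) + s

theorem exists_isExponents {n : ℕ} (hn : 1 ≤ n) : ∃ s p, IsExponents n s p := by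
  have hn' : (0 : ℝ) < n := by exact_mod_cast hn
  -- Equally spaced exponents descending to 0 at j = n - 1. The truncated subtraction keeps those
  -- with j ≥ n at 0, so membership in [0, 1/4] holds for all j.
  refine ⟨1 / (4 * n), fun j => ((n - 1 - j : ℕ) : ℝ) / (4 * n), by positivity, fun j => ⟨by positivity, ?_⟩,
    fun j hj => ?_⟩
  · rw [div_le_div_iff₀ (by positivity) (by norm_num)]
    have : ((n - 1 - j : ℕ) : ℝ) ≤ n := by exact_mod_cast (by omega)
    linarith
  · have e : n - 1 - j = (n - 1 - (j + 1)) + 1 := by omega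
    simp only [e]
    push_cast
    ring

variable {H : Type*} [NormedAddCommGroup H] [InnerProductSpace ℂ H] [CompleteSpace H]

/-- The model operator: weighted Toeplitz operators on the diagonal and a compact diagonal operator
on the superdiagonal. -/
noncomputable def model {n : ℕ} {s : ℝ} {p : ℕ → ℝ} (V : ℕ → SqSeq →L[ℂ] H) (hp : IsExponents n s p)
    (hφ : IsConformal φ Ω) : H →L[ℂ] H :=
  bidiag n V (fun j => wToeplitz hφ.bdd (hp.mem j)) (diagOp s hp.pos.le)

theorem IsFrame.norm_apply {n : ℕ} {V : ℕ → SqSeq →L[ℂ] H} (hV : IsFrame n V) {j : ℕ} (hj : j < n)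
    (f : SqSeq) : ‖V j f‖ = ‖f‖ := by
  rw [norm_eq_sqrt_re_inner (𝕜 := ℂ), norm_eq_sqrt_re_inner (𝕜 := ℂ) f,
    ← ContinuousLinearMap.adjoint_inner_left, hV.adj_self hj]

section Model

variable {n : ℕ} {s : ℝ} {p : ℕ → ℝ} {V : ℕ → SqSeq →L[ℂ] H}

theorem isUnit_model_sub (hV : IsFrame n V) (hp : IsExponents n s p) (hφ : IsConformal φ Ω) {w : ℂ}
    (hw : w ∉ closure Ω) : IsUnit (model V hp hφ - w • 1) :=
  hV.isUnit_bidiag_sub fun j _ =>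
    isUnit_wToeplitz_sub hφ.bdd (hp.mem j) (by rw [hφ.image]; exact hw)

theorem model_sub_surjective (hV : IsFrame n V) (hp : IsExponents n s p) (hφ : IsConformal φ Ω)
    {w : ℂ} (hw : w ∈ Ω) : Function.Surjective (model V hp hφ - w • 1 : H →L[ℂ] H) := by
  obtain ⟨z, hz, rfl⟩ := hφ.image.symm ▸ hw
  intro y
  obtain ⟨x, hx, -⟩ := hV.exists_bidiag_sub_eq (B := diagOp s hp.pos.le)
    (fun j _ => hφ.exists_wToeplitz_sub_eq (hp.mem j) hz) y 0
  exact ⟨x, hx⟩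

theorem finrank_ker_model_sub (hV : IsFrame n V) (hp : IsExponents n s p) (hφ : IsConformal φ Ω)
    {w : ℂ} (hw : w ∈ Ω) : Module.Finite ℂ (model V hp hφ - w • 1 : H →L[ℂ] H).ker ∧
      Module.finrank ℂ (model V hp hφ - w • 1 : H →L[ℂ] H).ker = n := by
  obtain ⟨z, hz, rfl⟩ := hφ.image.symm ▸ hw
  exact hV.rank_ker_bidiag_sub (fun j _ => hφ.exists_wToeplitz_sub_eq (hp.mem j) hz)
    fun j _ _ hf h0 => hφ.eq_zero_of_wToeplitz_sub (hp.mem j) hz hf h0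

/-- Induction on j. Back substitution extends the kernel vector at z, placed in component j with
zeros in the later components, to an eigenvector of the model. Its earlier components lie in the
closure by induction, hence so does the j-th, and kernel vectors span densely. -/
theorem mem_closure_iSup_ker_model (hV : IsFrame n V) (hp : IsExponents n s p)
    (hφ : IsConformal φ Ω) {j : ℕ} (hj : j < n) (f : SqSeq) :
    V j f ∈ (⨆ w ∈ Ω, (model V hp hφ - w • 1 : H →L[ℂ] H).ker).topologicalClosure := by
  set K := (⨆ w ∈ Ω, (model V hp hφ - w • 1 : H →L[ℂ] H).ker) with hK
  induction j using Nat.strong_induction_on generalizing f with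
  | _ j ih =>
    have hker : ∀ z ∈ ball (0 : ℂ) 1, V j (kernelVec (p j) z) ∈ K.topologicalClosure := by
      intro z hz
      choose Φ hΦ using fun i (y : SqSeq) => hφ.exists_wToeplitz_sub_eq (hp.mem i) hz y 0
      obtain ⟨x, hx⟩ := hV.exists_of_recursion fun i f =>
        if i < j then Φ i (-(diagOp s hp.pos.le f)) else if i = j then kernelVec (p j) z else 0
      have hxgt : ∀ i, j < i → ((V i)†) x = 0 := fun i hi => by
        by_cases h : i < n
        · rw [hx i h, if_neg (by omega), if_neg (by omega)]
        · exact hV.adj_of_le (not_lt.1 h) x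
      have hxK : x ∈ K := by
        have hw : φ z ∈ Ω := hφ.image ▸ mem_image_of_mem φ hz
        refine Submodule.mem_iSup_of_mem (φ z) (Submodule.mem_iSup_of_mem hw ?_)
        rw [LinearMap.mem_ker, ContinuousLinearMap.coe_coe]
        refine hV.ext fun i hi => ?_
        have h1 : ((V i)†) ((model V hp hφ - φ z • 1) x) =
            (wToeplitz hφ.bdd (hp.mem i) - φ z • 1) (((V i)†) x) +
              diagOp s hp.pos.le (((V (i + 1))†) x) := by
          rw [_root_.sub_apply, _root_.smul_apply, one_apply_eq_self, map_sub, map_smul, model,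
            hV.adj_bidiag _ _ x hi, _root_.sub_apply, _root_.smul_apply, one_apply_eq_self]
          abel
        rw [h1, map_zero]
        rcases lt_trichotomy i j with h | rfl | h
        · rw [hx i hi, if_pos h, (hΦ i _).1, neg_add_cancel]
        · rw [hx i hi, if_neg (lt_irrefl i), if_pos rfl, hxgt (i + 1) (by omega), map_zero, add_zero,
            _root_.sub_apply, _root_.smul_apply, one_apply_eq_self,
            wToeplitz_kernelVec _ _ (mem_ball_zero_iff.1 hz), sub_self]
        · rw [hxgt i h, hxgt (i + 1) (by omega), map_zero, map_zero, add_zero]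
      have h2 : V j (kernelVec (p j) z) = x - ∑ i ∈ Finset.range j, V i (((V i)†) x) := by
        have h3 := hV.sum_eq x
        rw [← Finset.sum_range_add_sum_Ico _ (show j + 1 ≤ n by omega), Finset.sum_eq_zero
          (s := Finset.Ico (j + 1) n) (fun i hi => by
            rw [hxgt i (by have := Finset.mem_Ico.1 hi; omega), map_zero]), add_zero,
          Finset.sum_range_succ, hx j hj, if_neg (lt_irrefl j), if_pos rfl] at h3
        rw [eq_sub_iff_add_eq, add_comm, h3]
      rw [h2]
      refine sub_mem (K.le_topologicalClosure hxK) (sum_mem fun i hi => ?_)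
      have hi' := Finset.mem_range.1 hi
      exact ih i hi' (by omega) _
    have hle : (Submodule.span ℂ (kernelVec (p j) '' ball 0 1)).topologicalClosure ≤
        K.topologicalClosure.comap (V j : SqSeq →ₗ[ℂ] H) := by
      refine Submodule.topologicalClosure_minimal _ (Submodule.span_le.2 ?_)
        (K.isClosed_topologicalClosure.preimage (V j).continuous)
      rintro _ ⟨z, hz, rfl⟩
      exact hker z hz
    rw [span_kernelVec (hp.mem j).1] at hle
    exact hle Submodule.mem_top

theorem isCowenDouglas_model (hV : IsFrame n V) (hp : IsExponents n s p) (hφ : IsConformal φ Ω) :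
    EssCowenDouglas.IsCowenDouglas n Ω (model V hp hφ) := by
  refine ⟨fun w hw => model_sub_surjective hV hp hφ hw, fun w hw => ?_, ?_⟩
  · obtain ⟨h1, h2⟩ := finrank_ker_model_sub hV hp hφ hw
    rw [← Module.finrank_eq_rank, h2]
  · rw [eq_top_iff]
    intro x _
    rw [← hV.sum_eq x]
    exact sum_mem fun j hj => mem_closure_iSup_ker_model hV hp hφ (Finset.mem_range.1 hj) _

theorem spectrum_model (hV : IsFrame n V) (hp : IsExponents n s p) (hφ : IsConformal φ Ω)
    (hn : 1 ≤ n) : spectrum ℂ (model V hp hφ) = closure Ω := by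
  have hiff : ∀ w, w ∈ spectrum ℂ (model V hp hφ) ↔ ¬ IsUnit (model V hp hφ - w • 1) := fun w => by
    rw [spectrum.mem_iff, Algebra.algebraMap_eq_smul_one, ← IsUnit.neg_iff, neg_sub]
  refine Subset.antisymm (fun w hw => ?_) ?_
  · by_contra h
    exact (hiff w).1 hw (isUnit_model_sub hV hp hφ h)
  · refine closure_minimal (fun w hw => (hiff w).2 fun h => ?_) (spectrum.isClosed _)
    have h1 := LinearMap.ker_eq_bot.2 (ContinuousLinearMap.isUnit_iff_bijective.1 h).1
    have h2 := (finrank_ker_model_sub hV hp hφ hw).2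
    rw [h1, finrank_bot] at h2
    omega

theorem ker_sub_comm {E : Type*} [NormedAddCommGroup E] [NormedSpace ℂ E] (T : E →L[ℂ] E) (w : ℂ) :
    (w • (1 : E →L[ℂ] E) - T).ker = (T - w • (1 : E →L[ℂ] E)).ker := by
  ext x
  rw [LinearMap.mem_ker, LinearMap.mem_ker, ContinuousLinearMap.coe_coe, ContinuousLinearMap.coe_coe,
    _root_.sub_apply, _root_.sub_apply, sub_eq_zero, sub_eq_zero, eq_comm]

theorem sub_model_surjective (hV : IsFrame n V) (hp : IsExponents n s p) (hφ : IsConformal φ Ω)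
    {w : ℂ} (hw : w ∈ Ω) : Function.Surjective (w • (1 : H →L[ℂ] H) - model V hp hφ) := by
  intro y
  obtain ⟨x, hx⟩ := model_sub_surjective hV hp hφ hw (-y)
  refine ⟨x, ?_⟩
  rw [← neg_sub, _root_.neg_apply, hx, neg_neg]

theorem isFredholm_model (hV : IsFrame n V) (hp : IsExponents n s p) (hφ : IsConformal φ Ω)
    {w : ℂ} (hw : w ∈ Ω) : (w • (1 : H →L[ℂ] H) - model V hp hφ).IsFredholm := by
  refine isFredholm_of_surjective (sub_model_surjective hV hp hφ hw) ?_
  rw [ker_sub_comm]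
  exact (finrank_ker_model_sub hV hp hφ hw).1

theorem fredholmIndex_model (hV : IsFrame n V) (hp : IsExponents n s p) (hφ : IsConformal φ Ω)
    {w : ℂ} (hw : w ∈ Ω) :
    EssCowenDouglas.fredholmIndex (w • (1 : H →L[ℂ] H) - model V hp hφ) = n := by
  have hr : (w • (1 : H →L[ℂ] H) - model V hp hφ).range = ⊤ :=
    LinearMap.range_eq_top.2 (sub_model_surjective hV hp hφ hw)
  have h1 : Module.finrank ℂ (H ⧸ (w • (1 : H →L[ℂ] H) - model V hp hφ).range) = 0 := by
    rw [hr]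
    exact Module.finrank_zero_of_subsingleton
  rw [EssCowenDouglas.fredholmIndex, h1, ker_sub_comm, (finrank_ker_model_sub hV hp hφ hw).2]
  simp

/-- Properness of the Riemann map: the image of the closed disc of radius r < 1 is a compact subset
of Ω, so a sequence of values converging to w ∉ Ω eventually leaves it. -/
theorem IsConformal.tendsto_norm (hφ : IsConformal φ Ω) {w : ℂ} (hw : w ∉ Ω) {z : ℕ → ℂ}
    (hz : ∀ m, z m ∈ ball (0 : ℂ) 1) (h : Tendsto (fun m => φ (z m)) atTop (𝓝 w)) :
    Tendsto (fun m => ‖z m‖) atTop (𝓝 1) := by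
  rw [tendsto_order]
  refine ⟨fun r hr => ?_, fun r hr => ?_⟩
  · have hsub : closedBall (0 : ℂ) r ⊆ ball 0 1 := closedBall_subset_ball hr
    have hc : IsClosed (φ '' closedBall 0 r) :=
      ((isCompact_closedBall 0 r).image_of_continuousOn
        (hφ.bdd.diff.continuousOn.mono hsub)).isClosed
    have hwn : w ∉ φ '' closedBall 0 r := fun hmem =>
      hw (hφ.image ▸ image_mono hsub hmem)
    filter_upwards [h.eventually (hc.isOpen_compl.mem_nhds hwn)] with m hm
    by_contra hle
    exact hm (mem_image_of_mem φ (mem_closedBall_zero_iff.2 (not_lt.1 hle)))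
  · exact Eventually.of_forall fun m => (mem_ball_zero_iff.1 (hz m)).trans hr

/-- The zeroth summand is invariant, so normalized kernel vectors there are approximate eigenvectors
for w. Fredholmness would give a convergent subsequence. But kernel vectors have entries of modulus
at most 1 and norms tending to infinity, so the limit would be 0 and also a unit vector. -/
theorem not_isFredholm_model (hV : IsFrame n V) (hp : IsExponents n s p) (hφ : IsConformal φ Ω)
    (hn : 1 ≤ n) {w : ℂ} (hwc : w ∈ closure Ω) (hw : w ∉ Ω) :
    ¬ (w • (1 : H →L[ℂ] H) - model V hp hφ).IsFredholm := by
  intro hF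
  obtain ⟨y, hy, hyl⟩ := mem_closure_iff_seq_limit.1 hwc
  choose z hz hzy using fun m => (hφ.image.symm ▸ hy m : y m ∈ φ '' ball 0 1)
  have hz' : ∀ m, ‖z m‖ < 1 := fun m => mem_ball_zero_iff.1 (hz m)
  have hlim : Tendsto (fun m => φ (z m)) atTop (𝓝 w) := by simpa only [hzy] using hyl
  have hnorm := tendsto_norm_kernelVec (hp.mem 0) hz' (hφ.tendsto_norm hw hz hlim)
  set v : ℕ → SqSeq := fun m => kernelVec (p 0) (z m) with hv
  have hv0 : ∀ m, v m ≠ 0 := fun m h => by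
    have := kernelVec_zero (hp.mem 0).1 (hz' m)
    rw [show kernelVec (p 0) (z m) = 0 from h] at this
    simp at this
  set f : ℕ → SqSeq := fun m => ((‖v m‖⁻¹ : ℝ) : ℂ) • v m with hf
  have hf1 : ∀ m, ‖f m‖ = 1 := fun m => by
    rw [hf, norm_smul, Complex.norm_real, norm_inv, norm_norm,
      inv_mul_cancel₀ (norm_ne_zero_iff.2 (hv0 m))]
  have hu1 : ∀ m, ‖V 0 (f m)‖ = 1 := fun m => by rw [hV.norm_apply hn, hf1]
  have hD : ∀ m, (w • (1 : H →L[ℂ] H) - model V hp hφ) (V 0 (f m)) = (w - φ (z m)) • V 0 (f m) := by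
    intro m
    rw [_root_.sub_apply, _root_.smul_apply, one_apply_eq_self, model, hV.bidiag_zero _ _ hn, hf,
      map_smul (wToeplitz _ _), wToeplitz_kernelVec _ _ (hz' m), sub_smul, smul_comm, map_smul _ (φ (z m))]
  have h0 : Tendsto (fun m => (w • (1 : H →L[ℂ] H) - model V hp hφ) (V 0 (f m))) atTop (𝓝 0) := by
    rw [tendsto_zero_iff_norm_tendsto_zero]
    simp_rw [hD, norm_smul, hu1, mul_one]
    rw [← tendsto_zero_iff_norm_tendsto_zero]
    have := (tendsto_const_nhds (x := w)).sub hlim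
    rwa [sub_self] at this
  obtain ⟨x, ψ, hψ, hx⟩ := exists_tendsto_subseq_of_isFredholm hF hu1 h0
  have h1 : Tendsto (fun m => f (ψ m)) atTop (𝓝 (((V 0)†) x)) := by
    have h2 := (((V 0)†).continuous.tendsto x).comp hx
    have e : (fun m => f (ψ m)) = ((V 0)†) ∘ (fun m => V 0 (f m)) ∘ ψ := by
      funext m
      exact (hV.adj_self hn _).symm
    rw [e]
    exact h2
  have h2 : ((V 0)†) x = 0 := by
    ext i
    have h3 : Tendsto (fun m => f (ψ m) i) atTop (𝓝 ((((V 0)†) x) i)) := by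
      have h4 := ((coord i).continuous.tendsto _).comp h1
      simpa only [Function.comp_def, coord_apply] using h4
    have h5 : Tendsto (fun m => f (ψ m) i) atTop (𝓝 0) := by
      refine squeeze_zero_norm (fun m => ?_)
        ((tendsto_inv_atTop_zero.comp hnorm).comp hψ.tendsto_atTop)
      rw [hf, lp.coeFn_smul, Pi.smul_apply, norm_smul, Complex.norm_real, norm_inv, norm_norm, hv,
        kernelVec_apply (hp.mem 0).1 (hz' _), norm_div, norm_pow, Complex.norm_real,
        Real.norm_of_nonneg (weight_pos _ i).le]
      refine mul_le_of_le_one_right (inv_nonneg.2 (norm_nonneg _)) ?_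
      rw [div_le_one (weight_pos _ i)]
      exact (pow_le_one₀ (norm_nonneg _) (hz' _).le).trans (one_le_weight (hp.mem 0).1 i)
    rw [tendsto_nhds_unique h3 h5]
    rfl
  have h3 := h1.norm
  simp only [hf1] at h3
  have h4 := tendsto_nhds_unique h3 tendsto_const_nhds
  rw [h2, norm_zero] at h4
  exact zero_ne_one h4

theorem fredholmDomain_inter_spectrum_model (hV : IsFrame n V) (hp : IsExponents n s p)
    (hφ : IsConformal φ Ω) (hn : 1 ≤ n) :
    EssCowenDouglas.fredholmDomain (model V hp hφ) ∩ spectrum ℂ (model V hp hφ) = Ω := by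
  rw [spectrum_model hV hp hφ hn]
  refine Subset.antisymm (fun w ⟨h1, h2⟩ => ?_) fun w hw =>
    ⟨isFredholm_model hV hp hφ hw, subset_closure hw⟩
  by_contra h
  exact not_isFredholm_model hV hp hφ hn h2 h h1

end Model

end SqSeq

end

/-! ### The commutant of the model: strong irreducibility -/

section

open Filter Metric Set MeasureTheory
open scoped Topology ENNReal InnerProductSpace ComplexConjugate InnerProduct

namespace SqSeq
open DiscDirichlet

variable {φ : ℂ → ℂ} {Ω : Set ℂ}

theorem continuousOn_apply_kernelVec {q : ℝ} (hq : 0 ≤ q) (X : SqSeq →L[ℂ] SqSeq) :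
    ContinuousOn (fun z => X (kernelVec q z) 0) (ball 0 1) := by
  intro z hz
  obtain ⟨r, hzr, hr1⟩ := exists_between (mem_ball_zero_iff.1 hz)
  have hr0 : 0 ≤ r := (norm_nonneg z).trans hzr.le
  set y := ContinuousLinearMap.adjoint X (basisVec 0) with hy
  have h1 : ContinuousOn (fun z : ℂ => ∑' i, conj (y i) / (weight q i : ℂ) * z ^ i) (ball 0 r) := by
    refine continuousOn_tsum (u := fun i => ‖y‖ * r ^ i) (fun i => by fun_prop)
      ((summable_geometric_of_lt_one hr0 hr1).mul_left _) fun i x hx => ?_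
    rw [norm_mul, norm_pow]
    have hxr := (mem_ball_zero_iff.1 hx).le
    gcongr
    exact norm_div_weight_le hq y i
  have h2 : ContinuousAt (fun z => X (kernelVec q z) 0) z := by
    refine (h1.continuousAt (isOpen_ball.mem_nhds (mem_ball_zero_iff.2 hzr))).congr ?_
    filter_upwards [isOpen_ball.mem_nhds hz] with x hx
    exact (hasSum_apply_kernelVec hq X (mem_ball_zero_iff.1 hx)).tsum_eq
  exact h2.continuousWithinAt

/-- Eigenspaces are lines, so C multiplies the kernel vector at z by a scalar c(z) with c² = c. As c
is continuous on the connected disc, it is constant. -/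
theorem IsConformal.eq_zero_or_one_of_commute (hφ : IsConformal φ Ω) {p : ℝ}
    (hp : p ∈ Icc (0 : ℝ) (1 / 4)) {C : SqSeq →L[ℂ] SqSeq} (hC : C * C = C)
    (h : wToeplitz hφ.bdd hp * C = C * wToeplitz hφ.bdd hp) : C = 0 ∨ C = 1 := by
  have hCv : ∀ z : ℂ, ‖z‖ < 1 → C (kernelVec p z) = C (kernelVec p z) 0 • kernelVec p z := by
    intro z hz
    have hz' := mem_ball_zero_iff.2 hz
    refine eq_smul_kernelVec hφ.bdd hφ.inj hp hz' (hφ.der z hz') ?_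
    rw [← mul_apply_eq_comp, h, mul_apply_eq_comp, wToeplitz_kernelVec hφ.bdd hp hz, map_smul]
  have hmaps : MapsTo (fun z => C (kernelVec p z) 0) (ball 0 1) {0, 1} := by
    intro z hz
    have hz' := mem_ball_zero_iff.1 hz
    have h1 : C (C (kernelVec p z)) = C (kernelVec p z) := by rw [← mul_apply_eq_comp, hC]
    rw [hCv z hz', map_smul, hCv z hz', smul_smul] at h1
    have h2 := congrArg (fun f : SqSeq => f 0) h1
    simp only [lp.coeFn_smul, Pi.smul_apply, kernelVec_zero hp.1 hz', smul_eq_mul, mul_one] at h2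
    have h3 : C (kernelVec p z) 0 * (C (kernelVec p z) 0 - 1) = 0 := by rw [mul_sub, h2, mul_one, sub_self]
    rcases mul_eq_zero.1 h3 with h4 | h4
    · exact Or.inl h4
    · exact Or.inr (sub_eq_zero.1 h4)
  obtain ⟨c, hc, heq⟩ := (convex_ball (0 : ℂ) 1).isPreconnected.eqOn_const_of_mapsTo
    (toFinite ({0, 1} : Set ℂ)).isDiscrete (continuousOn_apply_kernelVec hp.1 C) hmaps ⟨0, by simp⟩
  have hval : ∀ z : ℂ, ‖z‖ < 1 → C (kernelVec p z) = c • kernelVec p z := fun z hz => by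
    rw [hCv z hz]
    exact congrArg (· • kernelVec p z) (heq (mem_ball_zero_iff.2 hz))
  rcases hc with rfl | rfl
  · exact Or.inl (ext_kernelVec hp.1 fun z hz => by rw [hval z hz, zero_smul, _root_.zero_apply])
  · exact Or.inr (ext_kernelVec hp.1 fun z hz => by rw [hval z hz, one_smul, one_apply_eq_self])

variable {H : Type*} [NormedAddCommGroup H] [InnerProductSpace ℂ H] [CompleteSpace H]

/-- The entries of the matrix of an operator. -/
noncomputable def entry (V : ℕ → SqSeq →L[ℂ] H) (E : H →L[ℂ] H) (i j : ℕ) : SqSeq →L[ℂ] SqSeq :=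
  ((V i)†) ∘L E ∘L V j

theorem entry_apply (V : ℕ → SqSeq →L[ℂ] H) (E : H →L[ℂ] H) (i j : ℕ) (f : SqSeq) :
    entry V E i j f = ((V i)†) (E (V j f)) := rfl

section Model

variable {n : ℕ} {s : ℝ} {p : ℕ → ℝ} {V : ℕ → SqSeq →L[ℂ] H}

theorem entry_of_le (hV : IsFrame n V) (E : H →L[ℂ] H) {i : ℕ} (hi : n ≤ i) (j : ℕ) :
    entry V E i j = 0 := by
  ext f : 1
  rw [entry_apply, hV.adj_of_le hi, _root_.zero_apply]

theorem entry_commutator_zero (hV : IsFrame n V) (hp : IsExponents n s p) (hφ : IsConformal φ Ω)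
    {E : H →L[ℂ] H} (hE : Commute E (model V hp hφ)) {i : ℕ} (hi : i < n) :
    wToeplitz hφ.bdd (hp.mem i) * entry V E i 0 + diagOp s hp.pos.le * entry V E (i + 1) 0 =
      entry V E i 0 * wToeplitz hφ.bdd (hp.mem 0) := by
  ext f : 1
  rw [_root_.add_apply, mul_apply_eq_comp, mul_apply_eq_comp, mul_apply_eq_comp, entry_apply,
    entry_apply, entry_apply, ← hV.bidiag_zero (fun j => wToeplitz hφ.bdd (hp.mem j))
      (diagOp s hp.pos.le) (by omega : 0 < n), ← hV.adj_bidiag (fun j => wToeplitz hφ.bdd (hp.mem j))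
      (diagOp s hp.pos.le) _ hi]
  exact congrArg ((V i)†) (DFunLike.congr_fun hE (V 0 f)).symm

theorem entry_commutator_succ (hV : IsFrame n V) (hp : IsExponents n s p) (hφ : IsConformal φ Ω)
    {E : H →L[ℂ] H} (hE : Commute E (model V hp hφ)) {i j : ℕ} (hi : i < n) (hj : j + 1 < n) :
    wToeplitz hφ.bdd (hp.mem i) * entry V E i (j + 1) +
        diagOp s hp.pos.le * entry V E (i + 1) (j + 1) =
      entry V E i (j + 1) * wToeplitz hφ.bdd (hp.mem (j + 1)) +
        entry V E i j * diagOp s hp.pos.le := by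
  ext f : 1
  rw [_root_.add_apply, _root_.add_apply, mul_apply_eq_comp, mul_apply_eq_comp, mul_apply_eq_comp,
    mul_apply_eq_comp, entry_apply, entry_apply, entry_apply, entry_apply, ← map_add, ← map_add,
    ← hV.bidiag_succ (fun j => wToeplitz hφ.bdd (hp.mem j)) (diagOp s hp.pos.le) hj,
    ← hV.adj_bidiag (fun j => wToeplitz hφ.bdd (hp.mem j)) (diagOp s hp.pos.le) _ hi]
  exact congrArg ((V i)†) (DFunLike.congr_fun hE (V (j + 1) f)).symm

/-- The entries of an operator in the commutant of the model intertwine the diagonal entries. -/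
theorem entry_intertwines (hV : IsFrame n V) (hp : IsExponents n s p) (hφ : IsConformal φ Ω)
    {E : H →L[ℂ] H} (hE : Commute E (model V hp hφ)) {i j : ℕ} (hi : i < n) (hj : j < n) :
    wToeplitz hφ.bdd (hp.mem i) * entry V E i j = entry V E i j * wToeplitz hφ.bdd (hp.mem j) := by
  -- The commutation relation expresses A_i E_{ij} - E_{ij} A_j through E_{i,j-1} and E_{i+1,j};
  -- both have a smaller value of j + (n - i).
  suffices h : ∀ m i j, i < n → j < n → j + (n - i) = m →
      wToeplitz hφ.bdd (hp.mem i) * entry V E i j = entry V E i j * wToeplitz hφ.bdd (hp.mem j) from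
    h _ i j hi hj rfl
  clear hi hj i j
  intro m
  induction m with
  | zero => exact fun i j hi hj h => absurd h (by omega)
  | succ m ih =>
    intro i j hi hj hm
    have hG : wToeplitz hφ.bdd (hp.mem i) * (diagOp s hp.pos.le * entry V E (i + 1) j) =
        diagOp s hp.pos.le * entry V E (i + 1) j * wToeplitz hφ.bdd (hp.mem j) := by
      rcases Nat.lt_or_ge (i + 1) n with h | h
      · rw [← mul_assoc, wToeplitz_mul_diagOp hφ.bdd hp.pos.le (hp.mem i) (hp.mem (i + 1))
          (hp.step i h), mul_assoc, ih (i + 1) j h hj (by omega), mul_assoc]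
      · rw [entry_of_le hV E h, mul_zero, mul_zero, zero_mul]
    -- By induction A_i E_{ij} - E_{ij} A_j is itself an intertwiner. Property (H) with Z = E_{ij}
    -- makes it vanish.
    rw [← sub_eq_zero]
    rcases j with _ | j
    · have h1 := entry_commutator_zero hV hp hφ hE hi
      have hX : wToeplitz hφ.bdd (hp.mem i) * entry V E i 0 -
          entry V E i 0 * wToeplitz hφ.bdd (hp.mem 0) =
          -(diagOp s hp.pos.le * entry V E (i + 1) 0) := by
        rw [← h1]
        abel
      refine eq_zero_of_intertwines hφ.bdd hφ.inj hφ.der (hp.mem i) (hp.mem 0) ?_ rfl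
      rw [hX, mul_neg, neg_mul, hG]
    · have h1 := entry_commutator_succ hV hp hφ hE hi hj
      have hX : wToeplitz hφ.bdd (hp.mem i) * entry V E i (j + 1) -
          entry V E i (j + 1) * wToeplitz hφ.bdd (hp.mem (j + 1)) =
          entry V E i j * diagOp s hp.pos.le - diagOp s hp.pos.le * entry V E (i + 1) (j + 1) := by
        rw [sub_eq_sub_iff_add_eq_add, h1]
        abel
      have hF : wToeplitz hφ.bdd (hp.mem i) * (entry V E i j * diagOp s hp.pos.le) =
          entry V E i j * diagOp s hp.pos.le * wToeplitz hφ.bdd (hp.mem (j + 1)) := by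
        rw [← mul_assoc, ih i j hi (by omega) (by omega), mul_assoc,
          wToeplitz_mul_diagOp hφ.bdd hp.pos.le (hp.mem j) (hp.mem (j + 1)) (hp.step j hj), mul_assoc]
      refine eq_zero_of_intertwines hφ.bdd hφ.inj hφ.der (hp.mem i) (hp.mem (j + 1)) ?_ rfl
      rw [hX, mul_sub, sub_mul, hG, hF]

theorem entry_succ_zero (hV : IsFrame n V) (hp : IsExponents n s p) (hφ : IsConformal φ Ω)
    {E : H →L[ℂ] H} (hE : Commute E (model V hp hφ)) {i : ℕ} (hi : i + 1 < n) (f : SqSeq) :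
    entry V E (i + 1) 0 f = 0 := by
  have h1 := entry_commutator_zero hV hp hφ hE (i := i) (by omega)
  rw [entry_intertwines hV hp hφ hE (by omega) (by omega), add_eq_left] at h1
  exact diagOp_injective hp.pos.le (DFunLike.congr_fun h1 f)

theorem diagOp_entry_succ (hV : IsFrame n V) (hp : IsExponents n s p) (hφ : IsConformal φ Ω)
    {E : H →L[ℂ] H} (hE : Commute E (model V hp hφ)) {i j : ℕ} (hi : i < n) (hj : j + 1 < n)
    (f : SqSeq) : diagOp s hp.pos.le (entry V E (i + 1) (j + 1) f) =
      entry V E i j (diagOp s hp.pos.le f) := by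
  have h1 := entry_commutator_succ hV hp hφ hE hi hj
  rw [entry_intertwines hV hp hφ hE hi hj, add_right_inj] at h1
  exact DFunLike.congr_fun h1 f

theorem apply_frame_zero (hV : IsFrame n V) (hp : IsExponents n s p) (hφ : IsConformal φ Ω)
    {E : H →L[ℂ] H} (hE : Commute E (model V hp hφ)) (hn : 1 ≤ n) (f : SqSeq) :
    E (V 0 f) = V 0 (entry V E 0 0 f) := by
  refine hV.ext fun i hi => ?_
  rw [hV.adj _ _ _ hn]
  rcases i with _ | i
  · rw [if_pos rfl, entry_apply]
  · rw [if_neg (Nat.succ_ne_zero i), ← entry_apply, entry_succ_zero hV hp hφ hE hi]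

/-- Induction over the columns. If column j vanishes, then D E_{i+1,j+1} = E_{ij} D = 0 and
injectivity of D leave only row 0 in column j + 1. There E maps into the zeroth summand, which it
annihilates, so E² = E gives zero. -/
theorem eq_zero_of_entry_zero (hV : IsFrame n V) (hp : IsExponents n s p) (hφ : IsConformal φ Ω)
    {E : H →L[ℂ] H} (hE : Commute E (model V hp hφ)) (hn : 1 ≤ n) (hEE : E * E = E)
    (h0 : entry V E 0 0 = 0) : E = 0 := by
  have h : ∀ j < n, ∀ f, E (V j f) = 0 := by
    intro j
    induction j with
    | zero =>
      intro _ f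
      rw [apply_frame_zero hV hp hφ hE hn, h0, _root_.zero_apply, map_zero]
    | succ j ih =>
      intro hj f
      have h1 : E (V (j + 1) f) = V 0 (entry V E 0 (j + 1) f) := by
        refine hV.ext fun i hi => ?_
        rw [hV.adj _ _ _ hn]
        rcases i with _ | i
        · rw [if_pos rfl, entry_apply]
        · rw [if_neg (Nat.succ_ne_zero i), ← entry_apply]
          refine diagOp_injective hp.pos.le ?_
          rw [diagOp_entry_succ hV hp hφ hE (by omega) hj, entry_apply, ih (by omega), map_zero]
      have h2 : E (E (V (j + 1) f)) = E (V (j + 1) f) := by rw [← mul_apply_eq_comp, hEE]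
      rw [← h2, h1, apply_frame_zero hV hp hφ hE hn, h0, _root_.zero_apply, map_zero]
  ext x
  rw [← hV.sum_eq x, map_sum, _root_.zero_apply]
  exact Finset.sum_eq_zero fun j hj => h j (Finset.mem_range.1 hj) _

theorem isStronglyIrreducible_model (hV : IsFrame n V) (hp : IsExponents n s p)
    (hφ : IsConformal φ Ω) (hn : 1 ≤ n) :
    EssCowenDouglas.IsStronglyIrreducible (model V hp hφ) := by
  intro E hEE hE
  have hidem : entry V E 0 0 * entry V E 0 0 = entry V E 0 0 := by
    ext f : 1
    rw [mul_apply_eq_comp, entry_apply V E 0 0 (entry V E 0 0 f), ← apply_frame_zero hV hp hφ hE hn,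
      ← mul_apply_eq_comp, hEE, entry_apply]
  rcases hφ.eq_zero_or_one_of_commute (hp.mem 0) hidem
    (entry_intertwines hV hp hφ hE (by omega) (by omega)) with h | h
  · exact Or.inl (eq_zero_of_entry_zero hV hp hφ hE hn hEE h)
  · refine Or.inr (sub_eq_zero.1 (eq_zero_of_entry_zero hV hp hφ (E := 1 - E)
      ((Commute.one_left _).sub_left hE) hn ?_ ?_)).symm
    · rw [mul_sub, sub_mul, sub_mul, one_mul, one_mul, mul_one, hEE, sub_self, sub_zero]
    · ext f : 1
      rw [entry_apply, _root_.sub_apply, one_apply_eq_self, map_sub, hV.adj_self (by omega),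
        ← entry_apply, h, one_apply_eq_self, sub_self, _root_.zero_apply]

end Model

/-! ### Essential normality of the model -/

section EssentialNormality

theorem isEssNormal_of_compact_perturbation {D T : H →L[ℂ] H} (hD : EssCowenDouglas.IsEssNormal D)
    (hT : IsCompactOperator (T - D)) : EssCowenDouglas.IsEssNormal T := by
  set K := T - D with hK
  have hKs : IsCompactOperator (star K : H →L[ℂ] H) := by
    rw [ContinuousLinearMap.star_eq_adjoint]
    exact hT.adjoint_hilbert
  have e : star T * T - T * star T = (star D * D - D * star D) + (star D * K + star K * D +
      star K * K - D * star K - K * star D - K * star K) := by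
    have hTD : T = D + K := by rw [hK, add_sub_cancel]
    rw [hTD, star_add]
    noncomm_ring
  have hl : ∀ A C : H →L[ℂ] H, IsCompactOperator C → IsCompactOperator (A * C) :=
    fun A C h => h.clm_comp A
  have hr : ∀ A C : H →L[ℂ] H, IsCompactOperator C → IsCompactOperator (C * A) :=
    fun A C h => h.comp_clm A
  rw [EssCowenDouglas.IsEssNormal, EssCowenDouglas.EqModCompact, e]
  exact IsCompactOperator.add hD (((((((hl _ _ hT).add (hr _ _ hKs)).add (hl _ _ hT)).sub
    (hl _ _ hKs)).sub (hr _ _ hT)).sub (hl _ _ hKs)))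

variable {n : ℕ} {s : ℝ} {p : ℕ → ℝ} {V : ℕ → SqSeq →L[ℂ] H}

/-- The direct sum of `n` copies of an operator. -/
noncomputable def ampl (n : ℕ) (V : ℕ → SqSeq →L[ℂ] H) (A : SqSeq →L[ℂ] SqSeq) : H →L[ℂ] H :=
  ∑ j ∈ Finset.range n, V j ∘L A ∘L ((V j)†)

theorem ampl_mul (hV : IsFrame n V) (A C : SqSeq →L[ℂ] SqSeq) :
    ampl n V A * ampl n V C = ampl n V (A * C) := by
  ext x
  have h : ∀ (A : SqSeq →L[ℂ] SqSeq) x, ampl n V A x = ∑ j ∈ Finset.range n, V j (A (((V j)†) x)) :=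
    fun A x => by
      rw [ampl, _root_.sum_apply]
      rfl
  rw [mul_apply_eq_comp, h, h, h]
  refine Finset.sum_congr rfl fun j hj => ?_
  rw [hV.adj_sum (fun j => C (((V j)†) x)) (Finset.mem_range.1 hj), mul_apply_eq_comp]

theorem star_ampl (A : SqSeq →L[ℂ] SqSeq) : star (ampl n V A) = ampl n V (star A) := by
  rw [ampl, ampl, star_sum]
  refine Finset.sum_congr rfl fun j _ => ?_
  rw [ContinuousLinearMap.star_eq_adjoint, ContinuousLinearMap.star_eq_adjoint,
    ContinuousLinearMap.adjoint_comp, ContinuousLinearMap.adjoint_comp,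
    ContinuousLinearMap.adjoint_adjoint, ContinuousLinearMap.comp_assoc]

theorem isEssNormal_ampl_toeplitz (hV : IsFrame n V) {g : ℂ → ℂ} (hg : BoundedDirichlet g) :
    EssCowenDouglas.IsEssNormal (ampl n V (toeplitz hg)) := by
  have e : ampl n V (star (toeplitz hg) * toeplitz hg) - ampl n V (toeplitz hg * star (toeplitz hg)) =
      ∑ j ∈ Finset.range n, V j ∘L (star (toeplitz hg) * toeplitz hg -
        toeplitz hg * star (toeplitz hg)) ∘L ((V j)†) := by
    rw [ampl, ampl, ← Finset.sum_sub_distrib]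
    refine Finset.sum_congr rfl fun j _ => ?_
    rw [ContinuousLinearMap.sub_comp, ContinuousLinearMap.comp_sub]
  rw [EssCowenDouglas.IsEssNormal, EssCowenDouglas.EqModCompact, star_ampl, ampl_mul hV, ampl_mul hV, e]
  exact isCompactOperator_sum _ fun j _ =>
    ((isCompactOperator_toeplitz_selfCommutator hg).comp_clm ((V j)†)).clm_comp (V j)

/-- Modulo compacts the exponents disappear and so does the superdiagonal: what remains is n copies
of one essentially normal Toeplitz operator along an orthogonal decomposition. -/
theorem isEssNormal_model (hV : IsFrame n V) (hp : IsExponents n s p) (hφ : IsConformal φ Ω) :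
    EssCowenDouglas.IsEssNormal (model V hp hφ) := by
  refine isEssNormal_of_compact_perturbation (isEssNormal_ampl_toeplitz hV hφ.bdd) ?_
  have e : model V hp hφ - ampl n V (toeplitz hφ.bdd) = ∑ j ∈ Finset.range n, V j ∘L
      ((wToeplitz hφ.bdd (hp.mem j) - toeplitz hφ.bdd) ∘L ((V j)†) +
        diagOp s hp.pos.le ∘L ((V (j + 1))†)) := by
    rw [model, bidiag, ampl, ← Finset.sum_sub_distrib]
    refine Finset.sum_congr rfl fun j _ => ?_
    rw [← ContinuousLinearMap.comp_sub, ContinuousLinearMap.sub_comp]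
    congr 1
    abel
  rw [e]
  refine isCompactOperator_sum _ fun j _ => IsCompactOperator.clm_comp ?_ (V j)
  exact IsCompactOperator.add ((isCompactOperator_wToeplitz_sub hφ.bdd (hp.mem j)).comp_clm ((V j)†))
    ((isCompactOperator_diagOp hp.pos).comp_clm ((V (j + 1))†))

end EssentialNormality

end SqSeq

end

/-! ### Operator matrix of the model and membership in `NCFB` -/

section

open Filter Metric Set MeasureTheory
open scoped Topology ENNReal InnerProductSpace ComplexConjugate InnerProduct

theorem EssCowenDouglas.IsCowenDouglas.of_equiv {E F : Type*} [NormedAddCommGroup E] [NormedSpace ℂ E]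
    [NormedAddCommGroup F] [NormedSpace ℂ F] {n : ℕ} {Ω : Set ℂ} {S : E →L[ℂ] E} {T : F →L[ℂ] F}
    (e : E ≃L[ℂ] F) (h : ∀ x, T (e x) = e (S x)) (hS : EssCowenDouglas.IsCowenDouglas n Ω S) :
    EssCowenDouglas.IsCowenDouglas n Ω T := by
  have hw : ∀ (w : ℂ) x, (T - w • (1 : F →L[ℂ] F)) (e x) = e ((S - w • (1 : E →L[ℂ] E)) x) := fun w x => by
    rw [_root_.sub_apply, _root_.sub_apply, map_sub, h, _root_.smul_apply, _root_.smul_apply,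
      one_apply_eq_self, one_apply_eq_self, map_smul]
  have hmap : ∀ w : ℂ, (T - w • (1 : F →L[ℂ] F)).ker =
      (S - w • (1 : E →L[ℂ] E)).ker.map (e.toLinearEquiv : E →ₗ[ℂ] F) := fun w => by
    ext y
    obtain ⟨x, rfl⟩ := e.surjective y
    constructor
    · intro hy
      rw [LinearMap.mem_ker, ContinuousLinearMap.coe_coe, hw] at hy
      exact ⟨x, (map_eq_zero_iff e e.injective).1 hy, rfl⟩
    · rintro ⟨x', hx', hxx⟩
      have : x' = x := e.injective hxx
      rw [LinearMap.mem_ker, ContinuousLinearMap.coe_coe, hw, ← this]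
      rw [SetLike.mem_coe, LinearMap.mem_ker, ContinuousLinearMap.coe_coe] at hx'
      rw [hx', map_zero]
  refine ⟨fun w hwΩ y => ?_, fun w hwΩ => ?_, ?_⟩
  · obtain ⟨x, hx⟩ := hS.surj w hwΩ (e.symm y)
    exact ⟨e x, by rw [hw, hx, e.apply_symm_apply]⟩
  -- E and F may live in different universes, so the two ranks are compared after lifting.
  · have h1 := (e.toLinearEquiv.submoduleMap (S - w • (1 : E →L[ℂ] E)).ker).lift_rank_eq
    rw [hS.dim_ker w hwΩ, Cardinal.lift_natCast, eq_comm, Cardinal.lift_eq_nat_iff] at h1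
    rw [hmap]
    exact h1
  · rw [eq_top_iff]
    intro y _
    have hle : (⨆ w ∈ Ω, (S - w • (1 : E →L[ℂ] E)).ker).topologicalClosure ≤
        (⨆ w ∈ Ω, (T - w • (1 : F →L[ℂ] F)).ker).topologicalClosure.comap
          (e.toLinearEquiv : E →ₗ[ℂ] F) := by
      refine Submodule.topologicalClosure_minimal _ (iSup₂_le fun w hwΩ x hx => ?_)
        ((Submodule.isClosed_topologicalClosure _).preimage e.continuous)
      refine Submodule.le_topologicalClosure _ (Submodule.mem_iSup_of_mem w
        (Submodule.mem_iSup_of_mem hwΩ ?_))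
      rw [hmap]
      exact Submodule.mem_map_of_mem hx
    rw [hS.span_ker] at hle
    have h1 := hle (Submodule.mem_top (x := e.symm y))
    rw [Submodule.mem_comap] at h1
    simpa using h1

namespace SqSeq
open DiscDirichlet EssCowenDouglas

variable {φ : ℂ → ℂ} {Ω : Set ℂ}
variable {H : Type*} [NormedAddCommGroup H] [InnerProductSpace ℂ H] [CompleteSpace H]
variable {n : ℕ} {s : ℝ} {p : ℕ → ℝ} {V : ℕ → SqSeq →L[ℂ] H}

/-- The orthogonal projections onto the summands of a frame. -/
noncomputable def frameProj (n : ℕ) (V : ℕ → SqSeq →L[ℂ] H) (j : Fin n) : H →L[ℂ] H :=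
  V j ∘L ((V j)†)

theorem frameProj_apply (j : Fin n) (x : H) : frameProj n V j x = V j (((V j)†) x) := rfl

theorem isDecomposition_frameProj (hV : IsFrame n V) : IsDecomposition (frameProj n V) where
  idem j := by
    ext x
    rw [mul_apply_eq_comp, frameProj_apply, frameProj_apply, hV.adj_self j.2]
  mul_eq_zero k j hkj := by
    ext x
    rw [mul_apply_eq_comp, frameProj_apply, frameProj_apply, hV.adj _ _ _ j.2,
      if_neg fun h => hkj (Fin.ext h), map_zero, _root_.zero_apply]
  sum_eq_one := by
    ext x
    rw [_root_.sum_apply, one_apply_eq_self]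
    conv_rhs => rw [← hV.sum_eq x]
    exact Fin.sum_univ_eq_sum_range (fun j => V j (((V j)†) x)) n

theorem star_frameProj (j : Fin n) : star (frameProj n V j) = frameProj n V j := by
  rw [frameProj, ContinuousLinearMap.star_eq_adjoint, ContinuousLinearMap.adjoint_comp,
    ContinuousLinearMap.adjoint_adjoint]

/-- The identification of `ℓ²` with the range of a frame projection. -/
noncomputable def frameEquiv (hV : IsFrame n V) (j : Fin n) : SqSeq ≃L[ℂ] (frameProj n V j).range :=
  ContinuousLinearEquiv.equivOfInverse ((frameProj n V j).rangeRestrict ∘L V j)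
    (((V j)†) ∘L (frameProj n V j).range.subtypeL)
    (fun f => by
      change ((V j)†) (frameProj n V j (V j f)) = f
      rw [frameProj_apply, hV.adj_self j.2, hV.adj_self j.2])
    (fun x => by
      obtain ⟨_, y, rfl⟩ := x
      refine Subtype.ext ?_
      change frameProj n V j (V j (((V j)†) (frameProj n V j y))) = frameProj n V j y
      simp only [frameProj_apply, hV.adj_self j.2])

theorem coe_frameEquiv (hV : IsFrame n V) (j : Fin n) (f : SqSeq) :
    ((frameEquiv hV j f : (frameProj n V j).range) : H) = V j f := by
  change frameProj n V j (V j f) = V j f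
  rw [frameProj_apply, hV.adj_self j.2]

theorem block_frameEquiv (hV : IsFrame n V) (T : H →L[ℂ] H) (k j : Fin n) (f : SqSeq) :
    block (frameProj n V) T k j (frameEquiv hV j f) = frameEquiv hV k (entry V T k j f) := by
  refine Subtype.ext ?_
  rw [coe_frameEquiv, entry_apply, ← coe_frameEquiv hV j f]
  rfl

theorem block_eq_zero (hV : IsFrame n V) {T : H →L[ℂ] H} {k j : Fin n} (h : entry V T k j = 0) :
    block (frameProj n V) T k j = 0 := by
  ext x : 1
  obtain ⟨f, rfl⟩ := (frameEquiv hV j).surjective x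
  rw [block_frameEquiv, h, _root_.zero_apply, map_zero, _root_.zero_apply]

theorem block_one_self (hV : IsFrame n V) (k : Fin n) :
    block (frameProj n V) (1 : H →L[ℂ] H) k k = 1 := by
  ext x : 1
  obtain ⟨f, rfl⟩ := (frameEquiv hV k).surjective x
  rw [block_frameEquiv, entry_apply, one_apply_eq_self, hV.adj_self k.2, one_apply_eq_self]

theorem entry_model (hV : IsFrame n V) (hp : IsExponents n s p) (hφ : IsConformal φ Ω) {k j : ℕ}
    (hk : k < n) (hj : j < n) (f : SqSeq) : entry V (model V hp hφ) k j f =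
      (if k = j then wToeplitz hφ.bdd (hp.mem k) f else 0) +
        if k + 1 = j then diagOp s hp.pos.le f else 0 := by
  rw [entry_apply, model, hV.adj_bidiag _ _ _ hk, hV.adj _ _ _ hj, hV.adj _ _ _ hj]
  split_ifs <;> simp

theorem entry_model_self (hV : IsFrame n V) (hp : IsExponents n s p) (hφ : IsConformal φ Ω)
    {k : ℕ} (hk : k < n) (f : SqSeq) :
    entry V (model V hp hφ) k k f = wToeplitz hφ.bdd (hp.mem k) f := by
  rw [entry_model hV hp hφ hk hk, if_pos rfl, if_neg (by omega), add_zero]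

theorem entry_model_eq_zero (hV : IsFrame n V) (hp : IsExponents n s p) (hφ : IsConformal φ Ω)
    {k j : ℕ} (hk : k < n) (hj : j < n) (h : k ≠ j) (h' : k + 1 ≠ j) :
    entry V (model V hp hφ) k j = 0 := by
  ext f : 1
  rw [entry_model hV hp hφ hk hj, if_neg h, if_neg h', add_zero, _root_.zero_apply]

theorem adj_diagPart_model (hV : IsFrame n V) (hp : IsExponents n s p) (hφ : IsConformal φ Ω)
    {i : ℕ} (hi : i < n) (x : H) : ((V i)†) (diagPart (frameProj n V) (model V hp hφ) x) =
      wToeplitz hφ.bdd (hp.mem i) (((V i)†) x) := by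
  have e : diagPart (frameProj n V) (model V hp hφ) x = ∑ j ∈ Finset.range n,
      V j (entry V (model V hp hφ) j j (((V j)†) x)) := by
    rw [diagPart, _root_.sum_apply]
    exact Fin.sum_univ_eq_sum_range
      (fun j => V j (entry V (model V hp hφ) j j (((V j)†) x))) n
  rw [e, hV.adj_sum (fun j => entry V (model V hp hφ) j j (((V j)†) x)) hi,
    entry_model_self hV hp hφ hi]

/-- The superdiagonal entries intertwine consecutive diagonal entries, by `wToeplitz_mul_diagOp`. -/
theorem commute_diagPart_model (hV : IsFrame n V) (hp : IsExponents n s p) (hφ : IsConformal φ Ω) :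
    Commute (diagPart (frameProj n V) (model V hp hφ)) (model V hp hφ) := by
  refine ContinuousLinearMap.ext fun x => hV.ext fun i hi => ?_
  have hT : ∀ y, ((V i)†) (model V hp hφ y) = wToeplitz hφ.bdd (hp.mem i) (((V i)†) y) +
      diagOp s hp.pos.le (((V (i + 1))†) y) := fun y => hV.adj_bidiag _ _ y hi
  rw [mul_apply_eq_comp, mul_apply_eq_comp, adj_diagPart_model hV hp hφ hi, hT, hT, map_add,
    adj_diagPart_model hV hp hφ hi]
  congr 1
  rcases Nat.lt_or_ge (i + 1) n with h | h
  · rw [adj_diagPart_model hV hp hφ h, ← mul_apply_eq_comp, ← mul_apply_eq_comp,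
      wToeplitz_mul_diagOp hφ.bdd hp.pos.le (hp.mem i) (hp.mem (i + 1)) (hp.step i h)]
  · rw [hV.adj_of_le h, hV.adj_of_le h, map_zero, map_zero]

/-- The factor C is the diagonal entry itself for d = 0, the identity for d = 1, and zero for d ≥ 2,
where the bidiagonal matrix has no entry. -/
theorem exists_block_factor (hV : IsFrame n V) (hp : IsExponents n s p) (hφ : IsConformal φ Ω)
    (d : ℕ) (k j : Fin n) (h : (k : ℕ) + d = j) :
    ∃ C : (frameProj n V k).range →L[ℂ] (frameProj n V k).range,
      Commute C (block (frameProj n V) (model V hp hφ) k k) ∧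
        block (frameProj n V) (model V hp hφ) k j =
          C ∘L superdiagProd (frameProj n V) (model V hp hφ) d k j h := by
  match d, h with
  | 0, h =>
    obtain rfl : k = j := Fin.ext h
    refine ⟨_, Commute.refl _, ?_⟩
    rw [superdiagProd, block_one_self hV]
    rfl
  | 1, h =>
    obtain ⟨j, hj⟩ := j
    obtain rfl : (k : ℕ) + 1 = j := h
    refine ⟨1, Commute.one_left _, ?_⟩
    rw [superdiagProd, superdiagProd, block_one_self hV]
    rfl
  | d + 2, h =>
    refine ⟨0, Commute.zero_left _, ?_⟩
    rw [block_eq_zero hV (entry_model_eq_zero hV hp hφ k.2 j.2 (by omega) (by omega)),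
      ContinuousLinearMap.zero_comp]

theorem propertyH_block_model (hV : IsFrame n V) (hp : IsExponents n s p) (hφ : IsConformal φ Ω)
    (k j : Fin n) : PropertyH (block (frameProj n V) (model V hp hφ) k k)
      (block (frameProj n V) (model V hp hφ) j j) := by
  rintro X hX ⟨Z, hZ⟩
  have hU : ∀ (k : Fin n) f, block (frameProj n V) (model V hp hφ) k k (frameEquiv hV k f) =
      frameEquiv hV k (wToeplitz hφ.bdd (hp.mem k) f) := fun k f => by
    rw [block_frameEquiv, entry_model_self hV hp hφ k.2]
  have hUs : ∀ (k : Fin n) x, (frameEquiv hV k).symm (block (frameProj n V) (model V hp hφ) k k x) =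
      wToeplitz hφ.bdd (hp.mem k) ((frameEquiv hV k).symm x) := fun k x => by
    obtain ⟨f, rfl⟩ := (frameEquiv hV k).surjective x
    rw [hU, ContinuousLinearEquiv.symm_apply_apply, ContinuousLinearEquiv.symm_apply_apply]
  let pull : ((frameProj n V j).range →L[ℂ] (frameProj n V k).range) → (SqSeq →L[ℂ] SqSeq) :=
    fun Y => ((frameEquiv hV k).symm : _ →L[ℂ] SqSeq) ∘L Y ∘L (frameEquiv hV j : SqSeq →L[ℂ] _)
  have hpull : ∀ Y f, pull Y f = (frameEquiv hV k).symm (Y (frameEquiv hV j f)) := fun _ _ => rfl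
  have h0 : pull X = 0 := by
    refine eq_zero_of_intertwines hφ.bdd hφ.inj hφ.der (hp.mem k) (hp.mem j) (Z := pull Z) ?_ ?_
    · ext f : 1
      rw [mul_apply_eq_comp, mul_apply_eq_comp, hpull, hpull, ← hUs, ← hU]
      exact congrArg (frameEquiv hV k).symm (DFunLike.congr_fun hX (frameEquiv hV j f))
    · ext f : 1
      rw [_root_.sub_apply, mul_apply_eq_comp, mul_apply_eq_comp, hpull, hpull, hpull, ← hUs, ← hU,
        ← map_sub]
      exact congrArg (frameEquiv hV k).symm (DFunLike.congr_fun hZ (frameEquiv hV j f))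
  ext x : 1
  obtain ⟨f, rfl⟩ := (frameEquiv hV j).surjective x
  have h1 := DFunLike.congr_fun h0 f
  rw [hpull, _root_.zero_apply] at h1
  rw [_root_.zero_apply]
  exact (map_eq_zero_iff _ (frameEquiv hV k).symm.injective).1 h1

theorem isCFBWith_model (hV : IsFrame n V) (hp : IsExponents n s p) (hφ : IsConformal φ Ω) :
    IsCFBWith Ω (frameProj n V) (model V hp hφ) where
  cowenDouglas := isCowenDouglas_model hV hp hφ
  decomposition := isDecomposition_frameProj hV
  diag_cowenDouglas j := (hφ.isCowenDouglas (hp.mem j)).of_equiv (frameEquiv hV j) fun f => by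
    rw [block_frameEquiv, entry_model_self hV hp hφ j.2]
  upperTriangular k j h := block_eq_zero hV (entry_model_eq_zero hV hp hφ k.2 j.2
    (by have := Fin.lt_def.1 h; omega) (by have := Fin.lt_def.1 h; omega))
  diag_commute := commute_diagPart_model hV hp hφ
  factor k j hkj := exists_block_factor hV hp hφ _ k j _
  propertyH k j _ := propertyH_block_model hV hp hφ k j

theorem model_mem_NCFB (hV : IsFrame n V) (hp : IsExponents n s p) (hφ : IsConformal φ Ω) :
    model V hp hφ ∈ NCFB H n Ω := by
  refine ⟨isEssNormal_model hV hp hφ, frameProj n V, fun j => ?_, isCFBWith_model hV hp hφ⟩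
  rw [EqModCompact, star_frameProj, sub_self]
  exact isCompactOperator_zero

end SqSeq

end

/-! ### The existence theorem -/

theorem theorem3p2 {H : Type*} [NormedAddCommGroup H] [InnerProductSpace ℂ H] [CompleteSpace H]
    [TopologicalSpace.SeparableSpace H] (hH : ¬ FiniteDimensional ℂ H)
    (n : ℕ) (hn : 1 ≤ n) (Ω : Set ℂ) (hΩo : IsOpen Ω) (hΩb : Bornology.IsBounded Ω)
    (hΩs : IsSimplyConnected Ω) :
    (∃ T ∈ EssCowenDouglas.NCFB H n Ω,
      EssCowenDouglas.IsStronglyIrreducible T ∧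
      spectrum ℂ T = closure Ω ∧
      EssCowenDouglas.fredholmDomain T ∩ spectrum ℂ T = Ω ∧
      ∀ w ∈ Ω, EssCowenDouglas.fredholmIndex (w • (1 : H →L[ℂ] H) - T) = (n : ℤ)) ∧
    (EssCowenDouglas.NCFB H n Ω).Nonempty := by
  obtain ⟨g, hd, hinj, hder, him⟩ := RiemannMapping.exists_riemannMap hΩo hΩb hΩs
  have hφ : SqSeq.IsConformal g Ω :=
    ⟨DiscDirichlet.BoundedDirichlet.of_injOn hd hinj (him.symm ▸ hΩb), hinj, hder, him⟩
  obtain ⟨V, hV⟩ := SqSeq.exists_isFrame hH hn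
  obtain ⟨s, p, hp⟩ := SqSeq.exists_isExponents hn
  have hmem := SqSeq.model_mem_NCFB hV hp hφ
  exact ⟨⟨SqSeq.model V hp hφ, hmem, SqSeq.isStronglyIrreducible_model hV hp hφ hn,
    SqSeq.spectrum_model hV hp hφ hn, SqSeq.fredholmDomain_inter_spectrum_model hV hp hφ hn,
    fun w hw => SqSeq.fredholmIndex_model hV hp hφ hw⟩, ⟨_, hmem⟩⟩
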